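/- **Setting.** Let $M^4=\mathbb R^4$ with metric of signature $(+,-,-,-)$ and standard basis $e_0,\dots,e_3$, let $N\in\{e_0,e_3\}$, $t=N\cdot N=\pm1$, $V=N^{\perp}$, and let $SO(V)=\{G\in SO(1,3): GN=N\}$. All indices run over $\{0,\dots,4\}$. Let $v_{ij}\in V$ ($i\ne j$) be boundary data all of whose canonical normals equal $N$, with spacelike faces: $v_{ij}\cdot v_{ij}=-t\rho_{ij}^2$ with $\rho_{ij}>0$, and $\sum_{j\neq i}v_{ij}=0$ for every $i$. Assume that the data are non-degenerate: for every $i$, any three of the four vectors $v_{ij}$ are linearly independent. Let $M^{4\prime}$ be $\mathbb R^4$ with the flipped metric $g'_{\mu\nu}=g_{\mu\nu}-2N_\mu N_\nu/(N\cdot N)$ (signature $(-,-,-,-)$ if $N=e_0$ and $(+,+,-,-)$ if $N=e_3$), with scalar product $\cdot'$, Hodge star $\ast'$ ($\ast'(a\wedge b)$ is the contraction of $e_0\wedge e_1\wedge e_2\wedge e_3$ first with $a$ and then with $b$), inversion $I=-1$, reflections $R_n$ for $n\cdot' n=\pm1$, and $t'=N\cdot'N=-t$. *Solutions.* An $SO(M^{4\prime})$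 geometric solution for the flipped data is a family $G_i\in SO(M^{4\prime})$ with $G_i\,{\ast'}(v_{ij}\wedge N)=-G_j\,{\ast'}(v_{ji}\wedge N)$ for all $i\ne j$. It is non-degenerate if any four of the five vectors $G_iN$ span $\mathbb R^4$. Two solutions are gauge equivalent if $G_i'=G\,I^{s_i}G_i$ for some $G\in SO(M^{4\prime})$ and $s_i\in\{0,1\}$. *Vector geometries.* A vector geometry is a family $G_i\in SO(V)$ with $G_iv_{ij}=-G_jv_{ji}$ for all $i\neq j$; two are gauge equivalent if $G'_i=GG_i$ for some $G\in SO(V)$. *The maps $\varPhi^\pm$.* For a bivector $B$ put $\Phi^\pm(B)=t'(\pm B+{\ast'}B)\lrcorner' N\in V$, where $(a\wedge b)\lrcorner'N=(b\cdot'N)a-(a\cdot'N)b$. For $G\in SO(M^{4\prime})$ let $\varPhi^\pm(G)$ be the linear map that fixes $N$ and satisfies $\varPhi^\pm(G)\Phi^\pm(B)=\Phi^\pm(GB)$ for all bivectors $B$; explicitly $\varPhi^\pm(G)x=\Phi^\pm(G\,{\ast'}(x\wedge N))$ for $x\in V$. *Matching conditions.* For points $x_0,\dots,x_4$ put $B_{ij}(x)=\epsilon_{ij}\,(x_b-x_a)\wedge(x_c-x_a)$,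 where $a<b<c$ are the indices other than $i,j$, and $\epsilon_{ij}=(-1)^{i+j+1}$ if $i<j$, $\epsilon_{ij}=(-1)^{i+j}$ if $i>j$. For each $i$ the data determine, up to translation and inversion, a tetrahedron in $V$ with vertices $x_j$ ($j\ne i$) and face bivectors $B_{ij}(x)=r_i\,{\ast'}(v_{ij}\wedge N)$, $r_i=\pm1$. The lengths matching condition says that, for all $m,l$, the signed square length of the edge $ml$ is the same number $l_{ml}^2$ in all the tetrahedra $i\ne m,l$. A reconstructed non-degenerate $4$-simplex has affinely independent vertices $X_0,\dots,X_4$ with these signed square lengths. If it lies in $M^{4\prime}$, let $N_i^\Delta$ be its normalized outward normals, $v_{ij}^\Delta\perp N_i^\Delta$ the vectors with $B_{ij}(X)={\ast'}(v_{ij}^\Delta\wedge N_i^\Delta)$, and $G_i^\Delta$ the linear map with $G_i^\Delta N=N_i^\Delta$, $G_i^\Delta v_{ij}=v_{ij}^\Delta$ for $j\neq i$. The orientations matching condition says that for one (equivalently every) reconstructed simplex in $M^{4\prime}$ the signs $\det G_i^\Delta=\pm1$ do not depend on $i$. **Theorem.** The following are equivalent: 1. the lengths and orientations matching conditions hold,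 and the reconstructed $4$-simplex is non-degenerate of split $(+,+,-,-)$ or Euclidean $(-,-,-,-)$ signature; 2. there exists a non-degenerate $SO(M^{4\prime})$ geometric solution for the flipped data; 3. there exist exactly two gauge equivalence classes of non-degenerate $SO(M^{4\prime})$ geometric solutions for the flipped data; and if $\{G_i\}$ represents one of them, then for every $e$ with $e\cdot'e=\pm1$ the family $\tilde G_i=R_{e}G_iR_{N}$ represents the other; 4. there exist at least two gauge equivalence classes of vector geometries; 5. there exist exactly two gauge equivalence classes of vector geometries. Moreover, for every non-degenerate $SO(M^{4\prime})$ geometric solution $\{G_i\}$, the families $G_i^\pm=\varPhi^\pm(G_i)$ are gauge inequivalent vector geometries, and every vector geometry is gauge equivalent to one of them; and every ordered pair of gauge inequivalent vector geometries is, up to gauge equivalence, of the form $(\{\varPhi^+(G_i)\},\{\varPhi^-(G_i)\})$ for some such solution $\{G_i\}$. -/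

import Mathlib

noncomputable section

namespace SimplexGeometry

open Matrix

set_option linter.unusedSimpArgs false
set_option linter.unnecessarySeqFocus false

abbrev Vec := Fin 4 → ℝ

abbrev Mat := Matrix (Fin 4) (Fin 4) ℝ

/-! ### Linear algebra of a four-dimensional space with metric matrix `g`

A bivector is represented by its antisymmetric component matrix `B ^ (μ ν)`. -/

def dot (g : Mat) (x y : Vec) : ℝ := x ⬝ᵥ (g *ᵥ y)

/-- The components `a ^ μ * b ^ ν - b ^ μ * a ^ ν` of `a ∧ b`. -/
def wedge (a b : Vec) : Mat := vecMulVec a b - vecMulVec b a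

/-- The Levi-Civita symbol, with `ε 0 1 2 3 = 1`. -/
def leviCivita (a b c d : Fin 4) : ℝ :=
  (Matrix.of fun k : Fin 4 => (Pi.single (![a, b, c, d] k) 1 : Vec)).det

/-- The Hodge star on bivectors, `⋆(a ∧ b) = b ⌟ (a ⌟ Ω)` with `Ω = e₀ ∧ e₁ ∧ e₂ ∧ e₃`
(for a metric of determinant `±1`). The indices of `B` are lowered by `g * B * g`. -/
def hodge (g B : Mat) : Mat := Matrix.of fun ρ σ =>
  (1 / 2) * ∑ μ, ∑ ν, (g * B * g) μ ν * leviCivita μ ν ρ σ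

/-- The contraction of a bivector from the right, `(a ∧ b) ⌞ n = (b ⬝ n) a - (a ⬝ n) b`. -/
def contract (g B : Mat) (n : Vec) : Vec := B *ᵥ (g *ᵥ n)

/-- The action of a linear map on bivectors, `G (a ∧ b) = G a ∧ G b`. -/
def act (G B : Mat) : Mat := G * B * Gᵀ

def IsSO (g G : Mat) : Prop := Gᵀ * g * G = g ∧ G.det = 1

/-- The reflection with respect to a normalized vector `n`. -/
def reflection (g : Mat) (n : Vec) : Mat := 1 - (2 / dot g n n) • vecMulVec n (g *ᵥ n)

def IsNormalized (g : Mat) (n : Vec) : Prop := dot g n n = 1 ∨ dot g n n = -1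

/-! ### The spaces -/

def minkowski : Mat := Matrix.diagonal ![1, -1, -1, -1]

def splitMetric : Mat := Matrix.diagonal ![1, 1, -1, -1]

/-- The Euclidean signature, in the convention `(- - - -)`. -/
def euclideanMetric : Mat := Matrix.diagonal ![-1, -1, -1, -1]

def e0 : Vec := ![1, 0, 0, 0]

def e3 : Vec := ![0, 0, 0, 1]

/-- The metric of the flipped space `M⁴'`. -/
def flipped (N : Vec) : Mat :=
  minkowski - (2 / dot minkowski N N) • vecMulVec (minkowski *ᵥ N) (minkowski *ᵥ N)

/-! ### Boundary data

The vectors `v i j` with `i ≠ j` are the data; the values `v i i` are never used. -/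

/-- Geometric `SO(1,3)` boundary data all of whose canonical normals are equal to `N`,
with spacelike faces and the closure condition. -/
structure IsBoundaryData (N : Vec) (rho : Fin 5 → Fin 5 → ℝ) (v : Fin 5 → Fin 5 → Vec) :
    Prop where
  rho_pos : ∀ i j, i ≠ j → 0 < rho i j
  orthogonal : ∀ i j, i ≠ j → dot minkowski (v i j) N = 0
  norm_sq : ∀ i j, i ≠ j →
    dot minkowski (v i j) (v i j) = -(dot minkowski N N) * rho i j ^ 2
  closure : ∀ i, ∑ j ∈ Finset.univ.erase i, v i j = 0

/-- For every `i`, any three of the four vectors `v i j` are linearly independent. -/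
def IsNondegenerateData (v : Fin 5 → Fin 5 → Vec) : Prop :=
  ∀ i j k l, i ≠ j → i ≠ k → i ≠ l → j ≠ k → j ≠ l → k ≠ l →
    LinearIndependent ℝ ![v i j, v i k, v i l]

/-! ### Geometric solutions in a space with metric `g` -/

/-- The bivector `⋆(v i j ∧ N)`. -/
def dataBivector (g : Mat) (N : Vec) (v : Fin 5 → Fin 5 → Vec) (i j : Fin 5) : Mat :=
  hodge g (wedge (v i j) N)

/-- A geometric `SO(g)` solution (the closure condition is part of the boundary data). -/
def IsSolution (g : Mat) (N : Vec) (v : Fin 5 → Fin 5 → Vec) (G : Fin 5 → Mat) : Prop :=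
  (∀ i, IsSO g (G i)) ∧
    ∀ i j, i ≠ j → act (G i) (dataBivector g N v i j) = -act (G j) (dataBivector g N v j i)

/-- Every four of the five normals `G i N` span the whole space. -/
def IsNondegenerateFamily (N : Vec) (G : Fin 5 → Mat) : Prop :=
  ∀ k : Fin 5, Submodule.span ℝ ((fun i => G i *ᵥ N) '' {i | i ≠ k}) = ⊤

def IsNondegenerateSolution (g : Mat) (N : Vec) (v : Fin 5 → Fin 5 → Vec)
    (G : Fin 5 → Mat) : Prop :=
  IsSolution g N v G ∧ IsNondegenerateFamily N G

/-- Gauge equivalence `G' i = G I ^ (s i) (G i)`, where `I = -1` is the inversion. -/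
def SolutionEquiv (g : Mat) (G G' : Fin 5 → Mat) : Prop :=
  ∃ K : Mat, IsSO g K ∧ ∃ s : Fin 5 → Fin 2,
    ∀ i, G' i = K * (-1 : Mat) ^ (s i : ℕ) * G i

/-! ### Vector geometries -/

/-- The subgroup `SO(V)` of `SO(1,3)` fixing `N`. -/
def IsSOV (N : Vec) (G : Mat) : Prop := IsSO minkowski G ∧ G *ᵥ N = N

def IsVectorGeometry (N : Vec) (v : Fin 5 → Fin 5 → Vec) (G : Fin 5 → Mat) : Prop :=
  (∀ i, IsSOV N (G i)) ∧ ∀ i j, i ≠ j → G i *ᵥ v i j = -(G j *ᵥ v j i)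

def VectorGeometryEquiv (N : Vec) (G G' : Fin 5 → Mat) : Prop :=
  ∃ K : Mat, IsSOV N K ∧ ∀ i, G' i = K * G i

/-! ### The maps `Φ^±`, with the sign given by `σ = 1` or `σ = -1` -/

/-- `Φ^±(B) = t' (± B + ⋆' B) ⌞' N`, where `t' = N ⬝' N`. -/
def bivectorPhi (N : Vec) (σ : ℝ) (B : Mat) : Vec :=
  dot (flipped N) N N • contract (flipped N) (σ • B + hodge (flipped N) B) N

/-- The map `Φ^±` from `SO(M⁴')` to `SO(V)`, through which `G` acts on the image of `Φ^±` on
bivectors: it sends `x ⟂ N` to `Φ^±(G ⋆'(x ∧ N))`, where `Φ^±(⋆'(x ∧ N)) = x`, and it fixes `N`.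
The equivariance that characterizes it is `groupPhi_mulVec_bivectorPhi`. -/
def groupPhi (N : Vec) (σ : ℝ) (G : Mat) : Mat := Matrix.of fun μ ν =>
  (bivectorPhi N σ (act G (hodge (flipped N) (wedge (Pi.single ν 1) N)))
    + (dot (flipped N) (Pi.single ν 1) N / dot (flipped N) N N) • N) μ

/-! #### The equivariance of `Φ^±` -/

theorem leviCivita_eq (a b c d : Fin 4) : leviCivita a b c d =
    ∑ p : Equiv.Perm (Fin 4), ((Equiv.Perm.sign p : ℤ) : ℝ) *
      ((if p 0 = a then 1 else 0) * (if p 1 = b then 1 else 0) *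
        (if p 2 = c then 1 else 0) * (if p 3 = d then 1 else 0)) := by
  rw [leviCivita, ← Matrix.det_transpose, Matrix.det_apply']
  refine Finset.sum_congr rfl fun p _ => ?_
  simp [Fin.prod_univ_four, Matrix.transpose_apply, Pi.single_apply, -mul_ite, -ite_mul]
  congr

theorem leviCivita_map (G : Mat) (a b c d : Fin 4) :
    ∑ p, ∑ q, ∑ r, ∑ s, G a p * G b q * G c r * G d s * leviCivita p q r s =
      leviCivita a b c d * G.det := by
  have h1 : leviCivita a b c d * G.det =
      Matrix.det (Matrix.of fun k => fun l => G (![a, b, c, d] k) l) := by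
    rw [leviCivita, ← Matrix.det_mul]
    congr 1
    ext k l
    simp [Matrix.mul_apply, Pi.single_apply]
  rw [h1, ← Matrix.det_transpose, Matrix.det_apply']
  simp only [leviCivita_eq, Finset.mul_sum]
  have : ∀ p : Equiv.Perm (Fin 4), ((Equiv.Perm.sign p : ℤ) : ℝ) *
      ∏ i, (Matrix.transpose (Matrix.of fun k => fun l => G (![a, b, c, d] k) l) (p i) i) =
      ∑ p', ∑ q, ∑ r, ∑ s, G a p' * G b q * G c r * G d s * (((Equiv.Perm.sign p : ℤ) : ℝ) *
      ((if p 0 = p' then 1 else 0) * (if p 1 = q then 1 else 0) *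
        (if p 2 = r then 1 else 0) * (if p 3 = s then 1 else 0))) := by
    intro p
    simp [Fin.prod_univ_four, Matrix.transpose_apply]
    ring
  simp_rw [this]
  symm
  rw [Finset.sum_comm]
  refine Finset.sum_congr rfl fun i _ => ?_
  rw [Finset.sum_comm]
  refine Finset.sum_congr rfl fun j _ => ?_
  rw [Finset.sum_comm]
  refine Finset.sum_congr rfl fun k _ => ?_
  rw [Finset.sum_comm]

/-- The Hodge star commutes with rotations. -/
theorem hodge_act (g G B : Mat) (hg : gᵀ = g) (hgg : g * g = 1) (hG : IsSO g G) :
    hodge g (act G B) = act G (hodge g B) := by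
  obtain ⟨hG, hd⟩ := hG
  have hK : (g * G * g) * Gᵀ = 1 := by
    have h : (g * Gᵀ * g) * G = 1 := by
      rw [Matrix.mul_assoc, Matrix.mul_assoc, ← Matrix.mul_assoc Gᵀ, hG, hgg]
    have h2 := congrArg Matrix.transpose (mul_eq_one_comm.1 h)
    simpa [Matrix.transpose_mul, hg, Matrix.mul_assoc] using h2
  have hK' : Gᵀ * (g * G * g) = 1 := mul_eq_one_comm.1 hK
  have hL : g * act G B * g = (g * G * g) * (g * B * g) * (g * G * g)ᵀ := by
    simp only [act, Matrix.transpose_mul, hg]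
    calc g * (G * B * Gᵀ) * g = g * G * 1 * B * 1 * Gᵀ * g := by simp [Matrix.mul_assoc]
      _ = _ := by rw [← hgg]; simp only [Matrix.mul_assoc]
  generalize hKd : g * G * g = K at *
  generalize hLd : g * B * g = L at *
  have e : ∀ a b r s, leviCivita a b r s =
      ∑ p, ∑ q, ∑ t, ∑ u, G a p * G b q * G r t * G s u * leviCivita p q t u := by
    intro a b r s; rw [leviCivita_map, hd, mul_one]
  ext ρ τ
  set E : Fin 4 → Fin 4 → Mat := fun t u => Matrix.of fun p q => leviCivita p q t u with hE
  have hs : ∀ (M : Mat) (t u : Fin 4), ∑ μ, ∑ ν, M μ ν * leviCivita μ ν t u =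
      Matrix.trace (M * (E t u)ᵀ) := by
    intro M t u
    simp [Matrix.trace, Matrix.mul_apply, hE]
  have hE2 : E ρ τ = ∑ t, ∑ u, (G ρ t * G τ u) • (G * E t u * Gᵀ) := by
    ext a b
    simp only [hE, Matrix.of_apply, Matrix.sum_apply, Matrix.smul_apply, Matrix.mul_apply,
      Matrix.transpose_apply, smul_eq_mul]
    rw [e]
    simp only [Finset.mul_sum, Finset.sum_mul]
    simp only [Fin.sum_univ_four]
    ring
  have hT : ∀ X : Mat, Matrix.trace (K * L * Kᵀ * (G * X * Gᵀ)ᵀ) = Matrix.trace (L * Xᵀ) := by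
    intro X
    have h3 : Kᵀ * G = 1 := by
      have := congrArg Matrix.transpose hK'
      simpa [Matrix.transpose_mul] using this
    calc Matrix.trace (K * L * Kᵀ * (G * X * Gᵀ)ᵀ)
        = Matrix.trace (K * (L * (Kᵀ * G) * Xᵀ * Gᵀ)) := by
          simp [Matrix.transpose_mul, Matrix.mul_assoc]
      _ = Matrix.trace (L * Xᵀ * (Gᵀ * K)) := by
          rw [Matrix.trace_mul_comm, h3]; simp [Matrix.mul_assoc]
      _ = _ := by rw [hK', Matrix.mul_one]
  simp only [hodge, act, Matrix.of_apply, hs]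
  rw [show g * (G * B * Gᵀ) * g = _ from hL, hE2, hLd]
  simp only [Matrix.transpose_sum, Matrix.transpose_smul, Matrix.mul_sum, Matrix.trace_sum,
    Matrix.mul_smul, Matrix.trace_smul, hT]
  simp only [Matrix.mul_apply, Matrix.transpose_apply, Matrix.of_apply, smul_eq_mul,
    Finset.mul_sum, Finset.sum_mul]
  rw [Finset.sum_comm]
  refine Finset.sum_congr rfl fun i _ => Finset.sum_congr rfl fun j _ => ?_
  ring


theorem leviCivita_prod (a b c d : Fin 4) : leviCivita a b c d =
    ((b : ℕ) - (a : ℕ) : ℝ) * ((c : ℕ) - (a : ℕ)) * ((d : ℕ) - (a : ℕ)) *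
      ((c : ℕ) - (b : ℕ)) * ((d : ℕ) - (b : ℕ)) * ((d : ℕ) - (c : ℕ)) / 12 := by
  have h : leviCivita 0 1 2 3 = 1 := by
    simp [leviCivita, Matrix.det_succ_row_zero, Fin.sum_univ_succ, Fin.succAbove]
  let M : Mat := Matrix.of fun i j => ((i : ℕ) : ℝ) ^ (j : ℕ)
  have hM : M.det = 12 := by
    simp [M, Matrix.det_succ_row_zero, Fin.sum_univ_succ, Fin.succAbove]; norm_num
  have h1 : leviCivita a b c d * M.det =
      (Matrix.vandermonde fun k => ((![a, b, c, d] k : ℕ) : ℝ)).det := by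
    rw [leviCivita, ← Matrix.det_mul]
    congr 1
    ext k l
    simp [M, Matrix.mul_apply, Pi.single_apply, Matrix.vandermonde_apply]
  rw [hM, Matrix.det_vandermonde] at h1
  have : (Finset.Ioi (0 : Fin 4)) = {1, 2, 3} ∧ (Finset.Ioi (1 : Fin 4)) = {2, 3} ∧
    (Finset.Ioi (2 : Fin 4)) = {3} ∧ (Finset.Ioi (3 : Fin 4)) = ∅ := by decide
  simp [Fin.prod_univ_four, this] at h1
  linear_combination h1 / 12

theorem hodge_diagonal (d : Vec) (B : Mat) : hodge (Matrix.diagonal d) B = (1 / 2 : ℝ) •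
    !![0, d 2 * d 3 * (B 2 3 - B 3 2), d 1 * d 3 * (B 3 1 - B 1 3), d 1 * d 2 * (B 1 2 - B 2 1);
      d 2 * d 3 * (B 3 2 - B 2 3), 0, d 0 * d 3 * (B 0 3 - B 3 0), d 0 * d 2 * (B 2 0 - B 0 2);
      d 1 * d 3 * (B 1 3 - B 3 1), d 0 * d 3 * (B 3 0 - B 0 3), 0, d 0 * d 1 * (B 0 1 - B 1 0);
      d 1 * d 2 * (B 2 1 - B 1 2), d 0 * d 2 * (B 0 2 - B 2 0), d 0 * d 1 * (B 1 0 - B 0 1), 0] := by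
  ext i j
  simp only [hodge, Matrix.of_apply, leviCivita_prod, Fin.sum_univ_four, Matrix.diagonal_mul,
    Matrix.mul_diagonal, Matrix.smul_apply, smul_eq_mul]
  fin_cases i <;> fin_cases j <;> norm_num <;> ring

theorem flipped_eq (N : Vec) (hN : N = e0 ∨ N = e3) :
    ∃ d : Vec, flipped N = Matrix.diagonal d ∧
      ((N = e0 ∧ d = ![-1, -1, -1, -1]) ∨ (N = e3 ∧ d = ![1, -1, -1, 1])) := by
  have h2 : (![1, -1, -1, -1] : Vec) 2 = -1 := rfl
  have h3 : (![1, -1, -1, -1] : Vec) 3 = -1 := rfl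
  rcases hN with rfl | rfl
  · have a2 : e0 2 = 0 := rfl
    have a3 : e0 3 = 0 := rfl
    refine ⟨_, ?_, Or.inl ⟨rfl, rfl⟩⟩
    ext i j
    fin_cases i <;> fin_cases j <;>
      simp [flipped, minkowski, dot, Matrix.vecMulVec_apply, Matrix.mulVec_diagonal,
        dotProduct, Fin.sum_univ_four, a2, a3] <;> simp [e0] <;> norm_num
  · have a2 : e3 2 = 0 := rfl
    have a3 : e3 3 = 1 := rfl
    refine ⟨_, ?_, Or.inr ⟨rfl, rfl⟩⟩
    ext i j
    fin_cases i <;> fin_cases j <;>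
      simp [flipped, minkowski, dot, Matrix.vecMulVec_apply, Matrix.mulVec_diagonal,
        dotProduct, Fin.sum_univ_four, a2, a3, h2, h3] <;> simp [e3] <;> norm_num

theorem hodge_add (g A B : Mat) : hodge g (A + B) = hodge g A + hodge g B := by
  ext i j
  simp only [hodge, Matrix.mul_add, Matrix.add_mul, Matrix.add_apply, Matrix.of_apply, add_mul,
    Finset.sum_add_distrib, mul_add]

theorem hodge_smul (g A : Mat) (c : ℝ) : hodge g (c • A) = c • hodge g A := by
  ext i j
  simp only [hodge, Matrix.mul_smul, Matrix.smul_mul, Matrix.of_apply, Matrix.smul_apply,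
    smul_eq_mul, Finset.mul_sum]
  refine Finset.sum_congr rfl fun μ _ => Finset.sum_congr rfl fun ν _ => ?_
  ring

theorem bivectorPhi_add (N : Vec) (σ : ℝ) (A B : Mat) :
    bivectorPhi N σ (A + B) = bivectorPhi N σ A + bivectorPhi N σ B := by
  simp only [bivectorPhi, contract, hodge_add, smul_add, Matrix.add_mulVec]
  abel

theorem bivectorPhi_smul (N : Vec) (σ c : ℝ) (A : Mat) :
    bivectorPhi N σ (c • A) = c • bivectorPhi N σ A := by
  simp only [bivectorPhi, contract, hodge_smul, smul_add, Matrix.add_mulVec, Matrix.smul_mulVec]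
  congr 1 <;> simp only [smul_smul] <;> congr 1 <;> ring

/-- `x ↦ Φ^±(G ⋆'(x ∧ N))` as a linear map. -/
def phiLin (N : Vec) (σ : ℝ) (G : Mat) : Vec →ₗ[ℝ] Vec where
  toFun x := bivectorPhi N σ (act G (hodge (flipped N) (wedge x N))) +
    (dot (flipped N) x N / dot (flipped N) N N) • N
  map_add' x y := by
    have : wedge (x + y) N = wedge x N + wedge y N := by
      ext i j; simp [wedge, Matrix.vecMulVec_apply]; ring
    rw [this, hodge_add]
    simp only [act, Matrix.mul_add, Matrix.add_mul, bivectorPhi_add, dot, add_dotProduct,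
      add_div, add_smul]
    abel
  map_smul' c x := by
    have : wedge (c • x) N = c • wedge x N := by
      ext i j; simp [wedge, Matrix.vecMulVec_apply]; ring
    rw [this, hodge_smul]
    simp only [act, Matrix.mul_smul, Matrix.smul_mul, bivectorPhi_smul, dot, smul_dotProduct,
      smul_eq_mul, mul_div_assoc, RingHom.id_apply, smul_add, smul_smul]

theorem groupPhi_mulVec (N : Vec) (σ : ℝ) (G : Mat) (x : Vec) :
    groupPhi N σ G *ᵥ x = bivectorPhi N σ (act G (hodge (flipped N) (wedge x N))) +
      (dot (flipped N) x N / dot (flipped N) N N) • N := by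
  have h : groupPhi N σ G = LinearMap.toMatrix' (phiLin N σ G) := by
    ext i j
    simp [groupPhi, LinearMap.toMatrix'_apply, phiLin]
  rw [h, LinearMap.toMatrix'_mulVec]
  rfl

/-- The antisymmetric matrix with the given entries above the diagonal. -/
def asym (a b c f h k : ℝ) : Mat :=
  !![0, a, b, c; -a, 0, f, h; -b, -f, 0, k; -c, -h, -k, 0]

theorem eq_asym (B : Mat) (hB : Bᵀ = -B) :
    B = asym (B 0 1) (B 0 2) (B 0 3) (B 1 2) (B 1 3) (B 2 3) := by
  have hij : ∀ i j, B j i = -B i j := fun i j => congrFun (congrFun hB i) j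
  have hii : ∀ i, B i i = 0 := fun i => by linarith [hij i i]
  ext i j
  fin_cases i <;> fin_cases j <;> first | exact hii _ | exact hij _ _ | rfl

theorem hodge_asym (d : Vec) (a b c f h k : ℝ) : hodge (Matrix.diagonal d) (asym a b c f h k) =
    asym (d 2 * d 3 * k) (-(d 1 * d 3 * h)) (d 1 * d 2 * f) (d 0 * d 3 * c) (-(d 0 * d 2 * b))
      (d 0 * d 1 * a) := by
  rw [hodge_diagonal]
  simp only [asym, Matrix.of_apply, Matrix.cons_val, Matrix.smul_of, Matrix.smul_cons,
    Matrix.smul_empty, smul_eq_mul, mul_zero]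
  ring_nf

theorem asym_sub (a b c f h k a' b' c' f' h' k' : ℝ) :
    asym a b c f h k - asym a' b' c' f' h' k' =
      asym (a - a') (b - b') (c - c') (f - f') (h - h') (k - k') := by
  ext i j
  fin_cases i <;> fin_cases j <;> simp [asym] <;> ring

theorem asym_smul (s a b c f h k : ℝ) :
    s • asym a b c f h k = asym (s * a) (s * b) (s * c) (s * f) (s * h) (s * k) := by
  simp only [asym, Matrix.smul_of, Matrix.smul_cons, Matrix.smul_empty, smul_eq_mul, mul_zero,
    mul_neg]

theorem asym_mulVec (a b c f h k : ℝ) (x : Vec) : asym a b c f h k *ᵥ x =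
    ![a * x 1 + b * x 2 + c * x 3, -a * x 0 + f * x 2 + h * x 3, -b * x 0 - f * x 1 + k * x 3,
      -c * x 0 - h * x 1 - k * x 2] := by
  ext i
  fin_cases i <;> simp [asym, Matrix.mulVec, dotProduct, Fin.sum_univ_four] <;> ring

theorem wedge_eq_asym (x y : Vec) : wedge x y =
    asym (x 0 * y 1 - y 0 * x 1) (x 0 * y 2 - y 0 * x 2) (x 0 * y 3 - y 0 * x 3)
      (x 1 * y 2 - y 1 * x 2) (x 1 * y 3 - y 1 * x 3) (x 2 * y 3 - y 2 * x 3) := by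
  refine eq_asym _ ?_
  simp [wedge, Matrix.transpose_sub, Matrix.transpose_vecMulVec]

theorem phi_kernel (N : Vec) (hN : N = e0 ∨ N = e3) (σ : ℝ) (hσ : σ = 1 ∨ σ = -1) (B : Mat)
    (hB : Bᵀ = -B) :
    dot (flipped N) (bivectorPhi N σ B) N = 0 ∧
    hodge (flipped N) (B - hodge (flipped N) (wedge (bivectorPhi N σ B) N)) =
      -σ • (B - hodge (flipped N) (wedge (bivectorPhi N σ B) N)) := by
  rw [eq_asym B hB]
  generalize B 0 1 = a
  generalize B 0 2 = b
  generalize B 0 3 = c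
  generalize B 1 2 = f
  generalize B 1 3 = h
  generalize B 2 3 = k
  obtain ⟨d, hd, h⟩ := flipped_eq N hN
  unfold bivectorPhi
  have add : ∀ (P Q : Mat), contract (flipped N) (P + Q) N = P *ᵥ (flipped N *ᵥ N) +
    Q *ᵥ (flipped N *ᵥ N) := fun P Q => Matrix.add_mulVec _ _ _
  rw [add, hd]
  rcases h with ⟨rfl, rfl⟩ | ⟨rfl, rfl⟩
  · have hx : Matrix.diagonal ![-1, -1, -1, -1] *ᵥ e0 = ![-1, 0, 0, 0] := by
      ext i; fin_cases i <;> simp [Matrix.mulVec_diagonal, e0]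
    have hD : dot (Matrix.diagonal ![-1, -1, -1, -1]) e0 e0 = -1 := by
      simp only [dot, hx]; simp [e0]
    simp only [hD, hx, hodge_asym, asym_smul, asym_mulVec]
    constructor
    · simp only [dot, hx]; simp
    · simp only [wedge_eq_asym, hodge_asym, asym_smul, asym_sub]
      simp only [e0, Pi.smul_apply, Pi.add_apply, Matrix.cons_val, smul_eq_mul]
      rcases hσ with rfl | rfl <;> congr 1 <;> ring
  · have hx : Matrix.diagonal ![1, -1, -1, 1] *ᵥ e3 = ![0, 0, 0, 1] := by
      ext i; fin_cases i <;> simp [Matrix.mulVec_diagonal, e3]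
    have hD : dot (Matrix.diagonal ![1, -1, -1, 1]) e3 e3 = 1 := by
      simp only [dot, hx]; simp [e3]
    simp only [hD, hx, hodge_asym, asym_smul, asym_mulVec]
    constructor
    · simp only [dot, hx]; simp
    · simp only [wedge_eq_asym, hodge_asym, asym_smul, asym_sub]
      simp only [e3, Pi.smul_apply, Pi.add_apply, Matrix.cons_val, smul_eq_mul]
      rcases hσ with rfl | rfl <;> congr 1 <;> ring

/-- The equivariance that characterizes `groupPhi`. -/
theorem groupPhi_mulVec_bivectorPhi (N : Vec) (hN : N = e0 ∨ N = e3) (σ : ℝ)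
    (hσ : σ = 1 ∨ σ = -1) (G B : Mat) (hG : IsSO (flipped N) G) (hB : Bᵀ = -B) :
    groupPhi N σ G *ᵥ bivectorPhi N σ B = bivectorPhi N σ (act G B) := by
  obtain ⟨h1, h2⟩ := phi_kernel N hN σ hσ B hB
  have hg : (flipped N)ᵀ = flipped N ∧ flipped N * flipped N = 1 := by
    obtain ⟨d, hd, h⟩ := flipped_eq N hN
    rw [hd]
    refine ⟨by simp, ?_⟩
    rw [Matrix.diagonal_mul_diagonal, ← Matrix.diagonal_one]
    congr 1
    ext i
    rcases h with ⟨-, rfl⟩ | ⟨-, rfl⟩ <;> fin_cases i <;> simp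
  set C := B - hodge (flipped N) (wedge (bivectorPhi N σ B) N) with hC
  have h3 : bivectorPhi N σ (act G C) = 0 := by
    rw [bivectorPhi, hodge_act _ _ _ hg.1 hg.2 hG, h2]
    simp [act, contract]
  have h4 : act G B = act G C + act G (hodge (flipped N) (wedge (bivectorPhi N σ B) N)) := by
    simp [hC, act, Matrix.mul_sub, Matrix.sub_mul]
  rw [groupPhi_mulVec, h1, h4, bivectorPhi_add, h3]
  simp

/-! ### Simplices and reconstruction -/

/-- The geometric bivectors `B i j` of the simplex with vertices `x 0, …, x 4`: up to the sign
`(-1) ^ (i + j + 1)` (if `i < j`) or `(-1) ^ (i + j)` (if `i > j`), this is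
`(x b - x a) ∧ (x c - x a)`, where `a < b < c` are the three indices other than `i` and `j`.
The vertices `x i` and `x j` do not occur in it. -/
def simplexBivector (x : Fin 5 → Vec) (i j : Fin 5) : Mat :=
  (-1 : ℝ) ^ (if i < j then (i : ℕ) + (j : ℕ) + 1 else (i : ℕ) + (j : ℕ)) •
    ∑ a, ∑ b, ∑ c,
      if a < b ∧ b < c ∧ a ≠ i ∧ b ≠ i ∧ c ≠ i ∧ a ≠ j ∧ b ≠ j ∧ c ≠ j then
        wedge (x b - x a) (x c - x a)
      else 0

/-- The points `x j`, `j ≠ i`, are the vertices of a tetrahedron in the space orthogonal to `N`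
whose face bivectors are `r ⋆(v i j ∧ N)` with a sign `r`. The vertex `x j` is opposite to
the face `(i j)`; the value `x i` is not used. -/
def IsBoundaryTetrahedron (g : Mat) (N : Vec) (v : Fin 5 → Fin 5 → Vec) (i : Fin 5)
    (x : Fin 5 → Vec) : Prop :=
  (∀ j, j ≠ i → dot g (x j) N = 0) ∧
    ∃ r : ℝ, (r = 1 ∨ r = -1) ∧
      ∀ j, j ≠ i → simplexBivector x i j = r • dataBivector g N v i j

/-- The lengths matching condition, together with the signed square lengths that it defines:
`len m l` is the signed square length of the edge `m l` in each of the boundary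
tetrahedra `i`, `i ≠ m, l`. (In the tetrahedron `i` this is the edge between the faces `(i j)`
and `(i k)`, with `j, k` the two remaining indices.) -/
def IsMatchedLengths (g : Mat) (N : Vec) (v : Fin 5 → Fin 5 → Vec)
    (len : Fin 5 → Fin 5 → ℝ) : Prop :=
  ∀ i, ∃ x : Fin 5 → Vec, IsBoundaryTetrahedron g N v i x ∧
    ∀ m l, m ≠ i → l ≠ i → dot g (x m - x l) (x m - x l) = len m l

/-- A non-degenerate simplex with the given signed square lengths in the space with metric `g`. -/
def IsReconstructedSimplex (g : Mat) (len : Fin 5 → Fin 5 → ℝ) (X : Fin 5 → Vec) : Prop :=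
  AffineIndependent ℝ X ∧ ∀ m l, dot g (X m - X l) (X m - X l) = len m l

/-- The normalized outward normal of the tetrahedron `i` of the simplex `X`: the vertex `X i` lies
strictly on the side of this tetrahedron opposite to `n`. -/
def IsOutwardNormal (g : Mat) (X : Fin 5 → Vec) (i : Fin 5) (n : Vec) : Prop :=
  IsNormalized g n ∧
    (∀ j k, j ≠ i → k ≠ i → dot g n (X j - X k) = 0) ∧
    ∀ j, j ≠ i → dot g n (X i - X j) / dot g n n < 0

/-- The geometric rotation of the tetrahedron `i`: `G N` is the outward normal, and `G (v i j)` is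
the vector `w j` orthogonal to it with `B i j = ⋆(w j ∧ G N)`, for the bivectors of `X`. -/
def IsGeometricRotation (g : Mat) (N : Vec) (v : Fin 5 → Fin 5 → Vec) (X : Fin 5 → Vec)
    (i : Fin 5) (G : Mat) : Prop :=
  ∃ (n : Vec) (w : Fin 5 → Vec), IsOutwardNormal g X i n ∧
    (∀ j, j ≠ i → dot g (w j) n = 0 ∧ simplexBivector X i j = hodge g (wedge (w j) n)) ∧
    G *ᵥ N = n ∧ ∀ j, j ≠ i → G *ᵥ v i j = w j

/-- The orientations matching condition: the determinants of the geometric rotations of the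
reconstructed simplex are equal to a common sign (for one, and for all, reconstructed simplices). -/
def OrientationsMatching (g : Mat) (N : Vec) (v : Fin 5 → Fin 5 → Vec)
    (len : Fin 5 → Fin 5 → ℝ) : Prop :=
  (∃ X, IsReconstructedSimplex g len X) ∧
    ∀ X, IsReconstructedSimplex g len X → ∃ r : ℝ, (r = 1 ∨ r = -1) ∧
      ∀ i, ∃ G, IsGeometricRotation g N v X i G ∧ G.det = r

/-! ### Counting classes -/

def AtLeastTwoClasses {α : Type*} (P : α → Prop) (R : α → α → Prop) : Prop :=
  ∃ a b, P a ∧ P b ∧ ¬ R a b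

def ExactlyTwoClasses {α : Type*} (P : α → Prop) (R : α → α → Prop) : Prop :=
  ∃ a b, P a ∧ P b ∧ ¬ R a b ∧ ∀ c, P c → R a c ∨ R b c

end SimplexGeometry

end

open SimplexGeometry Matrix

/-!
The three kinds of objects of the theorem (simplices, solutions, pairs of vector geometries) are
translated into each other. Write `g` for the flipped metric, `n i = G i N` for the normals and
`w i j = G i (v i j)` for the face vectors of a solution. As the Hodge star commutes with rotations,
the gluing conditions read `w i j ∧ n i = -w j i ∧ n j`.

*Solutions and simplices.* For a non-degenerate solution, `w i j` lies in the plane of `n i` and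
`n j`. Closure of the tetrahedra turns this into five linear relations between the five normals with
a symmetric matrix of coefficients. The normals satisfy only one relation up to scale, so this matrix
has rank one: there are weights with `∑ i, m i • n i = 0` and `w i j ∧ n i = ± M j ∧ M i` for
`M i = m i • n i` (`IsClosedData.exists_isMinkowskiForm`). The `M i` are, up to scale, the dual
normals of a simplex, whose bivectors are the `⋆(M j ∧ M i)` (`simplexBivector_eq_hodge`), and so the
lengths and orientations match (`exists_matching_of_isNondegenerateSolution`). Conversely, the
geometric rotations of a reconstructed simplex are orthogonal, because equal lengths make its
tetrahedra congruent to the boundary tetrahedra (`IsGeometricRotation.isO`). As their determinants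
agree, either they or their products with `R_N` form a solution
(`exists_isNondegenerateSolution_of_matching`).

*Two classes of solutions.* The data determine the products of the bivectors `M j ∧ M i` and
`M l ∧ M i`. The difference of all such products for two solutions is a tensor with the symmetries of
the Riemann tensor, whose components with a repeated index vanish; by the closure relation it is zero
(`riemann_eq_zero`). Hence an orthogonal map `O` carries the `M i` of one solution to those of the
other, and the only freedom is inversion in each tetrahedron and one common reflection
(`IsClosedData.solutionEquiv_or`). The two classes differ, because an orthogonal map with all five
normals as eigenvectors is `1` or `-1`, and so has determinant `1`
(`IsClosedData.not_solutionEquiv_reflected`).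

*Solutions and vector geometries.* A bivector is determined by its two images under `Φ^±`, so a
family of rotations is a solution exactly if both of its images under `Φ^±` are vector geometries.
These images are gauge equivalent exactly if the solution is degenerate (`not_equiv_groupPhi`,
`isNondegenerateFamily_of_not_equiv`). Every pair of vector geometries comes from a solution: the
Euler-Rodrigues parameters of `Hp i (Hm i)⁻¹` give a (split) quaternion, acting on the flipped space,
whose image under `Φ⁺` is `Hp i (Hm i)⁻¹` and whose image under `Φ⁻` is `1`. For `N = e₃` this needs
a relative time orientation that the data force to be the same for all `i`
(`exists_isSolution_of_isVectorGeometry`). Since conjugation with `R_N` exchanges `Φ⁺` and `Φ⁻`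
(`groupPhi_reflection`), the two classes of solutions yield the same two classes of vector
geometries.
-/

namespace SimplexGeometry

/-! ### Scalar products, bivectors and the Hodge star -/

theorem dot_comm {g : Mat} (hg : gᵀ = g) (x y : Vec) : dot g x y = dot g y x := by
  rw [dot, dot, dotProduct_mulVec, ← mulVec_transpose, hg, dotProduct_comm]

theorem dot_add_left (g : Mat) (x y z : Vec) : dot g (x + y) z = dot g x z + dot g y z := by
  simp [dot, add_dotProduct]

theorem dot_add_right (g : Mat) (x y z : Vec) : dot g x (y + z) = dot g x y + dot g x z := by
  simp [dot, mulVec_add, dotProduct_add]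

theorem dot_smul_left (g : Mat) (c : ℝ) (x y : Vec) : dot g (c • x) y = c * dot g x y := by
  simp [dot, smul_dotProduct]

theorem dot_smul_right (g : Mat) (c : ℝ) (x y : Vec) : dot g x (c • y) = c * dot g x y := by
  simp [dot, mulVec_smul]

theorem dot_neg_left (g : Mat) (x y : Vec) : dot g (-x) y = -dot g x y := by
  simp [dot]

theorem dot_sub_left (g : Mat) (x y z : Vec) : dot g (x - y) z = dot g x z - dot g y z := by
  simp [dot, sub_dotProduct]

theorem dot_sub_right (g : Mat) (x y z : Vec) : dot g x (y - z) = dot g x y - dot g x z := by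
  simp [dot, mulVec_sub, dotProduct_sub]

theorem dot_sum_right {ι : Type*} (g : Mat) (x : Vec) (s : Finset ι) (f : ι → Vec) :
    dot g x (∑ i ∈ s, f i) = ∑ i ∈ s, dot g x (f i) := by
  simp [dot, mulVec_sum, dotProduct_sum]

theorem dot_mulVec (g G : Mat) (x y : Vec) : dot g (G *ᵥ x) (G *ᵥ y) = dot (Gᵀ * g * G) x y := by
  simp only [dot, ← mulVec_mulVec]
  rw [dotProduct_mulVec x, vecMul_transpose]

theorem wedge_swap (a b : Vec) : wedge a b = -wedge b a := by
  simp [wedge]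

theorem wedge_self (a : Vec) : wedge a a = 0 := by
  simp [wedge]

theorem wedge_add_left (a b c : Vec) : wedge (a + b) c = wedge a c + wedge b c := by
  simp only [wedge, add_vecMulVec, vecMulVec_add]; abel

theorem wedge_smul_left (r : ℝ) (a b : Vec) : wedge (r • a) b = r • wedge a b := by
  simp only [wedge, smul_vecMulVec, vecMulVec_smul, smul_sub]

theorem wedge_smul_right (r : ℝ) (a b : Vec) : wedge a (r • b) = r • wedge a b := by
  simp only [wedge, smul_vecMulVec, vecMulVec_smul, smul_sub]

theorem wedge_neg_left (a b : Vec) : wedge (-a) b = -wedge a b := by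
  simpa using wedge_smul_left (-1) a b

theorem wedge_neg_right (a b : Vec) : wedge a (-b) = -wedge a b := by
  simpa using wedge_smul_right (-1) a b

theorem wedge_zero_left (a : Vec) : wedge 0 a = 0 := by
  simp [wedge]

theorem wedge_transpose (a b : Vec) : (wedge a b)ᵀ = -wedge a b := by
  simp [wedge, transpose_vecMulVec]

theorem act_wedge (G : Mat) (a b : Vec) : act G (wedge a b) = wedge (G *ᵥ a) (G *ᵥ b) := by
  simp only [act, wedge, mul_sub, sub_mul, mul_vecMulVec, vecMulVec_mul, vecMul_transpose]

theorem act_smul (G B : Mat) (c : ℝ) : act G (c • B) = c • act G B := by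
  simp [act]

theorem act_add (G B C : Mat) : act G (B + C) = act G B + act G C := by
  simp [act, mul_add, add_mul]

theorem act_neg (G B : Mat) : act G (-B) = -act G B := by
  simp [act]

theorem act_act (G H B : Mat) : act G (act H B) = act (G * H) B := by
  simp [act, mul_assoc, transpose_mul]

theorem neg_act (G B : Mat) : act (-G) B = act G B := by
  simp [act]

theorem act_transpose (G B : Mat) (hB : Bᵀ = -B) : (act G B)ᵀ = -act G B := by
  simp [act, transpose_mul, hB, mul_assoc]

theorem contract_wedge {g : Mat} (a b n : Vec) :
    contract g (wedge a b) n = dot g b n • a - dot g a n • b := by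
  simp only [contract, wedge, sub_mulVec, vecMulVec_mulVec, dot]
  ext i; simp [mul_comm]

/-- A vector orthogonal to `n` is determined by its wedge product with `n`. -/
theorem eq_of_wedge_eq {g : Mat} {a b n : Vec} (ha : dot g a n = 0) (hb : dot g b n = 0)
    (hn : dot g n n ≠ 0) (h : wedge a n = wedge b n) : a = b := by
  have := congrArg (fun B => contract g B n) h
  simp only [contract_wedge, ha, hb, zero_smul, sub_zero] at this
  exact smul_right_injective _ hn this

/-- Two planes through `n` and `m` that coincide are spanned by `n` and `m`. -/
theorem exists_eq_add_of_wedge_eq {y y' n m : Vec} (h : wedge y n = wedge y' m)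
    (hnm : wedge n m ≠ 0) : ∃ a b : ℝ, y = a • n + b • m := by
  obtain ⟨μ, ν, hμν⟩ : ∃ μ ν, wedge n m μ ν ≠ 0 := by
    by_contra! hc
    exact hnm (by ext i j; exact hc i j)
  set d := wedge n m μ ν with hd
  have h1 := fun ρ : Fin 4 => congrFun (congrFun h ρ) μ
  have h2 := fun ρ : Fin 4 => congrFun (congrFun h ρ) ν
  simp only [wedge, Matrix.sub_apply, vecMulVec_apply] at h1 h2 hd
  -- contract both planes with the covector `m ν • e μ - m μ • e ν`, which vanishes on `m`
  refine ⟨(y μ * m ν - y ν * m μ) / d, (y' μ * m ν - y' ν * m μ) / (-d), ?_⟩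
  ext ρ
  simp only [Pi.add_apply, Pi.smul_apply, smul_eq_mul]
  field_simp
  linear_combination h1 ρ * m ν - h2 ρ * m μ + y ρ * hd

/-- Parallel vectors of the same non-zero norm agree up to sign. -/
theorem eq_or_eq_neg_of_wedge_eq_zero {g : Mat} {n m : Vec} (h : wedge n m = 0)
    (hm : dot g m m = dot g n n) (hn : dot g n n ≠ 0) : m = n ∨ m = -n := by
  have h1 : dot g m m • n = dot g n m • m := by
    have := contract_wedge (g := g) n m m
    rwa [h, contract, zero_mulVec, eq_comm, sub_eq_zero] at this
  have h2 : m = (dot g n m / dot g n n) • n ∨ n = (dot g n m / dot g n n) • m := by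
    right
    rw [div_eq_inv_mul, mul_smul, ← h1, hm, smul_smul, inv_mul_cancel₀ hn, one_smul]
  rcases h2 with h2 | h2
  all_goals
    set c := dot g n m / dot g n n
    have hc : c * c = 1 := by
      have := congrArg (fun z => dot g z z) h2
      simp only [dot_smul_left, dot_smul_right, hm] at this
      apply mul_right_cancel₀ hn
      linarith
    rcases mul_self_eq_one_iff.1 hc with h | h <;> rw [h] at h2 <;> simp_all

theorem hodge_neg (g B : Mat) : hodge g (-B) = -hodge g B := by
  simpa using hodge_smul g B (-1)

/-- Since `hodge 1` does not involve a metric, it is the duality from bivectors of covectors to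
bivectors of vectors. A linear map `G`, acting on covectors by its inverse transpose `K`, preserves
this duality up to its determinant. -/
theorem det_smul_hodge_one_act {G K : Mat} (hK : Gᵀ * K = 1) (L : Mat) :
    G.det • hodge 1 (act K L) = act G (hodge 1 L) := by
  set E : Fin 4 → Fin 4 → Mat := fun t u => Matrix.of fun p q => leviCivita p q t u with hE
  have hs : ∀ (M : Mat) (t u : Fin 4), ∑ μ, ∑ ν, M μ ν * leviCivita μ ν t u =
      Matrix.trace (M * (E t u)ᵀ) := by
    intro M t u
    simp [Matrix.trace, Matrix.mul_apply, hE]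
  have hE2 : ∀ ρ τ, G.det • E ρ τ = ∑ t, ∑ u, (G ρ t * G τ u) • (G * E t u * Gᵀ) := by
    intro ρ τ
    ext a b
    simp only [hE, Matrix.of_apply, Matrix.sum_apply, Matrix.smul_apply, Matrix.mul_apply,
      Matrix.transpose_apply, smul_eq_mul]
    rw [mul_comm, ← leviCivita_map]
    simp only [Finset.mul_sum, Finset.sum_mul]
    simp only [Fin.sum_univ_four]
    ring
  have hT : ∀ X : Mat, Matrix.trace (K * L * Kᵀ * (G * X * Gᵀ)ᵀ) = Matrix.trace (L * Xᵀ) := by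
    intro X
    have h3 : Kᵀ * G = 1 := by
      have := congrArg Matrix.transpose hK
      simpa [Matrix.transpose_mul] using this
    calc Matrix.trace (K * L * Kᵀ * (G * X * Gᵀ)ᵀ)
        = Matrix.trace (K * (L * (Kᵀ * G) * Xᵀ * Gᵀ)) := by
          simp [Matrix.transpose_mul, Matrix.mul_assoc]
      _ = Matrix.trace (L * Xᵀ * (Gᵀ * K)) := by
          rw [Matrix.trace_mul_comm, h3]; simp [Matrix.mul_assoc]
      _ = _ := by rw [hK, Matrix.mul_one]
  ext ρ τ
  have hl : (G.det • hodge 1 (act K L)) ρ τ =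
      (1 / 2) * Matrix.trace (K * L * Kᵀ * (G.det • E ρ τ)ᵀ) := by
    simp only [hodge, act, Matrix.smul_apply, Matrix.of_apply, hs, Matrix.one_mul, Matrix.mul_one,
      Matrix.transpose_smul, Matrix.mul_smul, Matrix.trace_smul, smul_eq_mul]
    ring
  rw [hl, hE2]
  simp only [Matrix.transpose_sum, Matrix.transpose_smul, Matrix.mul_sum, Matrix.trace_sum,
    Matrix.mul_smul, Matrix.trace_smul, hT]
  have hr : hodge 1 L = Matrix.of fun t u => (1 / 2) * Matrix.trace (L * (E t u)ᵀ) := by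
    ext t u
    simp only [hodge, hs, Matrix.one_mul, Matrix.mul_one, Matrix.of_apply]
  simp only [act, hr, Matrix.mul_apply, Matrix.transpose_apply, Matrix.of_apply, smul_eq_mul,
    Finset.mul_sum, Finset.sum_mul]
  rw [Finset.sum_comm]
  refine Finset.sum_congr rfl fun i _ => Finset.sum_congr rfl fun j _ => ?_
  ring

/-- A metric matrix for which the Hodge star is an involution: symmetric, with `g⁻¹ = g`, and of
positive determinant. -/
structure IsMetric (g : Mat) : Prop where
  symm : gᵀ = g
  sq : g * g = 1
  det : g.det = 1

theorem hodge_eq_hodge_one (g B : Mat) : hodge g B = hodge 1 (g * B * g) := by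
  simp [hodge]

theorem hodge_one_hodge_one (B : Mat) (hB : Bᵀ = -B) : hodge 1 (hodge 1 B) = B := by
  rw [eq_asym B hB, ← Matrix.diagonal_one, hodge_asym, hodge_asym]
  simp

theorem hodge_hodge {g : Mat} (hg : IsMetric g) (B : Mat) (hB : Bᵀ = -B) :
    hodge g (hodge g B) = B := by
  have h1 : gᵀ * g = 1 := by rw [hg.symm, hg.sq]
  have h2 : ∀ C, g * C * g = act g C := fun C => by rw [act, hg.symm]
  have h3 : ∀ C, hodge 1 (act g C) = act g (hodge 1 C) := fun C => by
    simpa [hg.det] using det_smul_hodge_one_act h1 C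
  rw [hodge_eq_hodge_one, hodge_eq_hodge_one g B, h2, h2, h3, h3, h3, hodge_one_hodge_one _ hB,
    act_act, hg.sq]
  simp [act]

theorem hodge_injective {g : Mat} (hg : IsMetric g) {B C : Mat} (hB : Bᵀ = -B) (hC : Cᵀ = -C)
    (h : hodge g B = hodge g C) : B = C := by
  rw [← hodge_hodge hg B hB, h, hodge_hodge hg C hC]

/-- An orthogonal map commutes with the Hodge star up to its determinant. -/
theorem hodge_act_eq_det_smul {g G : Mat} (hg : IsMetric g) (hG : Gᵀ * g * G = g) (B : Mat) :
    hodge g (act G B) = G.det • act G (hodge g B) := by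
  have hK : Gᵀ * (g * G * g) = 1 := by
    rw [← Matrix.mul_assoc, ← Matrix.mul_assoc, hG, hg.sq]
  have hd : G.det * G.det = 1 := by
    have := congrArg Matrix.det hG
    simpa [Matrix.det_mul, hg.det] using this
  have hL : g * act G B * g = act (g * G * g) (g * B * g) := by
    simp only [act, Matrix.transpose_mul, hg.symm]
    calc g * (G * B * Gᵀ) * g = g * G * 1 * B * 1 * Gᵀ * g := by simp [Matrix.mul_assoc]
      _ = _ := by rw [← hg.sq]; simp only [Matrix.mul_assoc]
  rw [hodge_eq_hodge_one, hL, hodge_eq_hodge_one g B, ← det_smul_hodge_one_act hK, smul_smul, hd,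
    one_smul]

theorem det_eq_one_or_neg_one {g G : Mat} (hg : IsMetric g) (hG : Gᵀ * g * G = g) :
    G.det = 1 ∨ G.det = -1 := by
  have := congrArg Matrix.det hG
  rw [← mul_self_eq_one_iff]
  simpa [Matrix.det_mul, hg.det] using this

theorem isO_mul {g G H : Mat} (hG : Gᵀ * g * G = g) (hH : Hᵀ * g * H = g) :
    (G * H)ᵀ * g * (G * H) = g := by
  calc (G * H)ᵀ * g * (G * H) = Hᵀ * (Gᵀ * g * G) * H := by
        simp only [transpose_mul, Matrix.mul_assoc]
    _ = g := by rw [hG, hH]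

theorem IsSO.mul {g G H : Mat} (hG : IsSO g G) (hH : IsSO g H) : IsSO g (G * H) :=
  ⟨isO_mul hG.1 hH.1, by rw [det_mul, hG.2, hH.2, one_mul]⟩

theorem det_neg_mat (G : Mat) : (-G).det = G.det := by
  rw [det_neg, Fintype.card_fin]; norm_num

theorem IsSO.neg {g G : Mat} (hG : IsSO g G) : IsSO g (-G) :=
  ⟨by simpa using hG.1, by rw [det_neg_mat, hG.2]⟩

theorem isO_inv_mul {g G : Mat} (hg : g * g = 1) (hG : Gᵀ * g * G = g) : (g * Gᵀ * g) * G = 1 := by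
  rw [Matrix.mul_assoc, Matrix.mul_assoc, ← Matrix.mul_assoc Gᵀ, hG, hg]

theorem isO_inv {g G : Mat} (hs : gᵀ = g) (hg : g * g = 1) (hG : Gᵀ * g * G = g) :
    (g * Gᵀ * g)ᵀ * g * (g * Gᵀ * g) = g := by
  have h := mul_eq_one_comm.1 (isO_inv_mul hg hG)
  calc (g * Gᵀ * g)ᵀ * g * (g * Gᵀ * g) = g * (G * (g * g) * g * Gᵀ * g) := by
        simp only [transpose_mul, hs, transpose_transpose, Matrix.mul_assoc]
    _ = g * (G * (g * Gᵀ * g)) := by rw [hg]; simp only [Matrix.mul_assoc, Matrix.one_mul]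
    _ = g := by rw [h, mul_one]

/-- The inverse of a rotation, with the formula `g Gᵀ g`. -/
theorem IsSO.exists_inv {g G : Mat} (hg : IsMetric g) (hG : IsSO g G) :
    ∃ H, IsSO g H ∧ H * G = 1 ∧ G * H = 1 := by
  refine ⟨g * Gᵀ * g, ⟨isO_inv hg.symm hg.sq hG.1, ?_⟩, isO_inv_mul hg.sq hG.1,
    mul_eq_one_comm.1 (isO_inv_mul hg.sq hG.1)⟩
  simp [det_mul, hg.det, hG.2]

theorem eq_of_dot_eq {A B : Mat} (h : ∀ x y, dot A x y = dot B x y) : A = B := by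
  ext i j
  simpa [dot] using h (Pi.single i 1) (Pi.single j 1)

/-! ### Reflections -/

theorem reflection_mulVec {g : Mat} (hg : gᵀ = g) (e x : Vec) :
    reflection g e *ᵥ x = x - (2 / dot g e e * dot g e x) • e := by
  rw [reflection, sub_mulVec, one_mulVec, smul_mulVec, vecMulVec_mulVec, dotProduct_comm,
    ← dot, dot_comm hg x e, op_smul_eq_smul, smul_smul]

theorem reflection_self {g : Mat} (hg : gᵀ = g) {e : Vec} (he : dot g e e ≠ 0) :
    reflection g e *ᵥ e = -e := by
  rw [reflection_mulVec hg, div_mul_cancel₀ _ he]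
  module

theorem reflection_of_dot_eq_zero {g : Mat} (hg : gᵀ = g) {e x : Vec} (h : dot g x e = 0) :
    reflection g e *ᵥ x = x := by
  rw [reflection_mulVec hg, dot_comm hg e x, h]
  simp

theorem reflection_isO {g : Mat} (hg : gᵀ = g) {e : Vec} (he : dot g e e ≠ 0) :
    (reflection g e)ᵀ * g * reflection g e = g := by
  refine eq_of_dot_eq fun x y => ?_
  rw [← dot_mulVec, reflection_mulVec hg, reflection_mulVec hg]
  simp only [dot_sub_left, dot_sub_right, dot_smul_left, dot_smul_right]
  rw [dot_comm hg x e]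
  field_simp
  ring

theorem reflection_sq {g : Mat} (hg : gᵀ = g) {e : Vec} (he : dot g e e ≠ 0) :
    reflection g e * reflection g e = 1 := by
  rw [← Matrix.mulVec_injective.eq_iff]
  ext1 x
  rw [← mulVec_mulVec, reflection_mulVec hg e x, mulVec_sub, mulVec_smul, reflection_self hg he,
    reflection_mulVec hg, one_mulVec]
  module

theorem reflection_det (g : Mat) {e : Vec} (he : dot g e e ≠ 0) : (reflection g e).det = -1 := by
  rw [reflection, ← vecMulVec_smul, vecMulVec_eq (Fin 1), det_one_sub_mul_comm, det_unique]
  have : (2 / dot g e e) * dot g e e = 2 := div_mul_cancel₀ _ he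
  rw [Matrix.sub_apply, replicateRow_mul_replicateCol_apply, smul_dotProduct, dotProduct_comm,
    ← dot, smul_eq_mul, this]
  norm_num

/-! ### Geometric solutions and their normals -/

/-- Non-degenerate boundary data in a space with metric `g`: the vectors `v i j` with `j ≠ i` are
orthogonal to the normalized vector `N`, close, and any three of them are independent. -/
structure IsClosedData (g : Mat) (N : Vec) (v : Fin 5 → Fin 5 → Vec) : Prop where
  metric : IsMetric g
  normalized : IsNormalized g N
  orthogonal : ∀ i j, i ≠ j → dot g (v i j) N = 0
  closure : ∀ i, ∑ j ∈ Finset.univ.erase i, v i j = 0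
  nondegenerate : IsNondegenerateData v

theorem IsNormalized.ne_zero {g : Mat} {n : Vec} (h : IsNormalized g n) : dot g n n ≠ 0 := by
  rcases h with h | h <;> rw [h] <;> norm_num

theorem IsNormalized.mul_self {g : Mat} {n : Vec} (h : IsNormalized g n) :
    dot g n n * dot g n n = 1 := by
  rcases h with h | h <;> rw [h] <;> norm_num

theorem span_eq_top_iff (S : Set Vec) :
    Submodule.span ℝ S = ⊤ ↔ ∀ y : Vec, (∀ s ∈ S, y ⬝ᵥ s = 0) → y = 0 := by
  constructor
  · intro h y hy
    have : ∀ x ∈ Submodule.span ℝ S, y ⬝ᵥ x = 0 := by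
      intro x hx
      induction hx using Submodule.span_induction with
      | mem x hx => exact hy x hx
      | zero => simp
      | add a b _ _ ha hb => rw [dotProduct_add, ha, hb, add_zero]
      | smul c a _ ha => rw [dotProduct_smul, ha, smul_zero]
    exact dotProduct_self_eq_zero.1 (this y (h ▸ Submodule.mem_top))
  · intro h
    by_contra hne
    obtain ⟨f, hf0, hf⟩ := Submodule.exists_le_ker_of_lt_top _ (lt_top_iff_ne_top.2 hne)
    apply hf0
    have hfy : ∀ x, f x = (fun i => f (Pi.single i 1)) ⬝ᵥ x := by
      intro x
      conv_lhs => rw [pi_eq_sum_univ' x, map_sum]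
      simp only [map_smul, smul_eq_mul, dotProduct]
      exact Finset.sum_congr rfl fun i _ => mul_comm _ _
    have := h (fun i => f (Pi.single i 1)) fun s hs => by
      rw [← hfy]; exact hf (Submodule.subset_span hs)
    refine LinearMap.ext fun x => ?_
    rw [hfy, this]
    simp

theorem IsSO.mulVec_injective {g G : Mat} (hG : IsSO g G) : Function.Injective G.mulVec :=
  Matrix.mulVec_injective_of_isUnit ((isUnit_iff_isUnit_det G).2 (by simp [hG.2]))

theorem IsSO.dot {g G : Mat} (hG : IsSO g G) (x y : Vec) :
    dot g (G *ᵥ x) (G *ᵥ y) = dot g x y := by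
  rw [dot_mulVec, hG.1]

/-- Orthogonal vectors in a plane through a non-null vector are proportional to each other. -/
theorem not_linearIndependent_of_plane {g : Mat} {n m x x' : Vec} (hn : dot g n n ≠ 0)
    (hx : dot g x n = 0) (hx' : dot g x' n = 0) (h : ∃ a b : ℝ, x = a • n + b • m)
    (h' : ∃ a b : ℝ, x' = a • n + b • m) : ¬ LinearIndependent ℝ ![x, x'] := by
  intro hi
  rw [LinearIndependent.pair_iff] at hi
  obtain ⟨a, b, h⟩ := h
  obtain ⟨a', b', h'⟩ := h'
  have e : b' • x + (-b) • x' = (b' * a - b * a') • n := by rw [h, h']; module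
  have e2 := congrArg (fun z => dot g z n) e
  simp only [dot_add_left, dot_smul_left, hx, hx', mul_zero, add_zero] at e2
  have e3 : b' * a - b * a' = 0 := by
    rcases mul_eq_zero.1 e2.symm with h | h
    · exact h
    · exact absurd h hn
  rw [e3, zero_smul] at e
  obtain ⟨-, hb⟩ := hi _ _ e
  have hb : b = 0 := by simpa using hb
  rw [hb, zero_smul, add_zero] at h
  rw [h, dot_smul_left] at hx
  have ha : a = 0 := by simpa [hn] using hx
  have := (hi 1 0 (by rw [h, ha]; simp)).1
  norm_num at this

namespace IsClosedData

variable {g : Mat} {N : Vec} {v : Fin 5 → Fin 5 → Vec}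

theorem exists_three_ne (i : Fin 5) : ∃ j k l, i ≠ j ∧ i ≠ k ∧ i ≠ l ∧ j ≠ k ∧ j ≠ l ∧ k ≠ l := by
  revert i; decide

/-- The normal and the data of a tetrahedron separate linear forms. -/
theorem eq_zero_of_dotProduct (hD : IsClosedData g N v) (i : Fin 5) {y : Vec} (hN : y ⬝ᵥ N = 0)
    (hv : ∀ j, i ≠ j → y ⬝ᵥ v i j = 0) : y = 0 := by
  obtain ⟨j, k, l, hij, hik, hil, hjk, hjl, hkl⟩ := exists_three_ne i
  have hli : LinearIndependent ℝ (Fin.cons N ![v i j, v i k, v i l] : Fin 4 → Vec) := by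
    rw [linearIndependent_finCons]
    refine ⟨hD.nondegenerate i j k l hij hik hil hjk hjl hkl, fun hmem => ?_⟩
    have : ∀ x ∈ Submodule.span ℝ (Set.range ![v i j, v i k, v i l]), dot g x N = 0 := by
      intro x hx
      induction hx using Submodule.span_induction with
      | mem x hx =>
        obtain ⟨a, rfl⟩ := hx
        fin_cases a
        · exact hD.orthogonal i j hij
        · exact hD.orthogonal i k hik
        · exact hD.orthogonal i l hil
      | zero => simp [dot]
      | add a b _ _ ha hb => rw [dot_add_left, ha, hb, add_zero]
      | smul c a _ ha => rw [dot_smul_left, ha, mul_zero]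
    exact hD.normalized.ne_zero (this N hmem)
  have hspan := hli.span_eq_top_of_card_eq_finrank (by simp)
  refine (span_eq_top_iff _).1 hspan y ?_
  rintro _ ⟨a, rfl⟩
  fin_cases a
  · exact hN
  · exact hv j hij
  · exact hv k hik
  · exact hv l hil

/-- A linear map is determined by its values on the normal and on the data of one tetrahedron. -/
theorem mat_ext (hD : IsClosedData g N v) (i : Fin 5) {A B : Mat} (hN : A *ᵥ N = B *ᵥ N)
    (hv : ∀ j, i ≠ j → A *ᵥ v i j = B *ᵥ v i j) : A = B := by
  rw [← sub_eq_zero]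
  funext μ
  refine hD.eq_zero_of_dotProduct i ?_ fun j hj => ?_
  · exact (congrFun (sub_mulVec A B N) μ).trans (by simp [hN])
  · exact (congrFun (sub_mulVec A B (v i j)) μ).trans (by simp [hv j hj])

theorem pair_linearIndependent (hD : IsClosedData g N v) {i j k : Fin 5} (hij : i ≠ j)
    (hik : i ≠ k) (hjk : j ≠ k) : LinearIndependent ℝ ![v i j, v i k] := by
  obtain ⟨l, hil, hjl, hkl⟩ : ∃ l, i ≠ l ∧ j ≠ l ∧ k ≠ l := by
    clear hD; revert i j k; decide
  have := (hD.nondegenerate i j k l hij hik hil hjk hjl hkl).comp ![0, 1]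
    (by intro a b; fin_cases a <;> fin_cases b <;> simp)
  convert this using 1
  ext a; fin_cases a <;> rfl

theorem linearIndependent_mulVec {G : Mat} (hG : IsSO g G) {x y : Vec}
    (h : LinearIndependent ℝ ![x, y]) : LinearIndependent ℝ ![G *ᵥ x, G *ᵥ y] := by
  rw [LinearIndependent.pair_iff] at h ⊢
  intro s t hst
  apply h
  apply hG.mulVec_injective
  rw [mulVec_add, mulVec_smul, mulVec_smul, hst, mulVec_zero]

theorem hodge_wedge (hD : IsClosedData g N v) {G : Mat} (hG : IsSO g G) (x : Vec) :
    act G (hodge g (wedge x N)) = hodge g (wedge (G *ᵥ x) (G *ᵥ N)) := by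
  rw [← hodge_act g G _ hD.metric.symm hD.metric.sq hG, act_wedge]

/-- The gluing conditions of a solution, freed from the Hodge star. -/
theorem isSolution_iff (hD : IsClosedData g N v) (G : Fin 5 → Mat) :
    IsSolution g N v G ↔ (∀ i, IsSO g (G i)) ∧ ∀ i j, i ≠ j →
      wedge (G i *ᵥ v i j) (G i *ᵥ N) = -wedge (G j *ᵥ v j i) (G j *ᵥ N) := by
  refine and_congr_right fun hG => forall₃_congr fun i j hij => ?_
  rw [dataBivector, dataBivector, hD.hodge_wedge (hG i), hD.hodge_wedge (hG j), ← hodge_neg]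
  refine ⟨fun h => hodge_injective hD.metric (wedge_transpose _ _) ?_ h, fun h => by rw [h]⟩
  simp [wedge_transpose]

variable {G : Fin 5 → Mat}

theorem dot_normal (_hD : IsClosedData g N v) (hG : IsSolution g N v G) (i : Fin 5) :
    dot g (G i *ᵥ N) (G i *ᵥ N) = dot g N N := (hG.1 i).dot N N

theorem dot_normal_ne (hD : IsClosedData g N v) (hG : IsSolution g N v G) (i : Fin 5) :
    dot g (G i *ᵥ N) (G i *ᵥ N) ≠ 0 := by
  rw [hD.dot_normal hG]; exact hD.normalized.ne_zero

theorem dot_face_normal (hD : IsClosedData g N v) (hG : IsSolution g N v G) {i j : Fin 5}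
    (hij : i ≠ j) : dot g (G i *ᵥ v i j) (G i *ᵥ N) = 0 := by
  rw [(hG.1 i).dot, hD.orthogonal i j hij]

theorem wedge_eq (hD : IsClosedData g N v) (hG : IsSolution g N v G) {i j : Fin 5}
    (hij : i ≠ j) : wedge (G i *ᵥ v i j) (G i *ᵥ N) = -wedge (G j *ᵥ v j i) (G j *ᵥ N) :=
  ((hD.isSolution_iff G).1 hG).2 i j hij

/-- The face between two tetrahedra with different normals is orthogonal to both. -/
theorem exists_face_eq (hD : IsClosedData g N v) (hG : IsSolution g N v G) {i j : Fin 5}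
    (hij : i ≠ j) (h : wedge (G i *ᵥ N) (G j *ᵥ N) ≠ 0) :
    ∃ a b : ℝ, G i *ᵥ v i j = a • G i *ᵥ N + b • G j *ᵥ N := by
  refine exists_eq_add_of_wedge_eq (y' := -(G j *ᵥ v j i)) ?_ h
  rw [hD.wedge_eq hG hij, wedge_neg_left]

theorem parallel_trans (hD : IsClosedData g N v) (hG : IsSolution g N v G) {i j k : Fin 5}
    (h : wedge (G i *ᵥ N) (G j *ᵥ N) = 0) (h' : wedge (G j *ᵥ N) (G k *ᵥ N) = 0) :
    wedge (G i *ᵥ N) (G k *ᵥ N) = 0 := by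
  rcases eq_or_eq_neg_of_wedge_eq_zero h (by rw [hD.dot_normal hG, hD.dot_normal hG])
    (hD.dot_normal_ne hG i) with e | e
  · rwa [e] at h'
  · rw [e, wedge_neg_left] at h'
    simpa using h'

/-- If two tetrahedra had parallel normals, both different from that of a third one, then their
faces in the third one would be parallel. -/
theorem not_parallel_of_not_parallel (hD : IsClosedData g N v) (hG : IsSolution g N v G)
    {i j k : Fin 5} (hij : i ≠ j) (hik : i ≠ k) (hjk : j ≠ k)
    (h : wedge (G i *ᵥ N) (G j *ᵥ N) ≠ 0) (h' : wedge (G i *ᵥ N) (G k *ᵥ N) ≠ 0) :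
    wedge (G j *ᵥ N) (G k *ᵥ N) ≠ 0 := by
  intro h0
  refine not_linearIndependent_of_plane (hD.dot_normal_ne hG i) (hD.dot_face_normal hG hij)
    (hD.dot_face_normal hG hik) (hD.exists_face_eq hG hij h) ?_
    (linearIndependent_mulVec (hG.1 i) (hD.pair_linearIndependent hij hik hjk))
  obtain ⟨a, b, hab⟩ := hD.exists_face_eq hG hik h'
  rcases eq_or_eq_neg_of_wedge_eq_zero h0 (by rw [hD.dot_normal hG, hD.dot_normal hG])
    (hD.dot_normal_ne hG j) with e | e
  · exact ⟨a, b, by rw [hab, e]⟩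
  · exact ⟨a, -b, by rw [hab, e]; module⟩

/-- If two normals of a solution differ, then they all do. -/
theorem wedge_normals_ne (hD : IsClosedData g N v) (hG : IsSolution g N v G)
    (h : ∃ i j, wedge (G i *ᵥ N) (G j *ᵥ N) ≠ 0) {k l : Fin 5} (hkl : k ≠ l) :
    wedge (G k *ᵥ N) (G l *ᵥ N) ≠ 0 := by
  obtain ⟨i, j, h⟩ := h
  have hij : i ≠ j := by rintro rfl; exact h (wedge_self _)
  have comm : ∀ {a b}, wedge (G a *ᵥ N) (G b *ᵥ N) ≠ 0 → wedge (G b *ᵥ N) (G a *ᵥ N) ≠ 0 := by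
    intro a b hab
    rwa [wedge_swap, neg_ne_zero]
  have key : ∀ k, k ≠ i → wedge (G i *ᵥ N) (G k *ᵥ N) ≠ 0 := by
    intro k hki
    rcases eq_or_ne k j with rfl | hkj
    · exact h
    intro h0
    have hjk : wedge (G j *ᵥ N) (G k *ᵥ N) ≠ 0 := fun h1 =>
      h (hD.parallel_trans hG h0 (by rw [wedge_swap, h1, neg_zero]))
    exact hD.not_parallel_of_not_parallel hG hij.symm hkj.symm hki.symm (comm h) hjk h0
  rcases eq_or_ne k i with rfl | hki
  · exact key l hkl.symm
  rcases eq_or_ne l i with rfl | hli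
  · exact comm (key k hki)
  exact hD.not_parallel_of_not_parallel hG hki.symm hli.symm hkl (key k hki) (key l hli)

/-- A solution is non-degenerate as soon as two of its normals are not parallel: the span of four
normals contains the normal and three faces of one tetrahedron, and the fourth face by closure. -/
theorem isNondegenerateFamily_of_wedge_ne (hD : IsClosedData g N v) (hG : IsSolution g N v G)
    (h : ∃ i j, wedge (G i *ᵥ N) (G j *ᵥ N) ≠ 0) : IsNondegenerateFamily N G := by
  intro m
  rw [span_eq_top_iff]
  intro y hy
  have hy' : ∀ i, i ≠ m → y ⬝ᵥ G i *ᵥ N = 0 := fun i hi => hy _ ⟨i, hi, rfl⟩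
  obtain ⟨i, him⟩ : ∃ i, i ≠ m := exists_ne m
  -- the pullback of `y` to the tetrahedron `i` vanishes on its normal and on three of its faces
  have h0 : ∀ j, i ≠ j → j ≠ m → (y ᵥ* G i) ⬝ᵥ v i j = 0 := by
    intro j hij hjm
    obtain ⟨a, b, hab⟩ := hD.exists_face_eq hG hij (hD.wedge_normals_ne hG h hij)
    rw [← dotProduct_mulVec, hab, dotProduct_add, dotProduct_smul, dotProduct_smul, hy' i him,
      hy' j hjm, smul_zero, smul_zero, add_zero]
  have h1 : y ᵥ* G i = 0 := by
    refine hD.eq_zero_of_dotProduct i ?_ fun j hij => ?_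
    · rw [← dotProduct_mulVec, hy' i him]
    · by_cases hjm : j = m
      · have := congrArg (fun z => (y ᵥ* G i) ⬝ᵥ z) (hD.closure i)
        simp only [dotProduct_sum, dotProduct_zero] at this
        rwa [Finset.sum_eq_single j] at this
        · intro b hb hbj
          exact h0 b (Finset.ne_of_mem_erase hb).symm (hjm ▸ hbj)
        · intro hb; simp [hij.symm] at hb
      · exact h0 j hij hjm
  by_contra hy0
  have : ∃ z ≠ 0, z ᵥ* G i = 0 := ⟨y, hy0, h1⟩
  rw [exists_vecMul_eq_zero_iff, (hG.1 i).2] at this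
  norm_num at this

theorem wedge_ne_of_isNondegenerateFamily (h : IsNondegenerateFamily N G) {i j : Fin 5}
    (hij : i ≠ j) : wedge (G i *ᵥ N) (G j *ᵥ N) ≠ 0 := by
  obtain ⟨k, l, m, hk⟩ : ∃ k l m, {a | a ≠ m} = ({i, j, k, l} : Set (Fin 5)) := by
    have : ∀ i j : Fin 5, i ≠ j → ∃ k l m, ∀ a, a ≠ m ↔ (a = i ∨ a = j ∨ a = k ∨ a = l) := by
      decide
    obtain ⟨k, l, m, h⟩ := this i j hij
    exact ⟨k, l, m, by ext a; simpa using h a⟩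
  have h1 := h m
  rw [hk] at h1
  have h2 : (fun i => G i *ᵥ N) '' {i, j, k, l} =
      Set.range ![G i *ᵥ N, G j *ᵥ N, G k *ᵥ N, G l *ᵥ N] := by
    ext x; simp [Set.image_insert_eq]; tauto
  rw [h2] at h1
  have h3 := linearIndependent_of_top_le_span_of_card_eq_finrank h1.ge (by simp)
  intro h0
  have h4 := (h3.comp ![0, 1] (by intro a b; fin_cases a <;> fin_cases b <;> simp))
  have h5 : LinearIndependent ℝ ![G i *ᵥ N, G j *ᵥ N] := by
    convert h4 using 1
    ext a; fin_cases a <;> rfl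
  rw [LinearIndependent.pair_iff] at h5
  have hj : G j *ᵥ N = 0 := by
    ext μ
    have := h5 ((G j *ᵥ N) μ) (-(G i *ᵥ N) μ) (by
      ext ρ
      have := congrFun (congrFun h0 ρ) μ
      simp only [wedge, Matrix.sub_apply, vecMulVec_apply, Matrix.zero_apply] at this
      simp only [Pi.add_apply, Pi.smul_apply, smul_eq_mul, Pi.zero_apply]
      linarith)
    exact this.1
  have := (h5 0 1 (by rw [hj]; simp)).2
  norm_num at this

end IsClosedData

/-! ### The Minkowski form of a non-degenerate solution -/

/-- The weighted normals `m i • G i N` of a solution sum to zero, and the bivectors of the solution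
are dual to their pairwise products up to a common sign `s`. -/
structure IsMinkowskiForm (N : Vec) (v : Fin 5 → Fin 5 → Vec) (G : Fin 5 → Mat) (s : ℝ)
    (m : Fin 5 → ℝ) : Prop where
  sign : s = 1 ∨ s = -1
  ne_zero : ∀ i, m i ≠ 0
  sum_eq_zero : ∑ i, m i • G i *ᵥ N = 0
  wedge_eq : ∀ i j, i ≠ j → wedge (G i *ᵥ v i j) (G i *ᵥ N) =
    s • wedge (m j • G j *ᵥ N) (m i • G i *ᵥ N)

theorem IsNondegenerateFamily.linearIndependent {N : Vec} {G : Fin 5 → Mat}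
    (h : IsNondegenerateFamily N G) (k : Fin 5) :
    LinearIndependent ℝ fun a => G (k.succAbove a) *ᵥ N := by
  refine linearIndependent_of_top_le_span_of_card_eq_finrank (le_of_eq ?_) (by simp)
  rw [← h k]
  congr 1
  ext x
  simp only [Set.mem_image, Set.mem_ofPred_eq, Set.mem_range]
  constructor
  · rintro ⟨i, hi, rfl⟩
    obtain ⟨a, rfl⟩ := Fin.exists_succAbove_eq hi
    exact ⟨a, rfl⟩
  · rintro ⟨a, rfl⟩
    exact ⟨_, Fin.succAbove_ne k a, rfl⟩

/-- The normals of a non-degenerate family satisfy at most one linear relation. -/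
theorem IsNondegenerateFamily.relation_eq_zero {N : Vec} {G : Fin 5 → Mat}
    (h : IsNondegenerateFamily N G) {a : Fin 5 → ℝ} (ha : ∑ i, a i • G i *ᵥ N = 0) {k : Fin 5}
    (hk : a k = 0) (i : Fin 5) : a i = 0 := by
  rcases eq_or_ne i k with rfl | hi
  · exact hk
  obtain ⟨b, rfl⟩ := Fin.exists_succAbove_eq hi
  rw [Fin.sum_univ_succAbove _ k, hk, zero_smul, zero_add] at ha
  exact Fintype.linearIndependent_iff.1 (h.linearIndependent k) (fun b => a (k.succAbove b)) ha b

/-- Closure of the tetrahedra gives five linear relations between the normals, with a symmetric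
matrix of coefficients. The normals satisfy only one relation, so this matrix has rank one. -/
theorem IsClosedData.exists_isMinkowskiForm {g : Mat} {N : Vec} {v : Fin 5 → Fin 5 → Vec}
    {G : Fin 5 → Mat} (hD : IsClosedData g N v) (hG : IsSolution g N v G)
    (hnd : IsNondegenerateFamily N G) : ∃ s m, IsMinkowskiForm N v G s m := by
  have hP : ∀ {i j}, i ≠ j → wedge (G i *ᵥ N) (G j *ᵥ N) ≠ 0 :=
    fun h => IsClosedData.wedge_ne_of_isNondegenerateFamily hnd h
  have hex : ∀ i j, ∃ a b : ℝ, i ≠ j → G i *ᵥ v i j = a • G i *ᵥ N + b • G j *ᵥ N := by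
    intro i j
    by_cases hij : i = j
    · exact ⟨0, 0, fun h => absurd hij h⟩
    · obtain ⟨a, b, h⟩ := hD.exists_face_eq hG hij (hP hij)
      exact ⟨a, b, fun _ => h⟩
  choose κ l hl using hex
  have hw : ∀ i j, i ≠ j → wedge (G i *ᵥ v i j) (G i *ᵥ N) =
      l i j • wedge (G j *ᵥ N) (G i *ᵥ N) := by
    intro i j hij
    rw [hl i j hij, wedge_add_left, wedge_smul_left, wedge_smul_left, wedge_self, smul_zero,
      zero_add]
  have hsymm : ∀ i j, i ≠ j → l i j = l j i := by
    intro i j hij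
    have h := hD.wedge_eq hG hij
    rw [hw i j hij, hw j i hij.symm, wedge_swap (G i *ᵥ N), smul_neg, neg_neg] at h
    exact smul_left_injective _ (hP hij.symm) h
  have hne : ∀ i j, i ≠ j → l i j ≠ 0 := by
    intro i j hij h0
    have h := hl i j hij
    rw [h0, zero_smul, add_zero] at h
    have h2 := hD.dot_face_normal hG hij
    rw [h, dot_smul_left] at h2
    have h3 : κ i j = 0 := by simpa [hD.dot_normal_ne hG i] using h2
    rw [h3, zero_smul] at h
    obtain ⟨k, hik, hjk⟩ : ∃ k, i ≠ k ∧ j ≠ k := by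
      clear h0 h h2 h3; revert i j; decide
    exact (IsClosedData.linearIndependent_mulVec (hG.1 i)
      (hD.pair_linearIndependent hij hik hjk)).ne_zero 0 h
  set Λ : Fin 5 → Fin 5 → ℝ := fun i j =>
    if i = j then ∑ k ∈ Finset.univ.erase i, κ i k else l i j with hΛ
  have hΛne : ∀ i j, i ≠ j → Λ i j = l i j := fun i j hij => by simp [hΛ, hij]
  have hΛs : ∀ i j, Λ i j = Λ j i := by
    intro i j
    rcases eq_or_ne i j with rfl | hij
    · rfl
    · rw [hΛne i j hij, hΛne j i hij.symm, hsymm i j hij]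
  have hrel : ∀ i, ∑ j, Λ i j • G j *ᵥ N = 0 := by
    intro i
    have h := congrArg (fun z => G i *ᵥ z) (hD.closure i)
    simp only [mulVec_sum, mulVec_zero] at h
    rw [← h, ← Finset.add_sum_erase _ _ (Finset.mem_univ i)]
    simp only [hΛ, if_true, Finset.sum_smul]
    rw [← Finset.sum_add_distrib]
    refine Finset.sum_congr rfl fun j hj => ?_
    have hij : i ≠ j := (Finset.ne_of_mem_erase hj).symm
    rw [hl i j hij, if_neg hij]
  have h00 : Λ 0 0 ≠ 0 := fun h0 => hne 0 1 (by decide) (by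
    rw [← hΛne 0 1 (by decide)]
    exact hnd.relation_eq_zero (hrel 0) h0 1)
  have hrank : ∀ i j, Λ 0 0 * Λ i j = Λ 0 i * Λ 0 j := by
    intro i j
    have := hnd.relation_eq_zero (a := fun j => Λ 0 0 * Λ i j - Λ i 0 * Λ 0 j) (k := 0) (by
      simp only [sub_smul, mul_smul, Finset.sum_sub_distrib, ← Finset.smul_sum, hrel, smul_zero,
        sub_zero]) (by ring) j
    rw [hΛs 0 i]
    linarith
  set r := Real.sqrt |Λ 0 0| with hr
  have hr2 : r * r = |Λ 0 0| := Real.mul_self_sqrt (abs_nonneg _)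
  have hr0 : r ≠ 0 := fun h => h00 (by rw [h, zero_mul, eq_comm, abs_eq_zero] at hr2; exact hr2)
  have habs : |Λ 0 0| ≠ 0 := abs_ne_zero.2 h00
  refine ⟨Λ 0 0 / |Λ 0 0|, fun i => Λ 0 i / r, ⟨?_, fun i => ?_, ?_, fun i j hij => ?_⟩⟩
  · rcases abs_cases (Λ 0 0) with ⟨h, -⟩ | ⟨h, -⟩ <;> rw [h]
    · exact Or.inl (div_self h00)
    · exact Or.inr (by rw [div_neg, div_self h00])
  · refine div_ne_zero ?_ hr0
    rcases eq_or_ne 0 i with rfl | hi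
    · exact h00
    · rw [hΛne 0 i hi]; exact hne 0 i hi
  · have := congrArg (fun z => r⁻¹ • z) (hrel 0)
    simpa [Finset.smul_sum, smul_smul, div_eq_inv_mul] using this
  · rw [hw i j hij, wedge_smul_left, wedge_smul_right, smul_smul, smul_smul, ← hΛne i j hij]
    congr 1
    have h := hrank i j
    calc Λ i j = Λ 0 0 * (Λ 0 0 * Λ i j) / (Λ 0 0 * Λ 0 0) := by field_simp
      _ = Λ 0 0 * (Λ 0 i * Λ 0 j) / (|Λ 0 0| * (r * r)) := by rw [h, hr2, abs_mul_abs_self]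
      _ = _ := by field_simp

/-! ### Rigidity: the data determine the Minkowski form up to an orthogonal map -/

/-- The scalar product of the bivectors `a ∧ b` and `c ∧ d`. -/
def biDot (g : Mat) (a b c d : Vec) : ℝ := dot g a c * dot g b d - dot g a d * dot g b c

theorem biDot_left {g : Mat} (hg : gᵀ = g) {a b a' b' : Vec} {s : ℝ}
    (h : wedge a b = s • wedge a' b') (c d : Vec) :
    biDot g a b c d = s * biDot g a' b' c d := by
  have key : ∀ a b, biDot g a b c d = dot g c (contract g (wedge a b) d) := by
    intro a b
    rw [contract_wedge, dot_sub_right, dot_smul_right, dot_smul_right, biDot, dot_comm hg c a,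
      dot_comm hg c b]
    ring
  rw [key, key, h, ← dot_smul_right, contract, contract, smul_mulVec]

theorem biDot_comm {g : Mat} (hg : gᵀ = g) (a b c d : Vec) :
    biDot g a b c d = biDot g c d a b := by
  simp only [biDot, dot_comm hg c, dot_comm hg d]
  ring

theorem biDot_right {g : Mat} (hg : gᵀ = g) {c d c' d' : Vec} {s : ℝ}
    (h : wedge c d = s • wedge c' d') (a b : Vec) :
    biDot g a b c d = s * biDot g a b c' d' := by
  rw [biDot_comm hg, biDot_left hg h, biDot_comm hg]

/-- A tensor on five indices with the symmetries of the Riemann tensor, whose rows sum to zero,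
vanishes if its components with a repeated index do: by the sum rule, a component with distinct
indices is unchanged by the even permutations of all five indices, and then the Bianchi identity
makes three times this component vanish. -/
theorem riemann_eq_zero {f : Fin 5 → Fin 5 → Fin 5 → Fin 5 → ℝ}
    (hanti : ∀ i j k l, f i j k l = -f j i k l) (hsymm : ∀ i j k l, f i j k l = f k l i j)
    (hbianchi : ∀ i j k l, f i j k l + f i k l j + f i l j k = 0)
    (hsum : ∀ i j l, ∑ k, f i j k l = 0) (hrep : ∀ i j l, f i j i l = 0) (i j k l : Fin 5) :
    f i j k l = 0 := by
  have hanti' : ∀ i j k l, f i j k l = -f i j l k := fun i j k l => by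
    rw [hsymm, hanti, hsymm]
  by_cases hij : i = j
  · subst hij; linarith [hanti i i k l]
  by_cases hik : i = k
  · subst hik; exact hrep _ _ _
  by_cases hil : i = l
  · subst hil; rw [hanti', hrep, neg_zero]
  by_cases hjk : j = k
  · subst hjk; rw [hanti, hrep, neg_zero]
  by_cases hjl : j = l
  · subst hjl; rw [hanti, hanti', hrep]; simp
  by_cases hkl : k = l
  · subst hkl; linarith [hanti' i j k k]
  have rot : ∀ p : Fin 5 → Fin 5, p.Injective →
      f (p 0) (p 1) (p 2) (p 3) = f (p 0) (p 1) (p 3) (p 4) := by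
    intro p hp
    have hs := hsum (p 0) (p 1) (p 3)
    rw [← (Finite.injective_iff_bijective.1 hp).sum_comp, Fin.sum_univ_five, hrep,
      hanti _ _ (p 1), hrep, hanti' _ _ (p 4)] at hs
    have := hanti' (p 0) (p 1) (p 3) (p 3)
    linarith
  have key : ∀ p : Fin 5 → Fin 5, p.Injective →
      f (p 0) (p 1) (p 2) (p 3) = f (p 0) (p 2) (p 3) (p 1) := by
    intro p hp
    calc f (p 0) (p 1) (p 2) (p 3) = f (p 2) (p 3) (p 0) (p 1) := hsymm _ _ _ _
      _ = f (p 2) (p 3) (p 1) (p 4) := rot (p ∘ ![2, 3, 0, 1, 4]) (hp.comp (by decide))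
      _ = f (p 1) (p 4) (p 2) (p 3) := hsymm _ _ _ _
      _ = f (p 1) (p 4) (p 3) (p 0) := rot (p ∘ ![1, 4, 2, 3, 0]) (hp.comp (by decide))
      _ = f (p 1) (p 4) (p 0) (p 2) := rot (p ∘ ![1, 4, 3, 0, 2]) (hp.comp (by decide))
      _ = f (p 0) (p 2) (p 1) (p 4) := hsymm _ _ _ _
      _ = f (p 0) (p 2) (p 4) (p 3) := rot (p ∘ ![0, 2, 1, 4, 3]) (hp.comp (by decide))
      _ = f (p 0) (p 2) (p 3) (p 1) := rot (p ∘ ![0, 2, 4, 3, 1]) (hp.comp (by decide))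
  obtain ⟨m, him, hjm, hkm, hlm⟩ : ∃ m, i ≠ m ∧ j ≠ m ∧ k ≠ m ∧ l ≠ m := by
    clear hij hik hil hjk hjl hkl; revert i j k l; decide
  have hp : Function.Injective ![i, j, k, l, m] := by
    intro a b hab
    fin_cases a <;> fin_cases b <;> first | rfl | (simp at hab; grind)
  have h1 : f i j k l = f i k l j := key _ hp
  have h2 : f i k l j = f i l j k := key (![i, j, k, l, m] ∘ ![0, 2, 3, 1, 4])
    (hp.comp (by decide))
  linarith [hbianchi i j k l]

/-- A linear map that acts trivially on bivectors is `1` or the inversion. -/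
theorem eq_one_or_neg_one_of_wedge {T : Mat} (h : ∀ a b : Fin 4,
    wedge (T *ᵥ Pi.single a 1) (T *ᵥ Pi.single b 1) = wedge (Pi.single a 1) (Pi.single b 1)) :
    T = 1 ∨ T = -1 := by
  have hm : ∀ a b c d, T c a * T d b - T c b * T d a =
      (1 : Mat) c a * (1 : Mat) d b - (1 : Mat) c b * (1 : Mat) d a := by
    intro a b c d
    have := congrFun (congrFun (h a b) c) d
    simpa [wedge, vecMulVec_apply, Matrix.one_apply, Pi.single_apply] using this
  have hoff : ∀ c a, c ≠ a → T c a = 0 := by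
    intro c a hca
    obtain ⟨b, hba, hbc⟩ : ∃ b, b ≠ a ∧ b ≠ c := by
      clear hca; revert a c; decide
    have h1 := hm a b a b
    have h2 := hm a b c b
    have h3 := hm a b c a
    simp only [Matrix.one_apply, hca, hba, hba.symm, hbc.symm, if_true, if_false] at h1 h2 h3
    -- the determinant of the columns `a, a, b` and the rows `c, a, b` vanishes
    linear_combination (-T c a) * h1 + T a a * h2 - T b a * h3
  have hdiag : ∀ a b, a ≠ b → T a a * T b b = 1 := by
    intro a b hab
    have h1 := hm a b a b
    simpa [Matrix.one_apply, hab, hab.symm, hoff a b hab] using h1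
  have heq : ∀ a b, a ≠ b → T a a = T b b := by
    intro a b hab
    obtain ⟨c, hca, hcb⟩ : ∃ c, c ≠ a ∧ c ≠ b := by
      clear hab; revert a b; decide
    have h1 := hdiag a c hca.symm
    have h2 := hdiag b c hcb.symm
    have hc : T c c ≠ 0 := fun h0 => by rw [h0] at h1; simp at h1
    exact mul_right_cancel₀ hc (h1.trans h2.symm)
  have hT : T = T 0 0 • (1 : Mat) := by
    ext c a
    rcases eq_or_ne c a with rfl | hca
    · rcases eq_or_ne c 0 with rfl | h0
      · simp
      · simp [heq c 0 h0]
    · simp [hoff c a hca, hca]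
  have hsq : T 0 0 * T 0 0 = 1 := by
    conv_lhs => rw [heq 0 1 (by decide)]
    rw [mul_comm, heq 1 0 (by decide)]
    have := hdiag 0 1 (by decide)
    rwa [heq 1 0 (by decide)] at this
  rcases mul_self_eq_one_iff.1 hsq with h0 | h0 <;> rw [hT, h0] <;> simp

/-- Two families of vectors closing to zero, of which the first one spans, differ by an orthogonal
map if the scalar products of their bivectors agree (up to a sign that is fixed by the signs of
the norms). -/
theorem exists_isO_of_biDot_eq {g : Mat} (hg : gᵀ = g) {M M' : Fin 5 → Vec} (hM : ∑ i, M i = 0)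
    (hM' : ∑ i, M' i = 0) (hli : LinearIndependent ℝ fun a : Fin 4 => M a.succ)
    (hgdet : g.det ≠ 0)
    (hpos : ∃ i, 0 < dot g (M i) (M i) * dot g (M' i) (M' i))
    (hrep : ∀ i j l, biDot g (M i) (M j) (M i) (M l) = biDot g (M' i) (M' j) (M' i) (M' l)) :
    ∃ O : Mat, Oᵀ * g * O = g ∧ ∀ i, M' i = O *ᵥ M i := by
  have hbi : ∀ i j k l, biDot g (M i) (M j) (M k) (M l) = biDot g (M' i) (M' j) (M' k) (M' l) := by
    have := riemann_eq_zero (f := fun i j k l => biDot g (M i) (M j) (M k) (M l) -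
      biDot g (M' i) (M' j) (M' k) (M' l)) ?_ ?_ ?_ ?_ ?_
    · exact fun i j k l => sub_eq_zero.1 (this i j k l)
    · intro i j k l; simp only [biDot]; ring
    · intro i j k l; rw [biDot_comm hg (M i), biDot_comm hg (M' i)]
    · intro i j k l
      simp only [biDot, dot_comm hg (M j) (M k), dot_comm hg (M l) (M j), dot_comm hg (M l) (M k),
        dot_comm hg (M' j) (M' k), dot_comm hg (M' l) (M' j), dot_comm hg (M' l) (M' k)]
      ring
    · intro i j l
      simp only [biDot, Finset.sum_sub_distrib, ← Finset.sum_mul, ← Finset.mul_sum,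
        ← dot_sum_right, hM, hM']
      simp [dot]
    · intro i j l; exact sub_eq_zero.2 (hrep i j l)
  set E : Mat := Matrix.of fun μ a => M (Fin.succ a) μ with hE
  set E' : Mat := Matrix.of fun μ a => M' (Fin.succ a) μ with hE'
  have hEu : IsUnit E := by
    rw [← Matrix.linearIndependent_cols_iff_isUnit]
    exact hli
  have hcol : ∀ a, E *ᵥ Pi.single a 1 = M a.succ := fun a => by ext μ; simp [hE]
  have hcol' : ∀ a, E' *ᵥ Pi.single a 1 = M' a.succ := fun a => by ext μ; simp [hE']
  have hΓ : ∀ a b, (Eᵀ * g * E) a b = dot g (M a.succ) (M b.succ) := by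
    intro a b
    rw [← hcol a, ← hcol b, dot_mulVec]
    simp [dot]
  have hΓ' : ∀ a b, (E'ᵀ * g * E') a b = dot g (M' a.succ) (M' b.succ) := by
    intro a b
    rw [← hcol' a, ← hcol' b, dot_mulVec]
    simp [dot]
  set Γ := Eᵀ * g * E
  set Γ' := E'ᵀ * g * E'
  have hΓu : IsUnit Γ := by
    refine IsUnit.mul (IsUnit.mul ?_ ?_) hEu
    · rw [isUnit_iff_isUnit_det, det_transpose, ← isUnit_iff_isUnit_det]; exact hEu
    · rw [isUnit_iff_isUnit_det, isUnit_iff_ne_zero]; exact hgdet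
  have hinv : Γ⁻¹ * Γ = 1 := nonsing_inv_mul Γ ((isUnit_iff_isUnit_det Γ).1 hΓu)
  have hinv' : Γ * Γ⁻¹ = 1 := mul_nonsing_inv Γ ((isUnit_iff_isUnit_det Γ).1 hΓu)
  have hT := eq_one_or_neg_one_of_wedge (T := Γ⁻¹ * Γ') fun a b => by
    have h1 : wedge (Γ' *ᵥ Pi.single a 1) (Γ' *ᵥ Pi.single b 1) =
        wedge (Γ *ᵥ Pi.single a 1) (Γ *ᵥ Pi.single b 1) := by
      ext c d
      have := hbi c.succ d.succ a.succ b.succ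
      simp only [biDot, ← hΓ, ← hΓ'] at this
      simp only [wedge, Matrix.sub_apply, vecMulVec_apply, mulVec_single_one, col_apply]
      linarith
    have h2 : ∀ x, (Γ⁻¹ * Γ') *ᵥ x = Γ⁻¹ *ᵥ (Γ' *ᵥ x) := fun x => (mulVec_mulVec _ _ _).symm
    rw [h2, h2, ← act_wedge, h1, act_wedge, mulVec_mulVec, mulVec_mulVec, hinv, one_mulVec,
      one_mulVec]
  have hEinv : E⁻¹ * E = 1 := nonsing_inv_mul E ((isUnit_iff_isUnit_det E).1 hEu)
  have hOE : E' * E⁻¹ * E = E' := by rw [Matrix.mul_assoc, hEinv, Matrix.mul_one]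
  have hO : ∀ i, M' i = (E' * E⁻¹) *ᵥ M i := by
    have hs : ∀ a : Fin 4, M' a.succ = (E' * E⁻¹) *ᵥ M a.succ := by
      intro a
      rw [← hcol, mulVec_mulVec, hOE, hcol']
    intro i
    refine Fin.cases ?_ hs i
    rw [Fin.sum_univ_succ] at hM hM'
    rw [eq_neg_of_add_eq_zero_left hM, eq_neg_of_add_eq_zero_left hM', mulVec_neg, mulVec_sum]
    simp only [hs]
  set O := E' * E⁻¹
  have hcancel : ∀ A B : Mat, Eᵀ * A * E = Eᵀ * B * E → A = B := by
    intro A B h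
    have h2 := hEu.mul_right_cancel h
    have h3 : IsUnit Eᵀ := by
      rw [isUnit_iff_isUnit_det, det_transpose, ← isUnit_iff_isUnit_det]; exact hEu
    exact h3.mul_left_cancel h2
  have hS : Eᵀ * (Oᵀ * g * O) * E = Γ' := by
    calc Eᵀ * (Oᵀ * g * O) * E = (O * E)ᵀ * g * (O * E) := by
          simp only [transpose_mul, Matrix.mul_assoc]
      _ = Γ' := by rw [hOE]
  have hΓ2 : Γ' = Γ * (Γ⁻¹ * Γ') := by rw [← Matrix.mul_assoc, hinv', Matrix.one_mul]
  rcases hT with hT | hT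
  · refine ⟨O, hcancel _ _ ?_, hO⟩
    rw [hS, hΓ2, hT, Matrix.mul_one]
  · exfalso
    have h1 : Oᵀ * g * O = -g := by
      refine hcancel _ _ ?_
      rw [hS, hΓ2, hT]
      simp [Γ]
    obtain ⟨i, hi⟩ := hpos
    rw [hO i, dot_mulVec, h1] at hi
    have : dot (-g) (M i) (M i) = -dot g (M i) (M i) := by simp [dot, neg_mulVec]
    rw [this] at hi
    nlinarith [mul_self_nonneg (dot g (M i) (M i))]

/-! ### The two classes of solutions -/

namespace IsClosedData

variable {g : Mat} {N : Vec} {v : Fin 5 → Fin 5 → Vec} {G G' : Fin 5 → Mat}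

theorem linearIndependent_smul {m : Fin 5 → ℝ} (hm : ∀ i, m i ≠ 0)
    (hnd : IsNondegenerateFamily N G) :
    LinearIndependent ℝ fun a : Fin 4 => m a.succ • G a.succ *ᵥ N := by
  have := (hnd.linearIndependent 0).units_smul fun a => Units.mk0 (m a.succ) (hm a.succ)
  convert this using 1
  funext a
  simp [Units.smul_def]

/-- The products of the bivectors of one tetrahedron are determined by the data. -/
theorem biDot_minkowskiForm (hD : IsClosedData g N v) (hG : IsSolution g N v G) {s : ℝ}
    {m : Fin 5 → ℝ} (hM : IsMinkowskiForm N v G s m) {i j l : Fin 5} (hij : i ≠ j) (hil : i ≠ l) :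
    biDot g (m j • G j *ᵥ N) (m i • G i *ᵥ N) (m l • G l *ᵥ N) (m i • G i *ᵥ N) =
      dot g (v i j) (v i l) * dot g N N := by
  have hs : s * s = 1 := mul_self_eq_one_iff.2 hM.sign
  have h : ∀ {j}, i ≠ j → wedge (m j • G j *ᵥ N) (m i • G i *ᵥ N) =
      s • wedge (G i *ᵥ v i j) (G i *ᵥ N) := by
    intro j hij
    rw [hM.wedge_eq i j hij, smul_smul, hs, one_smul]
  rw [biDot_left hD.metric.symm (h hij), biDot_right hD.metric.symm (h hil), ← mul_assoc, hs,
    one_mul, biDot, (hG.1 i).dot, (hG.1 i).dot, hD.dot_face_normal hG hij]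
  ring

/-- The Minkowski forms of two solutions for the same data differ by an orthogonal map. -/
theorem exists_isO (hD : IsClosedData g N v) (hG : IsSolution g N v G)
    (hG' : IsSolution g N v G') (hnd : IsNondegenerateFamily N G) {s s' : ℝ} {m m' : Fin 5 → ℝ}
    (hM : IsMinkowskiForm N v G s m) (hM' : IsMinkowskiForm N v G' s' m') :
    ∃ O : Mat, Oᵀ * g * O = g ∧ ∀ i, m' i • G' i *ᵥ N = O *ᵥ (m i • G i *ᵥ N) := by
  have hsymm := hD.metric.symm
  refine exists_isO_of_biDot_eq hsymm hM.sum_eq_zero hM'.sum_eq_zero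
    (linearIndependent_smul hM.ne_zero hnd) (by rw [hD.metric.det]; norm_num) ⟨0, ?_⟩ ?_
  · simp only [dot_smul_left, dot_smul_right, hD.dot_normal hG, hD.dot_normal hG']
    have h1 := hM.ne_zero 0
    have h2 := hM'.ne_zero 0
    have h3 := hD.normalized.ne_zero
    have : 0 < (m 0 * m' 0 * dot g N N) ^ 2 := by positivity
    linarith
  · have hz : ∀ a b c : Vec, biDot g a a b c = 0 ∧ biDot g b c a a = 0 := fun a b c => by
      constructor <;> (simp only [biDot]; ring)
    have hf : ∀ a b c d : Vec, biDot g a b c d = biDot g b a d c := fun a b c d => by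
      simp only [biDot]; ring
    intro i j l
    by_cases hij : i = j
    · subst hij; rw [(hz _ _ _).1, (hz _ _ _).1]
    by_cases hil : i = l
    · subst hil; rw [(hz _ _ _).2, (hz _ _ _).2]
    rw [hf, hD.biDot_minkowskiForm hG hM hij hil, hf (m' i • _),
      hD.biDot_minkowskiForm hG' hM' hij hil]

/-- The orthogonal map that relates the Minkowski forms of two solutions relates the solutions:
the two sign freedoms are inversions in the tetrahedra and a common reflection. -/
theorem solutionEquiv_or (hD : IsClosedData g N v) (hG : IsNondegenerateSolution g N v G)
    (hG' : IsNondegenerateSolution g N v G') :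
    SolutionEquiv g G G' ∨
      SolutionEquiv g (fun i => reflection g N * G i * reflection g N) G' := by
  obtain ⟨hG, hnd⟩ := hG
  obtain ⟨hG', hnd'⟩ := hG'
  obtain ⟨s, m, hM⟩ := hD.exists_isMinkowskiForm hG hnd
  obtain ⟨s', m', hM'⟩ := hD.exists_isMinkowskiForm hG' hnd'
  obtain ⟨O, hO, hOm⟩ := hD.exists_isO hG hG' hnd hM hM'
  have hsymm := hD.metric.symm
  have hN0 := hD.normalized.ne_zero
  have hOdot : ∀ x y, dot g (O *ᵥ x) (O *ᵥ y) = dot g x y := fun x y => by rw [dot_mulVec, hO]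
  have hε : ∀ i, ∃ ε : ℝ, (ε = 1 ∨ ε = -1) ∧ m i = ε * m' i ∧
      G' i *ᵥ N = ε • O *ᵥ (G i *ᵥ N) := by
    intro i
    have h1 : m' i * m' i = m i * m i := by
      have := congrArg (fun z => dot g z z) (hOm i)
      simp only [hOdot, dot_smul_left, dot_smul_right, hD.dot_normal hG, hD.dot_normal hG'] at this
      apply mul_right_cancel₀ hN0
      linarith
    have h2 : m' i ≠ 0 := hM'.ne_zero i
    refine ⟨m i / m' i, ?_, (div_mul_cancel₀ _ h2).symm, ?_⟩
    · rw [← mul_self_eq_one_iff, div_mul_div_comm, h1, div_self]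
      exact mul_ne_zero (hM.ne_zero i) (hM.ne_zero i)
    · have := congrArg (fun z => (m' i)⁻¹ • z) (hOm i)
      simp only [mulVec_smul, smul_smul, inv_mul_cancel₀ h2, one_smul] at this
      rw [this, div_eq_inv_mul]
  choose ε hε1 hεm hεN using hε
  have hεε : ∀ i, ε i * ε i = 1 := fun i => mul_self_eq_one_iff.2 (hε1 i)
  have hεv : ∀ i j, i ≠ j → G' i *ᵥ v i j = (s * s' * ε i) • O *ᵥ (G i *ᵥ v i j) := by
    intro i j hij
    refine eq_of_wedge_eq (g := g) (n := G' i *ᵥ N) (hD.dot_face_normal hG' hij) ?_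
      (hD.dot_normal_ne hG' i) ?_
    · rw [hεN, dot_smul_left, dot_smul_right, hOdot, hD.dot_face_normal hG hij]; simp
    · have h1 := hM.wedge_eq i j hij
      have h2 : wedge (m j • G j *ᵥ N) (m i • G i *ᵥ N) =
          s • wedge (G i *ᵥ v i j) (G i *ᵥ N) := by
        rw [h1, smul_smul, mul_self_eq_one_iff.2 hM.sign, one_smul]
      rw [hM'.wedge_eq i j hij, hOm, hOm, ← act_wedge, h2, act_smul, act_wedge, hεN,
        wedge_smul_left, wedge_smul_right, smul_smul, smul_smul]
      congr 1
      linear_combination (-(s * s')) * hεε i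
  have hreflN : reflection g N *ᵥ N = -N := reflection_self hsymm hN0
  have hreflv : ∀ i j, i ≠ j → reflection g N *ᵥ v i j = v i j := fun i j hij =>
    reflection_of_dot_eq_zero hsymm (hD.orthogonal i j hij)
  have hsign : ∀ ε : ℝ, ε = 1 ∨ ε = -1 → ∃ t : Fin 2, ((-1 : Mat) ^ (t : ℕ)) = ε • (1 : Mat) := by
    rintro ε (rfl | rfl)
    · exact ⟨0, by simp⟩
    · exact ⟨1, by simp⟩
  have hdet : ∀ i, (G' i).det = 1 := fun i => (hG'.1 i).2
  have hdetε : ∀ i, (ε i • (1 : Mat)).det = 1 := fun i => by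
    rcases hε1 i with h | h <;> rw [h] <;> simp [det_neg_mat]
  have hss : s * s' = 1 ∨ s * s' = -1 := by
    rcases hM.sign with rfl | rfl <;> rcases hM'.sign with rfl | rfl <;> simp
  rcases hss with hss | hss
  · left
    have hGi : ∀ i, G' i = O * (ε i • (1 : Mat)) * G i := by
      intro i
      refine hD.mat_ext i ?_ fun j hij => ?_
      · rw [hεN]; simp [smul_mulVec, ← mulVec_mulVec]
      · rw [hεv i j hij, hss]; simp [smul_mulVec, ← mulVec_mulVec]
    have hOdet : O.det = 1 := by
      have h := congrArg Matrix.det (hGi 0)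
      rwa [hdet, det_mul, det_mul, hdetε, (hG.1 0).2, mul_one, mul_one, eq_comm] at h
    choose t ht using fun i => hsign (ε i) (hε1 i)
    exact ⟨O, ⟨hO, hOdet⟩, t, fun i => by rw [ht, hGi i]⟩
  · right
    have hGi : ∀ i, G' i = O * reflection g N * (-ε i • (1 : Mat)) *
        (reflection g N * G i * reflection g N) := by
      intro i
      have h : O * reflection g N * (-ε i • (1 : Mat)) *
          (reflection g N * G i * reflection g N) = -ε i • (O * (reflection g N * reflection g N) *
            G i * reflection g N) := by
        simp [Matrix.mul_assoc]
      rw [h, reflection_sq hsymm hN0]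
      refine hD.mat_ext i ?_ fun j hij => ?_
      · rw [hεN]; simp [← mulVec_mulVec, hreflN, mulVec_neg, neg_mulVec, smul_mulVec]
      · rw [hεv i j hij, hss]; simp [← mulVec_mulVec, hreflv i j hij, neg_mulVec, smul_mulVec]
    have hdet' : ∀ i, (-ε i • (1 : Mat)).det = 1 := fun i => by
      rw [neg_smul, det_neg_mat, hdetε]
    have hR := reflection_det g hN0
    have hOdet : (O * reflection g N).det = 1 := by
      have h := congrArg Matrix.det (hGi 0)
      rw [hdet, det_mul, det_mul _ (-ε 0 • (1 : Mat)), hdet', det_mul (_ * _) (reflection g N),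
        det_mul _ (G 0), (hG.1 0).2, hR] at h
      linarith
    choose t ht using fun i => hsign (-ε i) (by
      rcases hε1 i with h | h <;> rw [h] <;> simp)
    exact ⟨O * reflection g N, ⟨isO_mul hO (reflection_isO hsymm hN0), hOdet⟩, t,
      fun i => by rw [ht, hGi i]⟩

theorem reflected_isSO (hD : IsClosedData g N v) {e : Vec} (he : IsNormalized g e) {H : Mat}
    (hH : IsSO g H) : IsSO g (reflection g e * H * reflection g N) := by
  have hsymm := hD.metric.symm
  refine ⟨isO_mul (isO_mul (reflection_isO hsymm he.ne_zero) hH.1)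
    (reflection_isO hsymm hD.normalized.ne_zero), ?_⟩
  rw [det_mul, det_mul, reflection_det g he.ne_zero, reflection_det g hD.normalized.ne_zero, hH.2]
  norm_num

theorem reflected_isNondegenerateSolution (hD : IsClosedData g N v)
    (hG : IsNondegenerateSolution g N v G) {e : Vec} (he : IsNormalized g e) :
    IsNondegenerateSolution g N v fun i => reflection g e * G i * reflection g N := by
  have hsymm := hD.metric.symm
  have hRN : ∀ i, (reflection g e * G i * reflection g N) *ᵥ N =
      -(reflection g e *ᵥ (G i *ᵥ N)) := fun i => by
    rw [← mulVec_mulVec, ← mulVec_mulVec, reflection_self hsymm hD.normalized.ne_zero, mulVec_neg,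
      mulVec_neg]
  have hRv : ∀ i j, i ≠ j → (reflection g e * G i * reflection g N) *ᵥ v i j =
      reflection g e *ᵥ (G i *ᵥ v i j) := fun i j hij => by
    rw [← mulVec_mulVec, ← mulVec_mulVec, reflection_of_dot_eq_zero hsymm (hD.orthogonal i j hij)]
  have hsol : IsSolution g N v fun i => reflection g e * G i * reflection g N := by
    rw [hD.isSolution_iff]
    refine ⟨fun i => hD.reflected_isSO he (hG.1.1 i), fun i j hij => ?_⟩
    rw [hRN, hRN, hRv i j hij, hRv j i hij.symm, wedge_neg_right, wedge_neg_right,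
      ← act_wedge (reflection g e), ← act_wedge (reflection g e), hD.wedge_eq hG.1 hij, act_neg]
  refine ⟨hsol, hD.isNondegenerateFamily_of_wedge_ne hsol ⟨0, 1, ?_⟩⟩
  rw [hRN, hRN, wedge_neg_left, wedge_neg_right, neg_neg, ← act_wedge]
  intro h0
  apply wedge_ne_of_isNondegenerateFamily hG.2 (show (0 : Fin 5) ≠ 1 by decide)
  have := congrArg (act (reflection g e)) h0
  rw [act_act, reflection_sq hsymm he.ne_zero] at this
  simpa [act] using this

/-- A rotation relating a solution to its reflection would give an orthogonal map of determinant
`-1` for which all normals are eigenvectors; the relation between the normals makes the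
eigenvalues agree, so this map would be `1` or `-1`. -/
theorem not_solutionEquiv_reflected (hD : IsClosedData g N v)
    (hG : IsNondegenerateSolution g N v G) {e : Vec} (he : IsNormalized g e) :
    ¬ SolutionEquiv g G fun i => reflection g e * G i * reflection g N := by
  rintro ⟨K, hK, t, ht⟩
  have hsymm := hD.metric.symm
  obtain ⟨s, m, hM⟩ := hD.exists_isMinkowskiForm hG.1 hG.2
  set O := reflection g e * K with hO
  have hOdet : O.det = -1 := by rw [hO, det_mul, reflection_det g he.ne_zero, hK.2, mul_one]
  have heig : ∀ i, ∃ δ : ℝ, (δ = 1 ∨ δ = -1) ∧ O *ᵥ (G i *ᵥ N) = δ • G i *ᵥ N := by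
    intro i
    have h1 := congrArg (fun A => reflection g e *ᵥ (A *ᵥ N)) (ht i)
    simp only [← mulVec_mulVec, reflection_self hsymm hD.normalized.ne_zero, mulVec_neg] at h1
    rw [mulVec_mulVec, reflection_sq hsymm he.ne_zero, one_mulVec, mulVec_mulVec, ← hO] at h1
    have h01 : t i = 0 ∨ t i = 1 := by have := (t i).2; omega
    rcases h01 with h | h <;> rw [h] at h1
    · exact ⟨-1, Or.inr rfl, by simpa using h1.symm⟩
    · exact ⟨1, Or.inl rfl, by simpa [neg_mulVec, mulVec_neg] using h1.symm⟩
  choose δ hδ1 hδ using heig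
  have hconst : ∀ i, δ i = δ 0 := by
    intro i
    have h1 := congrArg (fun z => O *ᵥ z) hM.sum_eq_zero
    simp only [mulVec_sum, mulVec_smul, hδ, mulVec_zero] at h1
    have h2 := hG.2.relation_eq_zero (a := fun i => (δ i - δ 0) * m i) (k := 0) (by
      have h3 := congrArg (fun z => δ 0 • z) hM.sum_eq_zero
      simp only [Finset.smul_sum, smul_zero] at h3
      rw [← sub_eq_zero.2 (h1.trans h3.symm), ← Finset.sum_sub_distrib]
      exact Finset.sum_congr rfl fun i _ => by module) (by simp) i
    simpa [hM.ne_zero i, sub_eq_zero] using h2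
  have hOδ : O = δ 0 • (1 : Mat) := by
    rw [← sub_eq_zero]
    funext μ
    refine (span_eq_top_iff _).1 (hG.2 0) _ ?_
    rintro _ ⟨i, -, rfl⟩
    refine (congrFun (sub_mulVec O (δ 0 • (1 : Mat)) (G i *ᵥ N)) μ).trans ?_
    rw [hδ, hconst]
    simp [smul_mulVec]
  rw [hOδ] at hOdet
  rcases hδ1 0 with h | h <;> rw [h] at hOdet <;> simp [det_neg_mat] at hOdet <;> norm_num at hOdet

end IsClosedData

/-! ### The flipped space -/

theorem mulVec_minkowski (x : Vec) : minkowski *ᵥ x = ![x 0, -x 1, -x 2, -x 3] := by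
  ext i; fin_cases i <;> simp [minkowski, mulVec_diagonal]

theorem minkowski_transpose : minkowskiᵀ = minkowski := by simp [minkowski]

theorem isNormalized_minkowski {N : Vec} (hN : N = e0 ∨ N = e3) : IsNormalized minkowski N := by
  rcases hN with rfl | rfl
  · left; simp [dot, mulVec_minkowski, e0]
  · right; simp [dot, mulVec_minkowski, e3]

theorem dot_flipped (N x y : Vec) : dot (flipped N) x y = dot minkowski x y -
    2 / dot minkowski N N * (dot minkowski x N * dot minkowski y N) := by
  rw [flipped, dot, sub_mulVec, smul_mulVec, vecMulVec_mulVec, dotProduct_sub, dotProduct_smul,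
    op_smul_eq_smul, dotProduct_smul, dotProduct_comm _ y]
  simp only [dot, smul_eq_mul]
  ring

theorem dot_flipped_right {N : Vec} (hN : N = e0 ∨ N = e3) (x : Vec) :
    dot (flipped N) x N = -dot minkowski x N := by
  have := (isNormalized_minkowski hN).ne_zero
  rw [dot_flipped]
  field_simp
  ring

theorem isMetric_flipped {N : Vec} (hN : N = e0 ∨ N = e3) : IsMetric (flipped N) := by
  obtain ⟨d, hd, h⟩ := flipped_eq N hN
  rw [hd]
  refine ⟨by simp, ?_, ?_⟩
  · rw [diagonal_mul_diagonal, ← diagonal_one]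
    congr 1
    ext i
    rcases h with ⟨-, rfl⟩ | ⟨-, rfl⟩ <;> fin_cases i <;> simp
  · rcases h with ⟨-, rfl⟩ | ⟨-, rfl⟩ <;> simp [det_diagonal, Fin.prod_univ_four]

theorem isNormalized_flipped {N : Vec} (hN : N = e0 ∨ N = e3) : IsNormalized (flipped N) N := by
  rw [IsNormalized, dot_flipped_right hN]
  rcases isNormalized_minkowski hN with h | h <;> rw [h] <;> simp

/-- Flipping the metric along `N` does not change the group of rotations that fix `N`. -/
theorem isSOV_iff {N : Vec} (hN : N = e0 ∨ N = e3) (K : Mat) :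
    IsSOV N K ↔ IsSO (flipped N) K ∧ K *ᵥ N = N := by
  have key : ∀ g h : Mat, gᵀ = g → ∀ c : ℝ,
      (∀ x y, dot h x y = dot g x y - c * (dot g x N * dot g y N)) → K *ᵥ N = N →
      Kᵀ * g * K = g → Kᵀ * h * K = h := by
    intro g h hg c hh hKN hK
    refine eq_of_dot_eq fun x y => ?_
    have h1 : ∀ x y, dot g (K *ᵥ x) (K *ᵥ y) = dot g x y := fun x y => by rw [dot_mulVec, hK]
    have h2 : ∀ x, dot g (K *ᵥ x) N = dot g x N := fun x => by
      conv_lhs => rw [← hKN]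
      exact h1 x N
    rw [← dot_mulVec, hh, hh, h1, h2, h2]
  have hflip : ∀ x y, dot minkowski x y = dot (flipped N) x y -
      -(2 / dot minkowski N N) * (dot (flipped N) x N * dot (flipped N) y N) := by
    intro x y
    rw [dot_flipped_right hN, dot_flipped_right hN, dot_flipped]
    ring
  constructor
  · rintro ⟨⟨h1, h2⟩, h3⟩
    exact ⟨⟨key _ _ minkowski_transpose _ (dot_flipped N) h3 h1, h2⟩, h3⟩
  · rintro ⟨⟨h1, h2⟩, h3⟩
    exact ⟨⟨key _ _ (isMetric_flipped hN).symm _ hflip h3 h1, h2⟩, h3⟩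

theorem isClosedData_flipped {N : Vec} (hN : N = e0 ∨ N = e3) {rho : Fin 5 → Fin 5 → ℝ}
    {v : Fin 5 → Fin 5 → Vec} (hv : IsBoundaryData N rho v) (hnd : IsNondegenerateData v) :
    IsClosedData (flipped N) N v where
  metric := isMetric_flipped hN
  normalized := isNormalized_flipped hN
  orthogonal i j hij := by rw [dot_flipped_right hN, hv.orthogonal i j hij, neg_zero]
  closure := hv.closure
  nondegenerate := hnd

theorem mat_ext_of_orthogonal {g : Mat} {N : Vec} (hN : dot g N N ≠ 0) {A B : Mat}
    (h : A *ᵥ N = B *ᵥ N) (hx : ∀ x, dot g x N = 0 → A *ᵥ x = B *ᵥ x) : A = B := by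
  refine Matrix.mulVec_injective (funext fun x => ?_)
  have hd : x = (x - (dot g x N / dot g N N) • N) + (dot g x N / dot g N N) • N := by module
  rw [hd, mulVec_add, mulVec_add, mulVec_smul, mulVec_smul, h, hx]
  rw [dot_sub_left, dot_smul_left, div_mul_cancel₀ _ hN, sub_self]

/-! ### The self-dual decomposition of bivectors and rotations -/

section Phi

variable {N : Vec} {σ : ℝ}

theorem bivectorPhi_neg (N : Vec) (σ : ℝ) (B : Mat) :
    bivectorPhi N σ (-B) = -bivectorPhi N σ B := by
  simpa using bivectorPhi_smul N σ (-1) B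

theorem hodge_transpose (hN : N = e0 ∨ N = e3) {B : Mat} (hB : Bᵀ = -B) :
    (hodge (flipped N) B)ᵀ = -hodge (flipped N) B := by
  obtain ⟨d, hd, -⟩ := flipped_eq N hN
  rw [eq_asym B hB, hd, hodge_asym, asym]
  ext i j
  fin_cases i <;> fin_cases j <;> simp

theorem hodge_wedge_transpose (hN : N = e0 ∨ N = e3) (x y : Vec) :
    (hodge (flipped N) (wedge x y))ᵀ = -hodge (flipped N) (wedge x y) :=
  hodge_transpose hN (wedge_transpose x y)

theorem bivectorPhi_hodge (hN : N = e0 ∨ N = e3) (hσ : σ = 1 ∨ σ = -1) {B : Mat} (hB : Bᵀ = -B) :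
    bivectorPhi N σ (hodge (flipped N) B) = σ • bivectorPhi N σ B := by
  have hs : σ * σ = 1 := mul_self_eq_one_iff.2 hσ
  have e : σ • hodge (flipped N) B + B = σ • (σ • B + hodge (flipped N) B) := by
    rw [smul_add, smul_smul, hs, one_smul, add_comm]
  simp only [bivectorPhi, contract]
  rw [hodge_hodge (isMetric_flipped hN) B hB, e, smul_mulVec, smul_comm]

/-- A bivector is determined by its self-dual and anti-self-dual parts. -/
theorem eq_of_bivectorPhi_eq (hN : N = e0 ∨ N = e3) {B C : Mat} (hB : Bᵀ = -B) (hC : Cᵀ = -C)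
    (h1 : bivectorPhi N 1 B = bivectorPhi N 1 C)
    (h2 : bivectorPhi N (-1) B = bivectorPhi N (-1) C) : B = C := by
  rw [← sub_eq_zero]
  have hBC : (B - C)ᵀ = -(B - C) := by rw [transpose_sub, hB, hC]; abel
  have hs : ∀ σ : ℝ, bivectorPhi N σ B = bivectorPhi N σ C → bivectorPhi N σ (B - C) = 0 := by
    intro σ h
    rw [sub_eq_add_neg, bivectorPhi_add, bivectorPhi_neg, h, add_neg_cancel]
  have k1 := (phi_kernel N hN 1 (Or.inl rfl) _ hBC).2
  have k2 := (phi_kernel N hN (-1) (Or.inr rfl) _ hBC).2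
  have hz : hodge (flipped N) (wedge 0 N) = 0 := by
    rw [wedge_zero_left]; simpa using hodge_smul (flipped N) 0 0
  rw [hs _ h1, hz, sub_zero] at k1
  rw [hs _ h2, hz, sub_zero] at k2
  have h3 : (-(1 : ℝ)) • (B - C) = (- -(1 : ℝ)) • (B - C) := k1.symm.trans k2
  have h4 : (2 : ℝ) • (B - C) = 0 := by
    rw [neg_neg] at h3
    calc (2 : ℝ) • (B - C) = (1 : ℝ) • (B - C) - (-(1 : ℝ)) • (B - C) := by module
      _ = 0 := by rw [h3, sub_self]
  exact (smul_eq_zero.1 h4).resolve_left (by norm_num)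

/-- `x ↦ ⋆(x ∧ N)` is a section of both maps `Φ^±` on bivectors. -/
theorem bivectorPhi_wedge (hN : N = e0 ∨ N = e3) {x : Vec} (hx : dot (flipped N) x N = 0) :
    bivectorPhi N σ (hodge (flipped N) (wedge x N)) = x := by
  have hz : contract (flipped N) (hodge (flipped N) (wedge x N)) N = 0 := by
    obtain ⟨d, hd, h⟩ := flipped_eq N hN
    rw [hd, wedge_eq_asym, hodge_asym, contract, asym_mulVec]
    rcases h with ⟨rfl, rfl⟩ | ⟨rfl, rfl⟩ <;> ext i <;> fin_cases i <;>
      simp [mulVec_diagonal, e0, e3]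
  have hm := (isNormalized_flipped hN).mul_self
  have hz2 : ∀ A B : Mat, contract (flipped N) (A + B) N =
      contract (flipped N) A N + contract (flipped N) B N := fun A B => add_mulVec _ _ _
  have hz3 : ∀ A : Mat, contract (flipped N) (σ • A) N = σ • contract (flipped N) A N :=
    fun A => smul_mulVec _ _ _
  rw [bivectorPhi, hz2, hz3, hz, hodge_hodge (isMetric_flipped hN) _ (wedge_transpose _ _),
    contract_wedge, hx, smul_zero, zero_add, zero_smul, sub_zero, smul_smul, hm, one_smul]

theorem dot_bivectorPhi (hN : N = e0 ∨ N = e3) (hσ : σ = 1 ∨ σ = -1) {B : Mat} (hB : Bᵀ = -B) :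
    dot (flipped N) (bivectorPhi N σ B) N = 0 :=
  (phi_kernel N hN σ hσ B hB).1

theorem groupPhi_mulVec_normal (hN : N = e0 ∨ N = e3) (G : Mat) : groupPhi N σ G *ᵥ N = N := by
  rw [groupPhi_mulVec, wedge_self, div_self (isNormalized_flipped hN).ne_zero, one_smul]
  have : hodge (flipped N) 0 = 0 := by simpa using hodge_smul (flipped N) 0 0
  rw [this]
  simp [act, bivectorPhi, contract, this]

theorem groupPhi_mulVec_of_orthogonal (G : Mat) {x : Vec} (hx : dot (flipped N) x N = 0) :
    groupPhi N σ G *ᵥ x = bivectorPhi N σ (act G (hodge (flipped N) (wedge x N))) := by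
  rw [groupPhi_mulVec, hx, zero_div, zero_smul, add_zero]

theorem dot_groupPhi (hN : N = e0 ∨ N = e3) (hσ : σ = 1 ∨ σ = -1) (G : Mat) {x : Vec}
    (hx : dot (flipped N) x N = 0) : dot (flipped N) (groupPhi N σ G *ᵥ x) N = 0 := by
  rw [groupPhi_mulVec_of_orthogonal G hx]
  exact dot_bivectorPhi hN hσ (act_transpose _ _ (hodge_wedge_transpose hN _ _))

/-- For `x ⟂ N`, the bivector `B` with `⋆ B = σ • B` and `Φ^σ(B) = 2 • x`. -/
noncomputable def dualPart (N : Vec) (σ : ℝ) (x : Vec) : Mat :=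
  hodge (flipped N) (wedge x N) + σ • wedge x N

theorem dualPart_transpose (hN : N = e0 ∨ N = e3) (x : Vec) :
    (dualPart N σ x)ᵀ = -dualPart N σ x := by
  rw [dualPart, transpose_add, transpose_smul, hodge_wedge_transpose hN, wedge_transpose]
  module

theorem bivectorPhi_dualPart (hN : N = e0 ∨ N = e3) (hσ : σ = 1 ∨ σ = -1) {τ : ℝ} {x : Vec}
    (hx : dot (flipped N) x N = 0) : bivectorPhi N σ (dualPart N τ x) = (1 + τ * σ) • x := by
  have h := bivectorPhi_hodge hN hσ (hodge_wedge_transpose hN x N)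
  rw [hodge_hodge (isMetric_flipped hN) _ (wedge_transpose _ _), bivectorPhi_wedge hN hx] at h
  rw [dualPart, bivectorPhi_add, bivectorPhi_smul, h, bivectorPhi_wedge hN hx]
  module

/-- A rotation acts on the eigenspace of the Hodge star of eigenvalue `σ` through `Φ^σ`. -/
theorem act_dualPart (hN : N = e0 ∨ N = e3) (hσ : σ = 1 ∨ σ = -1) {G : Mat}
    (hG : IsSO (flipped N) G) {x : Vec} (hx : dot (flipped N) x N = 0) :
    act G (dualPart N σ x) = dualPart N σ (groupPhi N σ G *ᵥ x) := by
  have h : ∀ τ : ℝ, τ = 1 ∨ τ = -1 → bivectorPhi N τ (act G (dualPart N σ x)) =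
      bivectorPhi N τ (dualPart N σ (groupPhi N σ G *ᵥ x)) := by
    intro τ hτ
    rw [← groupPhi_mulVec_bivectorPhi N hN τ hτ G _ hG (dualPart_transpose hN x),
      bivectorPhi_dualPart hN hτ hx, bivectorPhi_dualPart hN hτ (dot_groupPhi hN hσ G hx),
      mulVec_smul]
    rcases hσ with rfl | rfl <;> rcases hτ with rfl | rfl <;> norm_num
  exact eq_of_bivectorPhi_eq hN (act_transpose _ _ (dualPart_transpose hN x))
    (dualPart_transpose hN _) (h 1 (Or.inl rfl)) (h (-1) (Or.inr rfl))

theorem trace_act_mul_act {g G : Mat} (hG : Gᵀ * g * G = g) (A B : Mat) :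
    trace (act G A * g * act G B * g) = trace (A * g * B * g) := by
  calc trace (act G A * g * act G B * g) = trace (G * (A * (Gᵀ * g * G) * B * (Gᵀ * g))) := by
        simp only [act, Matrix.mul_assoc]
    _ = trace (A * (Gᵀ * g * G) * B * (Gᵀ * g * G)) := by
        rw [trace_mul_comm]; simp only [Matrix.mul_assoc]
    _ = _ := by rw [hG]

theorem trace_act_mul_act_mul_act {g G : Mat} (hG : Gᵀ * g * G = g) (A B C : Mat) :
    trace (act G A * g * act G B * g * act G C * g) = trace (A * g * B * g * C * g) := by
  calc trace (act G A * g * act G B * g * act G C * g) =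
        trace (G * (A * (Gᵀ * g * G) * B * (Gᵀ * g * G) * C * (Gᵀ * g))) := by
        simp only [act, Matrix.mul_assoc]
    _ = trace (A * (Gᵀ * g * G) * B * (Gᵀ * g * G) * C * (Gᵀ * g * G)) := by
        rw [trace_mul_comm]; simp only [Matrix.mul_assoc]
    _ = _ := by rw [hG]

theorem flipped_e0 : flipped e0 = diagonal ![-1, -1, -1, -1] := by
  obtain ⟨d, hd, h⟩ := flipped_eq e0 (Or.inl rfl)
  rcases h with ⟨-, rfl⟩ | ⟨h, -⟩
  · exact hd
  · simpa [e0, e3] using congrFun h 0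

theorem flipped_e3 : flipped e3 = diagonal ![1, -1, -1, 1] := by
  obtain ⟨d, hd, h⟩ := flipped_eq e3 (Or.inr rfl)
  rcases h with ⟨h, -⟩ | ⟨-, rfl⟩
  · simpa [e0, e3] using congrFun h 0
  · exact hd

theorem dualPart_e0 (σ a b c : ℝ) : dualPart e0 σ ![0, a, b, c] * flipped e0 =
    asym (σ * a) (σ * b) (σ * c) c (-b) a := by
  rw [dualPart, flipped_e0, wedge_eq_asym, hodge_asym]
  ext i j
  fin_cases i <;> fin_cases j <;> simp [asym, e0]

theorem dualPart_e3 (σ a b c : ℝ) : dualPart e3 σ ![a, b, c, 0] * flipped e3 =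
    !![0, c, -b, σ * a; c, 0, -a, σ * b; -b, a, 0, σ * c; -(σ * a), σ * b, σ * c, 0] := by
  rw [dualPart, flipped_e3, wedge_eq_asym, hodge_asym]
  ext i j
  fin_cases i <;> fin_cases j <;> simp [asym, e3]

theorem orthogonal_e0 {x : Vec} (hx : dot (flipped e0) x e0 = 0) :
    ∃ a b c : ℝ, x = ![0, a, b, c] := by
  refine ⟨x 1, x 2, x 3, ?_⟩
  have h : x 0 = 0 := by
    rw [dot_flipped_right (Or.inl rfl), dot, mulVec_minkowski] at hx
    simpa [e0, dotProduct, Fin.sum_univ_four] using hx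
  ext i; fin_cases i <;> simp [h]

theorem orthogonal_e3 {x : Vec} (hx : dot (flipped e3) x e3 = 0) :
    ∃ a b c : ℝ, x = ![a, b, c, 0] := by
  refine ⟨x 0, x 1, x 2, ?_⟩
  have h : x 3 = 0 := by
    rw [dot_flipped_right (Or.inr rfl), dot, mulVec_minkowski] at hx
    simpa [e3, dotProduct, Fin.sum_univ_four] using hx
  ext i; fin_cases i <;> simp [h]

theorem dot_flipped_e0_self : dot (flipped e0) e0 e0 = -1 := by
  rw [dot_flipped_right (Or.inl rfl), dot, mulVec_minkowski]
  simp [e0]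

theorem dot_flipped_e3_self : dot (flipped e3) e3 e3 = 1 := by
  rw [dot_flipped_right (Or.inr rfl), dot, mulVec_minkowski]
  simp [e3]

theorem trace_dualPart_mul (hN : N = e0 ∨ N = e3) (hσ : σ = 1 ∨ σ = -1) {x y : Vec}
    (hx : dot (flipped N) x N = 0) (hy : dot (flipped N) y N = 0) :
    trace (dualPart N σ x * flipped N * dualPart N σ y * flipped N) =
      -4 * dot (flipped N) N N * dot (flipped N) x y := by
  have hs : σ ^ 2 = 1 := by rw [sq]; exact mul_self_eq_one_iff.2 hσ
  rw [Matrix.mul_assoc (dualPart N σ x * _)]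
  rcases hN with rfl | rfl
  · obtain ⟨a, b, c, rfl⟩ := orthogonal_e0 hx
    obtain ⟨a', b', c', rfl⟩ := orthogonal_e0 hy
    rw [dualPart_e0, dualPart_e0, dot_flipped_e0_self, flipped_e0]
    simp [trace, Fin.sum_univ_four, asym, dot, mulVec_diagonal, dotProduct]
    linear_combination (-2 * (a * a' + b * b' + c * c')) * hs
  · obtain ⟨a, b, c, rfl⟩ := orthogonal_e3 hx
    obtain ⟨a', b', c', rfl⟩ := orthogonal_e3 hy
    rw [dualPart_e3, dualPart_e3, dot_flipped_e3_self, flipped_e3]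
    simp [trace, Fin.sum_univ_four, dot, mulVec_diagonal, dotProduct]
    linear_combination (-2 * (a * a' - b * b' - c * c')) * hs

theorem trace_dualPart_mul_mul (hN : N = e0 ∨ N = e3) (hσ : σ = 1 ∨ σ = -1) {x y z : Vec}
    (hx : dot (flipped N) x N = 0) (hy : dot (flipped N) y N = 0) (hz : dot (flipped N) z N = 0) :
    trace (dualPart N σ x * flipped N * dualPart N σ y * flipped N * dualPart N σ z * flipped N) =
      4 * dot (flipped N) N N * (Matrix.of ![x, y, z, N]).det := by
  have hs : σ ^ 2 = 1 := by rw [sq]; exact mul_self_eq_one_iff.2 hσ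
  rw [Matrix.mul_assoc _ (dualPart N σ z), Matrix.mul_assoc (dualPart N σ x * _)]
  rcases hN with rfl | rfl
  · obtain ⟨a, b, c, rfl⟩ := orthogonal_e0 hx
    obtain ⟨a', b', c', rfl⟩ := orthogonal_e0 hy
    obtain ⟨a'', b'', c'', rfl⟩ := orthogonal_e0 hz
    rw [dualPart_e0, dualPart_e0, dualPart_e0, dot_flipped_e0_self]
    simp [trace, asym, det_succ_row_zero, Fin.sum_univ_succ,
      Fin.succAbove, e0]
    linear_combination (3 * (a * (b' * c'' - c' * b'') - b * (a' * c'' - c' * a'') +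
      c * (a' * b'' - b' * a''))) * hs
  · obtain ⟨a, b, c, rfl⟩ := orthogonal_e3 hx
    obtain ⟨a', b', c', rfl⟩ := orthogonal_e3 hy
    obtain ⟨a'', b'', c'', rfl⟩ := orthogonal_e3 hz
    rw [dualPart_e3, dualPart_e3, dualPart_e3, dot_flipped_e3_self]
    simp [trace, det_succ_row_zero, Fin.sum_univ_succ,
      Fin.succAbove, e3]
    linear_combination (3 * (a * (b' * c'' - c' * b'') - b * (a' * c'' - c' * a'') +
      c * (a' * b'' - b' * a''))) * hs

/-- The invariant quadratic and cubic trace forms on self-dual bivectors are the scalar product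
and the volume form of `V`, so the action of a rotation on self-dual bivectors is a rotation. -/
theorem groupPhi_isSO (hN : N = e0 ∨ N = e3) (hσ : σ = 1 ∨ σ = -1) {G : Mat}
    (hG : IsSO (flipped N) G) : IsSO (flipped N) (groupPhi N σ G) := by
  set H := groupPhi N σ G with hH
  have hsymm := (isMetric_flipped hN).symm
  have hN0 := (isNormalized_flipped hN).ne_zero
  have hHN : H *ᵥ N = N := groupPhi_mulVec_normal hN G
  have hHx : ∀ {x}, dot (flipped N) x N = 0 → dot (flipped N) (H *ᵥ x) N = 0 :=
    fun hx => dot_groupPhi hN hσ G hx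
  have hdot : ∀ {x y}, dot (flipped N) x N = 0 → dot (flipped N) y N = 0 →
      dot (flipped N) (H *ᵥ x) (H *ᵥ y) = dot (flipped N) x y := by
    intro x y hx hy
    have h := trace_act_mul_act hG.1 (dualPart N σ x) (dualPart N σ y)
    rw [act_dualPart hN hσ hG hx, act_dualPart hN hσ hG hy, trace_dualPart_mul hN hσ hx hy,
      trace_dualPart_mul hN hσ (hHx hx) (hHx hy)] at h
    exact mul_left_cancel₀ (mul_ne_zero (by norm_num) hN0) h
  refine ⟨eq_of_dot_eq fun x y => ?_, ?_⟩
  · have hd : ∀ x, ∃ x' c, dot (flipped N) x' N = 0 ∧ x = x' + c • N := fun x =>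
      ⟨x - (dot (flipped N) x N / dot (flipped N) N N) • N,
        dot (flipped N) x N / dot (flipped N) N N,
        by rw [dot_sub_left, dot_smul_left, div_mul_cancel₀ _ hN0, sub_self], by module⟩
    obtain ⟨x, c, hx, rfl⟩ := hd x
    obtain ⟨y, c', hy, rfl⟩ := hd y
    rw [← dot_mulVec]
    simp only [mulVec_add, mulVec_smul, hHN, dot_add_left, dot_add_right, dot_smul_left,
      dot_smul_right, hdot hx hy, hx, hHx hx, dot_comm hsymm N, hy, hHx hy]
  · -- three vectors of `V` with `N` span a volume that `H` preserves
    have hvol : ∀ {x y z}, dot (flipped N) x N = 0 → dot (flipped N) y N = 0 →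
        dot (flipped N) z N = 0 → (Matrix.of ![x, y, z, N]).det * H.det =
          (Matrix.of ![x, y, z, N]).det := by
      intro x y z hx hy hz
      have h := trace_act_mul_act_mul_act hG.1 (dualPart N σ x) (dualPart N σ y) (dualPart N σ z)
      rw [act_dualPart hN hσ hG hx, act_dualPart hN hσ hG hy, act_dualPart hN hσ hG hz,
        trace_dualPart_mul_mul hN hσ hx hy hz,
        trace_dualPart_mul_mul hN hσ (hHx hx) (hHx hy) (hHx hz)] at h
      have h2 := mul_left_cancel₀ (mul_ne_zero (by norm_num) hN0) h
      have h3 : Matrix.of ![H *ᵥ x, H *ᵥ y, H *ᵥ z, N] = Matrix.of ![x, y, z, N] * Hᵀ := by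
        ext i j
        rw [mul_apply_eq_vecMul]
        conv_lhs => rw [← hHN]
        fin_cases i <;> simp [vecMul_transpose] <;> rfl
      rw [← det_transpose H, ← det_mul, ← h3, h2]
    rcases hN with rfl | rfl
    · have h := hvol (x := Pi.single 1 1) (y := Pi.single 2 1) (z := Pi.single 3 1)
        (by rw [flipped_e0, dot]; simp [e0, mulVec_diagonal])
        (by rw [flipped_e0, dot]; simp [e0, mulVec_diagonal])
        (by rw [flipped_e0, dot]; simp [e0, mulVec_diagonal])
      refine mul_left_cancel₀ ?_ (h.trans (mul_one _).symm)
      simp [det_succ_row_zero, Fin.sum_univ_succ, Fin.succAbove, e0]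
    · have h := hvol (x := Pi.single 0 1) (y := Pi.single 1 1) (z := Pi.single 2 1)
        (by rw [flipped_e3, dot]; simp [e3, mulVec_diagonal])
        (by rw [flipped_e3, dot]; simp [e3, mulVec_diagonal])
        (by rw [flipped_e3, dot]; simp [e3, mulVec_diagonal])
      refine mul_left_cancel₀ ?_ (h.trans (mul_one _).symm)
      simp [det_succ_row_zero, Fin.sum_univ_succ, Fin.succAbove, e3]

end Phi

section VectorGeometries

variable {N : Vec} {σ : ℝ}

theorem isSOV_groupPhi (hN : N = e0 ∨ N = e3) (hσ : σ = 1 ∨ σ = -1) {G : Mat}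
    (hG : IsSO (flipped N) G) : IsSOV N (groupPhi N σ G) :=
  (isSOV_iff hN _).2 ⟨groupPhi_isSO hN hσ hG, groupPhi_mulVec_normal hN G⟩

theorem groupPhi_mul (hN : N = e0 ∨ N = e3) (hσ : σ = 1 ∨ σ = -1) {G : Mat} (H : Mat)
    (hG : IsSO (flipped N) G) : groupPhi N σ (G * H) = groupPhi N σ G * groupPhi N σ H := by
  refine mat_ext_of_orthogonal (isNormalized_flipped hN).ne_zero ?_ fun x hx => ?_
  · rw [← mulVec_mulVec, groupPhi_mulVec_normal hN, groupPhi_mulVec_normal hN,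
      groupPhi_mulVec_normal hN]
  · rw [← mulVec_mulVec, groupPhi_mulVec_of_orthogonal _ hx, groupPhi_mulVec_of_orthogonal _ hx,
      groupPhi_mulVec_bivectorPhi N hN σ hσ G _ hG
        (act_transpose _ _ (hodge_wedge_transpose hN _ _)), act_act]

theorem groupPhi_neg (G : Mat) : groupPhi N σ (-G) = groupPhi N σ G := by
  refine Matrix.mulVec_injective (funext fun x => ?_)
  rw [groupPhi_mulVec, groupPhi_mulVec, neg_act]

theorem IsSOV.dot_normal (hN : N = e0 ∨ N = e3) {H : Mat} (hH : IsSOV N H) (x : Vec) :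
    dot (flipped N) (H *ᵥ x) N = dot (flipped N) x N := by
  have h := ((isSOV_iff hN H).1 hH).1.dot x N
  rwa [hH.2] at h

/-- On the rotations that fix `N`, the maps `Φ^±` restrict to the identity. -/
theorem groupPhi_eq_self (hN : N = e0 ∨ N = e3) {H : Mat} (hH : IsSOV N H) :
    groupPhi N σ H = H := by
  obtain ⟨hS, hHN⟩ := (isSOV_iff hN H).1 hH
  have hm := isMetric_flipped hN
  refine mat_ext_of_orthogonal (isNormalized_flipped hN).ne_zero ?_ fun x hx => ?_
  · rw [groupPhi_mulVec_normal hN, hHN]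
  · rw [groupPhi_mulVec_of_orthogonal _ hx, ← hodge_act _ _ _ hm.symm hm.sq hS, act_wedge, hHN,
      bivectorPhi_wedge hN (by rw [hH.dot_normal hN, hx])]

/-- Conjugation with the reflection in `N` exchanges the self-dual and the anti-self-dual part. -/
theorem groupPhi_reflection (hN : N = e0 ∨ N = e3) {G : Mat} :
    groupPhi N σ (reflection (flipped N) N * G * reflection (flipped N) N) =
      groupPhi N (-σ) G := by
  have hm := isMetric_flipped hN
  have hN0 := (isNormalized_flipped hN).ne_zero
  set R := reflection (flipped N) N with hR
  have hRO : Rᵀ * flipped N * R = flipped N := reflection_isO hm.symm hN0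
  have hRR : R * R = 1 := reflection_sq hm.symm hN0
  have hRN : R *ᵥ N = -N := reflection_self hm.symm hN0
  have hRd : R.det = -1 := reflection_det _ hN0
  have hRg : Rᵀ * flipped N = flipped N * R := by
    calc Rᵀ * flipped N = Rᵀ * flipped N * (R * R) := by rw [hRR, Matrix.mul_one]
      _ = (Rᵀ * flipped N * R) * R := by simp only [Matrix.mul_assoc]
      _ = _ := by rw [hRO]
  -- `R` fixes `V`, so it changes the sign of the contraction with `N` only
  have hcon : ∀ C : Mat, Cᵀ = -C →
      contract (flipped N) (act R C) N = -contract (flipped N) C N := by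
    intro C hC
    have h1 : contract (flipped N) (act R C) N = -(R *ᵥ contract (flipped N) C N) := by
      rw [contract, act, mulVec_mulVec, Matrix.mul_assoc, hRg, contract, mulVec_mulVec]
      rw [show R * C * (flipped N * R) = R * C * flipped N * R by simp only [Matrix.mul_assoc],
        ← mulVec_mulVec, hRN, mulVec_neg, ← mulVec_mulVec, ← mulVec_mulVec]
    have h2 : dot (flipped N) (contract (flipped N) C N) N = 0 := by
      have h3 : ∀ x : Vec, (C *ᵥ x) ⬝ᵥ x = 0 := by
        intro x
        have : (C *ᵥ x) ⬝ᵥ x = -((C *ᵥ x) ⬝ᵥ x) := by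
          conv_lhs => rw [dotProduct_comm, dotProduct_mulVec, ← mulVec_transpose, hC, neg_mulVec,
            neg_dotProduct]
        linarith
      exact h3 _
    rw [h1, reflection_of_dot_eq_zero hm.symm h2]
  -- as `det R = -1`, acting with `R` changes the sign of the Hodge star
  have hphi : ∀ B : Mat, Bᵀ = -B → bivectorPhi N σ (act R B) = bivectorPhi N (-σ) B := by
    intro B hB
    have e1 : σ • act R B + hodge (flipped N) (act R B) =
        act R (σ • B - hodge (flipped N) B) := by
      rw [hodge_act_eq_det_smul hm hRO, hRd, sub_eq_add_neg, act_add, act_smul, act_neg]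
      module
    have h2 := hodge_transpose hN hB
    rw [bivectorPhi, e1, hcon _ (by rw [transpose_sub, transpose_smul, hB, h2]; module),
      bivectorPhi]
    congr 1
    rw [contract, contract, ← neg_mulVec]
    congr 1
    module
  refine mat_ext_of_orthogonal hN0 ?_ fun x hx => ?_
  · rw [groupPhi_mulVec_normal hN, groupPhi_mulVec_normal hN]
  · have h1 : act R (hodge (flipped N) (wedge x N)) = hodge (flipped N) (wedge x N) := by
      have h2 := hodge_act_eq_det_smul hm hRO (wedge x N)
      rw [hRd, act_wedge, hRN, reflection_of_dot_eq_zero hm.symm hx, wedge_neg_right, hodge_neg,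
        neg_smul, one_smul] at h2
      exact (neg_injective h2).symm
    rw [groupPhi_mulVec_of_orthogonal _ hx, groupPhi_mulVec_of_orthogonal _ hx, ← act_act,
      ← act_act, h1, hphi _ (act_transpose _ _ (hodge_wedge_transpose hN _ _))]

/-! ### Solutions and pairs of vector geometries -/

variable {v : Fin 5 → Fin 5 → Vec} {G : Fin 5 → Mat}

theorem groupPhi_mulVec_face (hD : IsClosedData (flipped N) N v)
    (G : Mat) {i j : Fin 5} (hij : i ≠ j) :
    groupPhi N σ G *ᵥ v i j = bivectorPhi N σ (act G (dataBivector (flipped N) N v i j)) :=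
  groupPhi_mulVec_of_orthogonal G (hD.orthogonal i j hij)

theorem isVectorGeometry_groupPhi (hN : N = e0 ∨ N = e3) (hσ : σ = 1 ∨ σ = -1)
    (hD : IsClosedData (flipped N) N v) (hG : IsSolution (flipped N) N v G) :
    IsVectorGeometry N v fun i => groupPhi N σ (G i) := by
  refine ⟨fun i => isSOV_groupPhi hN hσ (hG.1 i), fun i j hij => ?_⟩
  rw [groupPhi_mulVec_face hD _ hij, groupPhi_mulVec_face hD _ hij.symm, hG.2 i j hij,
    bivectorPhi_neg]

/-- A family of rotations solves the gluing conditions if its self-dual and anti-self-dual parts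
do. -/
theorem isSolution_of_isVectorGeometry (hN : N = e0 ∨ N = e3)
    (hD : IsClosedData (flipped N) N v) (hG : ∀ i, IsSO (flipped N) (G i))
    (hp : IsVectorGeometry N v fun i => groupPhi N 1 (G i))
    (hm : IsVectorGeometry N v fun i => groupPhi N (-1) (G i)) : IsSolution (flipped N) N v G := by
  refine ⟨hG, fun i j hij => ?_⟩
  have ht : ∀ i j, (act (G i) (dataBivector (flipped N) N v i j))ᵀ =
      -act (G i) (dataBivector (flipped N) N v i j) := fun i j =>
    act_transpose _ _ (hodge_wedge_transpose hN _ _)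
  have h1 := hp.2 i j hij
  have h2 := hm.2 i j hij
  rw [groupPhi_mulVec_face hD _ hij, groupPhi_mulVec_face hD _ hij.symm,
    ← bivectorPhi_neg] at h1 h2
  exact eq_of_bivectorPhi_eq hN (ht i j) (by rw [transpose_neg, ht j i]) h1 h2

theorem IsSOV.mul {H K : Mat} (hH : IsSOV N H) (hK : IsSOV N K) : IsSOV N (H * K) :=
  ⟨hH.1.mul hK.1, by rw [← mulVec_mulVec, hK.2, hH.2]⟩

theorem IsSOV.exists_inv (hN : N = e0 ∨ N = e3) {H : Mat} (hH : IsSOV N H) :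
    ∃ K, IsSOV N K ∧ K * H = 1 ∧ H * K = 1 := by
  obtain ⟨K, hK, h1, h2⟩ := ((isSOV_iff hN H).1 hH).1.exists_inv (isMetric_flipped hN)
  refine ⟨K, (isSOV_iff hN K).2 ⟨hK, ?_⟩, h1, h2⟩
  conv_lhs => rw [← hH.2]
  rw [mulVec_mulVec, h1, one_mulVec]

theorem VectorGeometryEquiv.symm (hN : N = e0 ∨ N = e3) {H H' : Fin 5 → Mat}
    (h : VectorGeometryEquiv N H H') : VectorGeometryEquiv N H' H := by
  obtain ⟨K, hK, h⟩ := h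
  obtain ⟨L, hL, h1, -⟩ := hK.exists_inv hN
  exact ⟨L, hL, fun i => by rw [h, ← Matrix.mul_assoc, h1, Matrix.one_mul]⟩

theorem VectorGeometryEquiv.trans {H H' H'' : Fin 5 → Mat}
    (h : VectorGeometryEquiv N H H') (h' : VectorGeometryEquiv N H' H'') :
    VectorGeometryEquiv N H H'' := by
  obtain ⟨K, hK, h⟩ := h
  obtain ⟨L, hL, h'⟩ := h'
  exact ⟨L * K, hL.mul hK, fun i => by rw [h', h, Matrix.mul_assoc]⟩

theorem groupPhi_equiv_of_solutionEquiv (hN : N = e0 ∨ N = e3) (hσ : σ = 1 ∨ σ = -1)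
    {G' : Fin 5 → Mat} (h : SolutionEquiv (flipped N) G G') :
    VectorGeometryEquiv N (fun i => groupPhi N σ (G i)) fun i => groupPhi N σ (G' i) := by
  obtain ⟨K, hK, t, h⟩ := h
  refine ⟨groupPhi N σ K, isSOV_groupPhi hN hσ hK, fun i => ?_⟩
  show groupPhi N σ (G' i) = groupPhi N σ K * groupPhi N σ (G i)
  rw [h, ← groupPhi_mul hN hσ _ hK]
  have h01 : t i = 0 ∨ t i = 1 := by have := (t i).2; omega
  rcases h01 with h | h <;> rw [h]
  · simp
  · rw [← groupPhi_neg]; simp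

/-- If the two vector geometries were equivalent, then every bivector of the tetrahedron `0` would
be the image under `G 1` of some `⋆(x ∧ N)`. All face vectors of this tetrahedron would thus lie in
the plane of `G 0 N` and `G 1 N`, and be parallel. -/
theorem not_equiv_groupPhi (hN : N = e0 ∨ N = e3) (hD : IsClosedData (flipped N) N v)
    (hG : IsNondegenerateSolution (flipped N) N v G) :
    ¬ VectorGeometryEquiv N (fun i => groupPhi N 1 (G i)) fun i => groupPhi N (-1) (G i) := by
  rintro ⟨K, hK, h : ∀ i, groupPhi N (-1) (G i) = K * groupPhi N 1 (G i)⟩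
  have hm := isMetric_flipped hN
  have h1 : (1 : ℝ) = 1 ∨ (1 : ℝ) = -1 := Or.inl rfl
  have h2 : (-1 : ℝ) = 1 ∨ (-1 : ℝ) = -1 := Or.inr rfl
  have hS := hG.1.1
  obtain ⟨L, hL, -, hL2⟩ := (isSOV_groupPhi hN h1 (hS 1)).exists_inv hN
  have key : ∀ j, 0 ≠ j → ∃ a b : ℝ, G 0 *ᵥ v 0 j = a • G 0 *ᵥ N + b • G 1 *ᵥ N := by
    intro j hj
    have hx := hD.orthogonal 0 j hj
    set x' := L *ᵥ (groupPhi N 1 (G 0) *ᵥ v 0 j) with hx'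
    have hx'N : dot (flipped N) x' N = 0 := by
      rw [hx', hL.dot_normal hN, dot_groupPhi hN h1 _ hx]
    have e1 : groupPhi N 1 (G 1) *ᵥ x' = groupPhi N 1 (G 0) *ᵥ v 0 j := by
      rw [hx', mulVec_mulVec, hL2, one_mulVec]
    have e2 : groupPhi N (-1) (G 1) *ᵥ x' = groupPhi N (-1) (G 0) *ᵥ v 0 j := by
      rw [h, h, ← mulVec_mulVec, e1, mulVec_mulVec]
    rw [groupPhi_mulVec_of_orthogonal _ hx'N, groupPhi_mulVec_of_orthogonal _ hx] at e1 e2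
    have e3 := eq_of_bivectorPhi_eq hN (act_transpose _ _ (hodge_wedge_transpose hN _ _))
      (act_transpose _ _ (hodge_wedge_transpose hN _ _)) e1 e2
    rw [hD.hodge_wedge (hS 1), hD.hodge_wedge (hS 0)] at e3
    exact exists_eq_add_of_wedge_eq (hodge_injective hm (wedge_transpose _ _)
      (wedge_transpose _ _) e3).symm
      (IsClosedData.wedge_ne_of_isNondegenerateFamily hG.2 (by decide))
  exact not_linearIndependent_of_plane (hD.dot_normal_ne hG.1 0)
    (hD.dot_face_normal hG.1 (by decide)) (hD.dot_face_normal hG.1 (by decide))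
    (key 1 (by decide)) (key 2 (by decide))
    (IsClosedData.linearIndependent_mulVec (hS 0)
      (hD.pair_linearIndependent (by decide) (by decide) (by decide)))

/-- If all normals of a solution are parallel, then up to inversions and a common rotation the
solution fixes `N`, and its self-dual and anti-self-dual parts agree up to a common rotation. -/
theorem isNondegenerateFamily_of_not_equiv (hN : N = e0 ∨ N = e3)
    (hD : IsClosedData (flipped N) N v) (hG : IsSolution (flipped N) N v G)
    (h : ¬ VectorGeometryEquiv N (fun i => groupPhi N 1 (G i)) fun i => groupPhi N (-1) (G i)) :
    IsNondegenerateFamily N G := by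
  refine hD.isNondegenerateFamily_of_wedge_ne hG ?_
  by_contra! hpar
  apply h
  have hm := isMetric_flipped hN
  have h1 : (1 : ℝ) = 1 ∨ (1 : ℝ) = -1 := Or.inl rfl
  have h2 : (-1 : ℝ) = 1 ∨ (-1 : ℝ) = -1 := Or.inr rfl
  obtain ⟨F, hF, hF1, hF2⟩ := (hG.1 0).exists_inv hm
  have hH : ∀ i, ∃ H, IsSOV N H ∧ (G i = G 0 * H ∨ G i = -(G 0 * H)) := by
    intro i
    have hFi : G 0 * (F * G i) = G i := by rw [← Matrix.mul_assoc, hF2, Matrix.one_mul]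
    rcases eq_or_eq_neg_of_wedge_eq_zero (hpar 0 i) (by rw [hD.dot_normal hG, hD.dot_normal hG])
      (hD.dot_normal_ne hG 0) with e | e
    · refine ⟨F * G i, (isSOV_iff hN _).2 ⟨hF.mul (hG.1 i), ?_⟩, Or.inl hFi.symm⟩
      rw [← mulVec_mulVec, e, mulVec_mulVec, hF1, one_mulVec]
    · refine ⟨-(F * G i), (isSOV_iff hN _).2 ⟨(hF.mul (hG.1 i)).neg, ?_⟩,
        Or.inr (by rw [Matrix.mul_neg, neg_neg, hFi])⟩
      rw [neg_mulVec, ← mulVec_mulVec, e, mulVec_neg, neg_neg, mulVec_mulVec, hF1, one_mulVec]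
  have hphi : ∀ i, ∃ H, ∀ σ : ℝ, σ = 1 ∨ σ = -1 →
      groupPhi N σ (G i) = groupPhi N σ (G 0) * H := by
    intro i
    obtain ⟨H, hHS, e⟩ := hH i
    refine ⟨H, fun σ hσ => ?_⟩
    have e2 : groupPhi N σ (G i) = groupPhi N σ (G 0 * H) := by
      rcases e with e | e <;> rw [e]
      exact groupPhi_neg _
    rw [e2, groupPhi_mul hN hσ _ (hG.1 0), groupPhi_eq_self hN hHS]
  obtain ⟨L, hL, hL1, -⟩ := (isSOV_groupPhi hN h1 (hG.1 0)).exists_inv hN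
  refine ⟨groupPhi N (-1) (G 0) * L, (isSOV_groupPhi hN h2 (hG.1 0)).mul hL, fun i => ?_⟩
  obtain ⟨H, hH⟩ := hphi i
  show groupPhi N (-1) (G i) = groupPhi N (-1) (G 0) * L * groupPhi N 1 (G i)
  rw [hH 1 h1, hH (-1) h2, Matrix.mul_assoc, ← Matrix.mul_assoc L, hL1, Matrix.one_mul]

end VectorGeometries

/-! ### Spin lifts of rotations of a three-dimensional space -/

/-- A symmetric matrix of rank one and positive trace is the square of a vector. -/
theorem exists_eq_mul_of_minors {Q : Mat} (h : ∀ m a b, Q m m * Q a b = Q m a * Q m b)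
    (htr : 0 < ∑ m, Q m m) : ∃ q : Vec, ∀ a b, Q a b = q a * q b := by
  obtain ⟨m, -, hm⟩ := Finset.exists_lt_of_sum_lt (s := Finset.univ) (f := fun _ : Fin 4 => (0 : ℝ))
    (g := fun m => Q m m) (by simpa using htr)
  have hs : Real.sqrt (Q m m) * Real.sqrt (Q m m) = Q m m := Real.mul_self_sqrt hm.le
  refine ⟨fun a => Q m a / Real.sqrt (Q m m), fun a b => ?_⟩
  rw [div_mul_div_comm, hs, ← h, mul_div_cancel_left₀ _ hm.ne']

/-- The adjugate of a rotation with respect to a metric matrix `h`. -/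
theorem adjugate_eq_of_isO {h A : Matrix (Fin 3) (Fin 3) ℝ} (hh : h * h = 1)
    (hA : Aᵀ * h * A = h) (hd : A.det = 1) : A.adjugate = h * Aᵀ * h := by
  have h1 : (h * Aᵀ * h) * A = 1 := by
    rw [Matrix.mul_assoc, Matrix.mul_assoc, ← Matrix.mul_assoc Aᵀ, hA, hh]
  calc A.adjugate = (h * Aᵀ * h) * A * A.adjugate := by rw [h1, Matrix.one_mul]
    _ = h * Aᵀ * h := by rw [Matrix.mul_assoc, mul_adjugate, hd, one_smul, Matrix.mul_one]

theorem mul_mul_transpose_of_isO {h A : Matrix (Fin 3) (Fin 3) ℝ} (hh : h * h = 1)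
    (hA : Aᵀ * h * A = h) : A * h * Aᵀ = h := by
  have h1 : (h * Aᵀ * h) * A = 1 := by
    rw [Matrix.mul_assoc, Matrix.mul_assoc, ← Matrix.mul_assoc Aᵀ, hA, hh]
  have h2 := mul_eq_one_comm.1 h1
  calc A * h * Aᵀ = A * (h * Aᵀ * h) * h := by simp only [Matrix.mul_assoc, hh, Matrix.mul_one]
    _ = h := by rw [h2, Matrix.one_mul]

/-- The Euler-Rodrigues parametrization of `SO(3)`. The ten products of the parameters are
linear in the matrix, and orthogonality makes them a matrix of rank one. -/
theorem exists_eulerRodrigues {A : Matrix (Fin 3) (Fin 3) ℝ} (hA : Aᵀ * A = 1) (hd : A.det = 1) :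
    ∃ q a b c : ℝ, q * q + a * a + b * b + c * c = 1 ∧ A =
      !![q * q + a * a - b * b - c * c, 2 * (a * b + q * c), 2 * (a * c - q * b);
        2 * (a * b - q * c), q * q - a * a + b * b - c * c, 2 * (b * c + q * a);
        2 * (a * c + q * b), 2 * (b * c - q * a), q * q - a * a - b * b + c * c] := by
  have hh : (1 : Matrix (Fin 3) (Fin 3) ℝ) * 1 = 1 := Matrix.one_mul 1
  have hA' : Aᵀ * 1 * A = 1 := by rw [Matrix.mul_one, hA]
  have hC' := mul_mul_transpose_of_isO hh hA'
  have hadj' := adjugate_eq_of_isO hh hA' hd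
  have hR := fun i j => congrFun (congrFun hA i) j
  have hC := fun i j => congrFun (congrFun hC' i) j
  have hJ := fun i j => congrFun (congrFun hadj' i) j
  simp only [Matrix.mul_one, Matrix.one_mul, mul_apply, transpose_apply, Fin.sum_univ_three]
    at hR hC hJ
  simp only [adjugate_fin_three] at hJ
  set Q : Mat :=
    !![1 + A 0 0 + A 1 1 + A 2 2, A 1 2 - A 2 1, A 2 0 - A 0 2, A 0 1 - A 1 0;
      A 1 2 - A 2 1, 1 + A 0 0 - A 1 1 - A 2 2, A 0 1 + A 1 0, A 0 2 + A 2 0;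
      A 2 0 - A 0 2, A 0 1 + A 1 0, 1 - A 0 0 + A 1 1 - A 2 2, A 1 2 + A 2 1;
      A 0 1 - A 1 0, A 0 2 + A 2 0, A 1 2 + A 2 1, 1 - A 0 0 - A 1 1 + A 2 2] with hQ
  -- each of these minors is a linear combination of the orthogonality relations of the rows and of
  -- the columns and of the relations between `A` and its adjugate
  have hminor : ∀ m a b, Q m m * Q a b = Q m a * Q m b := by
    have r00 := hR 0 0
    have r01 := hR 0 1
    have r02 := hR 0 2
    have r11 := hR 1 1
    have r12 := hR 1 2
    have r22 := hR 2 2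
    have c00 := hC 0 0
    have c01 := hC 0 1
    have c02 := hC 0 2
    have c11 := hC 1 1
    have c12 := hC 1 2
    have j00 := hJ 0 0
    have j01 := hJ 0 1
    have j02 := hJ 0 2
    have j10 := hJ 1 0
    have j11 := hJ 1 1
    have j12 := hJ 1 2
    have j20 := hJ 2 0
    have j21 := hJ 2 1
    have j22 := hJ 2 2
    clear hR hC hJ hadj' hC' hA' hA hd
    simp at *
    intro m a b
    fin_cases m <;> fin_cases a <;> fin_cases b <;> simp [hQ] <;> linarith
  obtain ⟨p, hp⟩ := exists_eq_mul_of_minors hminor (by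
    simp [Fin.sum_univ_four, hQ]
    linarith)
  have p00 := hp 0 0
  have p01 := hp 0 1
  have p02 := hp 0 2
  have p03 := hp 0 3
  have p11 := hp 1 1
  have p12 := hp 1 2
  have p13 := hp 1 3
  have p22 := hp 2 2
  have p23 := hp 2 3
  have p33 := hp 3 3
  clear hminor
  simp [hQ] at p00 p01 p02 p03 p11 p12 p13 p22 p23 p33
  refine ⟨p 0 / 2, p 1 / 2, p 2 / 2, p 3 / 2, by linarith, ?_⟩
  ext i j
  fin_cases i <;> fin_cases j <;> simp <;> linarith

/-- The spin parametrization of the identity component of `SO(1, 2)`. -/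
theorem exists_eulerRodrigues_lorentz {A : Matrix (Fin 3) (Fin 3) ℝ}
    (hA : Aᵀ * Matrix.diagonal ![1, -1, -1] * A = Matrix.diagonal ![1, -1, -1]) (hd : A.det = 1)
    (hpos : 0 < A 0 0) :
    ∃ q a b c : ℝ, q * q + a * a - b * b - c * c = 1 ∧ A =
      !![q * q + a * a + b * b + c * c, 2 * (q * c - a * b), -2 * (a * c + q * b);
        2 * (a * b + q * c), q * q - a * a - b * b + c * c, -2 * (b * c + q * a);
        2 * (a * c - q * b), 2 * (q * a - b * c), q * q - a * a + b * b - c * c] := by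
  have hh : (Matrix.diagonal ![1, -1, -1] : Matrix (Fin 3) (Fin 3) ℝ) *
      Matrix.diagonal ![1, -1, -1] = 1 := by
    rw [diagonal_mul_diagonal, ← diagonal_one]
    congr 1
    ext i; fin_cases i <;> simp
  have hC' := mul_mul_transpose_of_isO hh hA
  have hadj' := adjugate_eq_of_isO hh hA hd
  have hR := fun i j => congrFun (congrFun hA i) j
  have hC := fun i j => congrFun (congrFun hC' i) j
  have hJ := fun i j => congrFun (congrFun hadj' i) j
  simp only [mul_apply, transpose_apply, Fin.sum_univ_three]
    at hR hC hJ
  simp only [adjugate_fin_three] at hJ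
  set Q : Mat :=
    !![1 + A 0 0 + A 1 1 + A 2 2, A 2 1 - A 1 2, -(A 0 2 + A 2 0), A 0 1 + A 1 0;
      A 2 1 - A 1 2, 1 + A 0 0 - A 1 1 - A 2 2, A 1 0 - A 0 1, A 2 0 - A 0 2;
      -(A 0 2 + A 2 0), A 1 0 - A 0 1, A 0 0 - 1 - A 1 1 + A 2 2, -(A 1 2 + A 2 1);
      A 0 1 + A 1 0, A 2 0 - A 0 2, -(A 1 2 + A 2 1), A 0 0 - 1 + A 1 1 - A 2 2] with hQ
  -- each of these minors is a linear combination of the orthogonality relations of the rows and of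
  -- the columns and of the relations between `A` and its adjugate
  have hminor : ∀ m a b, Q m m * Q a b = Q m a * Q m b := by
    have r00 := hR 0 0
    have r01 := hR 0 1
    have r02 := hR 0 2
    have r11 := hR 1 1
    have r12 := hR 1 2
    have r22 := hR 2 2
    have c00 := hC 0 0
    have c01 := hC 0 1
    have c02 := hC 0 2
    have c11 := hC 1 1
    have c12 := hC 1 2
    have j00 := hJ 0 0
    have j01 := hJ 0 1
    have j02 := hJ 0 2
    have j10 := hJ 1 0
    have j11 := hJ 1 1
    have j12 := hJ 1 2
    have j20 := hJ 2 0
    have j21 := hJ 2 1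
    have j22 := hJ 2 2
    clear hR hC hJ hadj' hC' hA hd
    simp at *
    intro m a b
    fin_cases m <;> fin_cases a <;> fin_cases b <;> simp [hQ] <;> linarith
  obtain ⟨p, hp⟩ := exists_eq_mul_of_minors hminor (by
    simp [Fin.sum_univ_four, hQ]
    linarith)
  have p00 := hp 0 0
  have p01 := hp 0 1
  have p02 := hp 0 2
  have p03 := hp 0 3
  have p11 := hp 1 1
  have p12 := hp 1 2
  have p13 := hp 1 3
  have p22 := hp 2 2
  have p23 := hp 2 3
  have p33 := hp 3 3
  clear hminor
  simp [hQ] at p00 p01 p02 p03 p11 p12 p13 p22 p23 p33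
  refine ⟨p 0 / 2, p 1 / 2, p 2 / 2, p 3 / 2, by linarith, ?_⟩
  ext i j
  fin_cases i <;> fin_cases j <;> simp <;> linarith

/-! ### Quaternions acting on the flipped space -/

section Lift

variable {N : Vec} {σ : ℝ}

/-- The action of a rotation on self-dual bivectors, as conjugation of endomorphisms. -/
theorem groupPhi_mulVec_eq_of_conj (hN : N = e0 ∨ N = e3) (hσ : σ = 1 ∨ σ = -1) {G F : Mat}
    (hG : IsSO (flipped N) G) (hF : F * G = 1) {x y : Vec} (hx : dot (flipped N) x N = 0)
    (hy : dot (flipped N) y N = 0)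
    (h : dualPart N σ y * flipped N = G * (dualPart N σ x * flipped N) * F) :
    groupPhi N σ G *ᵥ x = y := by
  have hm := isMetric_flipped hN
  have h1 : act G (dualPart N σ x) = dualPart N σ y := by
    have hGg : IsUnit (flipped N * G) := by
      rw [isUnit_iff_isUnit_det, det_mul, hm.det, hG.2]; simp
    apply hGg.mul_right_cancel
    calc act G (dualPart N σ x) * (flipped N * G) =
          G * dualPart N σ x * (Gᵀ * flipped N * G) := by simp only [act, Matrix.mul_assoc]
      _ = G * (dualPart N σ x * flipped N) * (F * G) := by
          rw [hG.1, hF, Matrix.mul_one, Matrix.mul_assoc]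
      _ = (G * (dualPart N σ x * flipped N) * F) * G := by simp only [Matrix.mul_assoc]
      _ = _ := by rw [← h, Matrix.mul_assoc]
  have h2 := groupPhi_mulVec_bivectorPhi N hN σ hσ G _ hG (dualPart_transpose (σ := σ) hN x)
  rw [h1, bivectorPhi_dualPart hN hσ hx, bivectorPhi_dualPart hN hσ hy, mulVec_smul,
    mul_self_eq_one_iff.2 hσ] at h2
  exact smul_right_injective _ (by norm_num : (1 + 1 : ℝ) ≠ 0) h2

/-- The quaternion `q + a i + b j + c k` as an endomorphism of the flipped space for `N = e0`. -/
noncomputable def quaternionMat (q a b c : ℝ) : Mat :=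
  !![q, a, b, c; -a, q, c, -b; -b, -c, q, a; -c, b, -a, q]

/-- The split quaternion `q + a i + b j + c k` as an endomorphism of the flipped space for
`N = e3`. -/
noncomputable def splitQuaternionMat (q a b c : ℝ) : Mat :=
  !![q, c, -b, a; c, q, -a, b; -b, a, q, c; -a, b, c, q]

/-- On self-dual bivectors, conjugation is the Euler-Rodrigues rotation. -/
theorem quaternionMat_conj (q a b c x y z : ℝ) :
    quaternionMat q a b c * asym x y z z (-y) x * quaternionMat q (-a) (-b) (-c) =
      asym
        ((q * q + a * a - b * b - c * c) * x + 2 * (a * b + q * c) * y + 2 * (a * c - q * b) * z)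
        (2 * (a * b - q * c) * x + (q * q - a * a + b * b - c * c) * y + 2 * (b * c + q * a) * z)
        (2 * (a * c + q * b) * x + 2 * (b * c - q * a) * y + (q * q - a * a - b * b + c * c) * z)
        (2 * (a * c + q * b) * x + 2 * (b * c - q * a) * y + (q * q - a * a - b * b + c * c) * z)
        (-(2 * (a * b - q * c) * x + (q * q - a * a + b * b - c * c) * y +
          2 * (b * c + q * a) * z))
        ((q * q + a * a - b * b - c * c) * x + 2 * (a * b + q * c) * y +
          2 * (a * c - q * b) * z) := by
  ext i j
  simp only [quaternionMat, asym, mul_apply, Fin.sum_univ_four]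
  fin_cases i <;> fin_cases j <;>
    simp only [Fin.zero_eta, Fin.mk_one, Fin.reduceFinMk, of_apply, cons_val] <;> ring

theorem quaternionMat_conj_antiselfdual (q a b c x y z : ℝ) :
    quaternionMat q a b c * asym (-x) (-y) (-z) z (-y) x * quaternionMat q (-a) (-b) (-c) =
      (q * q + a * a + b * b + c * c) • asym (-x) (-y) (-z) z (-y) x := by
  ext i j
  simp only [quaternionMat, asym, mul_apply, Fin.sum_univ_four, Matrix.smul_apply, smul_eq_mul]
  fin_cases i <;> fin_cases j <;>
    simp only [Fin.zero_eta, Fin.mk_one, Fin.reduceFinMk, of_apply, cons_val] <;> ring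

/-- On self-dual bivectors, conjugation is the spin parametrization of `SO(1, 2)`. -/
theorem splitQuaternionMat_conj (q a b c x y z x' y' z' : ℝ)
    (hx : x' = (q * q + a * a + b * b + c * c) * x + 2 * (q * c - a * b) * y +
      -2 * (a * c + q * b) * z)
    (hy : y' = 2 * (a * b + q * c) * x + (q * q - a * a - b * b + c * c) * y +
      -2 * (b * c + q * a) * z)
    (hz : z' = 2 * (a * c - q * b) * x + 2 * (q * a - b * c) * y +
      (q * q - a * a + b * b - c * c) * z) :
    splitQuaternionMat q a b c * !![0, z, -y, x; z, 0, -x, y; -y, x, 0, z; -x, y, z, 0] *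
      splitQuaternionMat q (-a) (-b) (-c) =
      !![0, z', -y', x'; z', 0, -x', y'; -y', x', 0, z'; -x', y', z', 0] := by
  subst hx hy hz
  ext i j
  simp only [splitQuaternionMat, mul_apply, Fin.sum_univ_four]
  fin_cases i <;> fin_cases j <;>
    simp only [Fin.zero_eta, Fin.mk_one, Fin.reduceFinMk, of_apply, cons_val] <;> ring

theorem splitQuaternionMat_conj_antiselfdual (q a b c x y z : ℝ) :
    splitQuaternionMat q a b c * !![0, z, -y, -x; z, 0, -x, -y; -y, x, 0, -z; x, -y, -z, 0] *
      splitQuaternionMat q (-a) (-b) (-c) = (q * q + a * a - b * b - c * c) •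
      !![0, z, -y, -x; z, 0, -x, -y; -y, x, 0, -z; x, -y, -z, 0] := by
  ext i j
  simp only [splitQuaternionMat, mul_apply, Fin.sum_univ_four, Matrix.smul_apply, smul_eq_mul]
  fin_cases i <;> fin_cases j <;>
    simp only [Fin.zero_eta, Fin.mk_one, Fin.reduceFinMk, of_apply, cons_val] <;> ring

theorem quaternionMat_inv {q a b c : ℝ} (hn : q * q + a * a + b * b + c * c = 1) :
    quaternionMat q (-a) (-b) (-c) * quaternionMat q a b c = 1 := by
  have : quaternionMat q (-a) (-b) (-c) * quaternionMat q a b c =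
      (q * q + a * a + b * b + c * c) • (1 : Mat) := by
    ext i j; fin_cases i <;> fin_cases j <;> simp [quaternionMat] <;> ring
  rw [this, hn, one_smul]

theorem splitQuaternionMat_inv {q a b c : ℝ} (hn : q * q + a * a - b * b - c * c = 1) :
    splitQuaternionMat q (-a) (-b) (-c) * splitQuaternionMat q a b c = 1 := by
  have : splitQuaternionMat q (-a) (-b) (-c) * splitQuaternionMat q a b c =
      (q * q + a * a - b * b - c * c) • (1 : Mat) := by
    ext i j; fin_cases i <;> fin_cases j <;> simp [splitQuaternionMat] <;> ring
  rw [this, hn, one_smul]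

theorem quaternionMat_isSO {q a b c : ℝ} (hn : q * q + a * a + b * b + c * c = 1) :
    IsSO (flipped e0) (quaternionMat q a b c) := by
  have h1 : (quaternionMat q a b c)ᵀ * flipped e0 * quaternionMat q a b c =
      (q * q + a * a + b * b + c * c) • flipped e0 := by
    rw [flipped_e0]
    ext i j
    fin_cases i <;> fin_cases j <;> simp [quaternionMat, mul_apply, Fin.sum_univ_four] <;> ring
  have h2 : (quaternionMat q a b c).det = (q * q + a * a + b * b + c * c) ^ 2 := by
    simp [quaternionMat, det_succ_row_zero, Fin.sum_univ_succ, Fin.succAbove]; ring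
  exact ⟨by rw [h1, hn, one_smul], by rw [h2, hn, one_pow]⟩

theorem splitQuaternionMat_isSO {q a b c : ℝ} (hn : q * q + a * a - b * b - c * c = 1) :
    IsSO (flipped e3) (splitQuaternionMat q a b c) := by
  have h1 : (splitQuaternionMat q a b c)ᵀ * flipped e3 * splitQuaternionMat q a b c =
      (q * q + a * a - b * b - c * c) • flipped e3 := by
    rw [flipped_e3]
    ext i j
    fin_cases i <;> fin_cases j <;>
      simp [splitQuaternionMat, mul_apply, Fin.sum_univ_four] <;> ring
  have h2 : (splitQuaternionMat q a b c).det = (q * q + a * a - b * b - c * c) ^ 2 := by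
    simp [splitQuaternionMat, det_succ_row_zero, Fin.sum_univ_succ, Fin.succAbove]; ring
  exact ⟨by rw [h1, hn, one_smul], by rw [h2, hn, one_pow]⟩

/-- Every rotation of `V` lifts to a rotation of the flipped space that acts trivially on
anti-self-dual bivectors. -/
theorem exists_lift_e0 {K : Mat} (hK : IsSOV e0 K) :
    ∃ G, IsSO (flipped e0) G ∧ groupPhi e0 1 G = K ∧ groupPhi e0 (-1) G = 1 := by
  have hN : e0 = e0 ∨ e0 = e3 := Or.inl rfl
  obtain ⟨hS, hKN⟩ := (isSOV_iff hN K).1 hK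
  have hcol : ∀ i, K i 0 = if i = 0 then 1 else 0 := by
    intro i
    have := congrFun hKN i
    simp only [e0, mulVec, dotProduct, Fin.sum_univ_four] at this
    fin_cases i <;> simpa using this
  have hrow : ∀ j, K 0 j = if j = 0 then 1 else 0 := by
    intro j
    have := hK.dot_normal hN (Pi.single j 1)
    rw [flipped_e0, dot, dot] at this
    fin_cases j <;> simpa [mulVec_diagonal, e0, dotProduct, Fin.sum_univ_four] using this
  set A : Matrix (Fin 3) (Fin 3) ℝ := K.submatrix Fin.succ Fin.succ with hA
  have hKA : K = !![1, 0, 0, 0; 0, A 0 0, A 0 1, A 0 2; 0, A 1 0, A 1 1, A 1 2;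
      0, A 2 0, A 2 1, A 2 2] := by
    ext i j
    fin_cases i <;> fin_cases j <;> simp [hA, hcol, hrow]
  have hAA : Aᵀ * A = 1 := by
    ext i j
    have h1 := congrFun (congrFun hS.1 i.succ) j.succ
    rw [flipped_e0] at h1
    simp only [mul_apply, transpose_apply, Fin.sum_univ_four, hrow] at h1
    simp only [hA, mul_apply, transpose_apply, Fin.sum_univ_three, submatrix_apply]
    fin_cases i <;> fin_cases j <;> simp at h1 ⊢ <;> linarith
  have hAd : A.det = 1 := by
    have h1 := hS.2
    rw [det_succ_row_zero, Fin.sum_univ_four] at h1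
    simpa [hrow] using h1
  obtain ⟨q, a, b, c, hn, hq⟩ := exists_eulerRodrigues hAA hAd
  clear_value A
  subst hq
  have hFG := quaternionMat_inv hn
  have hGS := quaternionMat_isSO hn
  have hN0 := (isNormalized_flipped hN).ne_zero
  refine ⟨_, hGS, mat_ext_of_orthogonal hN0 (by rw [groupPhi_mulVec_normal hN, hKN]) ?_,
    mat_ext_of_orthogonal hN0 (by rw [groupPhi_mulVec_normal hN, one_mulVec]) ?_⟩
  · intro x hx
    refine groupPhi_mulVec_eq_of_conj hN (Or.inl rfl) hGS hFG hx
      (by rw [hK.dot_normal hN, hx]) ?_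
    obtain ⟨x1, x2, x3, rfl⟩ := orthogonal_e0 hx
    have hy : K *ᵥ ![0, x1, x2, x3] = ![0,
        (q * q + a * a - b * b - c * c) * x1 + 2 * (a * b + q * c) * x2 + 2 * (a * c - q * b) * x3,
        2 * (a * b - q * c) * x1 + (q * q - a * a + b * b - c * c) * x2 + 2 * (b * c + q * a) * x3,
        2 * (a * c + q * b) * x1 + 2 * (b * c - q * a) * x2 +
          (q * q - a * a - b * b + c * c) * x3] := by
      rw [hKA]
      ext i; fin_cases i <;> simp [mulVec, dotProduct, Fin.sum_univ_four]
    rw [hy, dualPart_e0, dualPart_e0]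
    simp only [one_mul]
    rw [quaternionMat_conj]
  · intro x hx
    rw [one_mulVec]
    refine groupPhi_mulVec_eq_of_conj hN (Or.inr rfl) hGS hFG hx hx ?_
    obtain ⟨x1, x2, x3, rfl⟩ := orthogonal_e0 hx
    rw [dualPart_e0]
    simp only [neg_mul, one_mul]
    rw [quaternionMat_conj_antiselfdual, hn, one_smul]

/-- For `N = e₃`, the rotations of `V` that preserve the time orientation lift in the same way. -/
theorem exists_lift_e3 {K : Mat} (hK : IsSOV e3 K) (hpos : 0 < K 0 0) :
    ∃ G, IsSO (flipped e3) G ∧ groupPhi e3 1 G = K ∧ groupPhi e3 (-1) G = 1 := by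
  have hN : e3 = e0 ∨ e3 = e3 := Or.inr rfl
  obtain ⟨hS, hKN⟩ := (isSOV_iff hN K).1 hK
  have hcol : ∀ i, K i 3 = if i = 3 then 1 else 0 := by
    intro i
    have := congrFun hKN i
    simp only [e3, mulVec, dotProduct, Fin.sum_univ_four] at this
    fin_cases i <;> simpa using this
  have hrow : ∀ j, K 3 j = if j = 3 then 1 else 0 := by
    intro j
    have := hK.dot_normal hN (Pi.single j 1)
    rw [flipped_e3, dot, dot] at this
    fin_cases j <;> simpa [mulVec_diagonal, e3, dotProduct, Fin.sum_univ_four] using this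
  set A : Matrix (Fin 3) (Fin 3) ℝ := K.submatrix Fin.castSucc Fin.castSucc with hA
  have hKA : K = !![A 0 0, A 0 1, A 0 2, 0; A 1 0, A 1 1, A 1 2, 0; A 2 0, A 2 1, A 2 2, 0;
      0, 0, 0, 1] := by
    ext i j
    fin_cases i <;> fin_cases j <;> simp [hA, hcol, hrow]
  have hAA : Aᵀ * Matrix.diagonal ![1, -1, -1] * A = Matrix.diagonal ![1, -1, -1] := by
    ext i j
    have h1 := congrFun (congrFun hS.1 i.castSucc) j.castSucc
    rw [flipped_e3] at h1
    simp only [mul_apply, transpose_apply, Fin.sum_univ_four, hrow] at h1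
    simp only [hA, mul_apply, transpose_apply, Fin.sum_univ_three, submatrix_apply]
    fin_cases i <;> fin_cases j <;> simp at h1 ⊢ <;> linarith
  have hAd : A.det = 1 := by
    have h1 := hS.2
    rw [det_succ_row _ 3, Fin.sum_univ_four] at h1
    have h3 : (Fin.succAbove 3 : Fin 3 → Fin 4) = Fin.castSucc := by
      ext i; fin_cases i <;> rfl
    simpa [hrow, h3, Even.neg_one_pow (by decide : Even 6)] using h1
  obtain ⟨q, a, b, c, hn, hq⟩ := exists_eulerRodrigues_lorentz hAA hAd hpos
  clear_value A
  subst hq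
  have hFG := splitQuaternionMat_inv hn
  have hGS := splitQuaternionMat_isSO hn
  have hN0 := (isNormalized_flipped hN).ne_zero
  refine ⟨_, hGS, mat_ext_of_orthogonal hN0 (by rw [groupPhi_mulVec_normal hN, hKN]) ?_,
    mat_ext_of_orthogonal hN0 (by rw [groupPhi_mulVec_normal hN, one_mulVec]) ?_⟩
  · intro x hx
    refine groupPhi_mulVec_eq_of_conj hN (Or.inl rfl) hGS hFG hx
      (by rw [hK.dot_normal hN, hx]) ?_
    obtain ⟨x1, x2, x3, rfl⟩ := orthogonal_e3 hx
    have hy : K *ᵥ ![x1, x2, x3, 0] = ![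
        (q * q + a * a + b * b + c * c) * x1 + 2 * (q * c - a * b) * x2 + -2 * (a * c + q * b) * x3,
        2 * (a * b + q * c) * x1 + (q * q - a * a - b * b + c * c) * x2 + -2 * (b * c + q * a) * x3,
        2 * (a * c - q * b) * x1 + 2 * (q * a - b * c) * x2 +
          (q * q - a * a + b * b - c * c) * x3, 0] := by
      rw [hKA]
      ext i; fin_cases i <;> simp [mulVec, dotProduct, Fin.sum_univ_four]
    rw [hy, dualPart_e3, dualPart_e3]
    simp only [one_mul]
    exact (splitQuaternionMat_conj q a b c x1 x2 x3 _ _ _ rfl rfl rfl).symm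
  · intro x hx
    rw [one_mulVec]
    refine groupPhi_mulVec_eq_of_conj hN (Or.inr rfl) hGS hFG hx hx ?_
    obtain ⟨x1, x2, x3, rfl⟩ := orthogonal_e3 hx
    rw [dualPart_e3]
    simp only [neg_mul, one_mul, neg_neg]
    rw [splitQuaternionMat_conj_antiselfdual, hn, one_smul]

end Lift

/-! ### Lifting pairs of vector geometries -/

section FamilyLift

variable {N : Vec} {v : Fin 5 → Fin 5 → Vec}

/-- An element of `SO(1,2)` preserves or reverses the time orientation of all timelike vectors,
according to the sign of its entry `(0, 0)`. -/
theorem IsSOV.timelike_sign {K : Mat} (hK : IsSOV e3 K) {x : Vec} (hx : x 3 = 0)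
    (hpos : 0 < dot minkowski x x) : 0 < x 0 * (K *ᵥ x) 0 * K 0 0 := by
  obtain ⟨hS, hKN⟩ := hK
  have hK3 : K 0 3 = 0 := by
    have := congrFun hKN 0
    simpa [e3, mulVec, dotProduct, Fin.sum_univ_four] using this
  have hmm : minkowski * minkowski = 1 := by
    rw [minkowski, diagonal_mul_diagonal, ← diagonal_one]
    congr 1
    ext i
    fin_cases i <;> simp
  -- the transposed relation `K η Kᵀ = η` gives the norm of the row of index `0`
  have hT : K * minkowski * Kᵀ = minkowski := by
    have h1 : (minkowski * Kᵀ * minkowski) * K = 1 := by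
      rw [Matrix.mul_assoc, Matrix.mul_assoc, ← Matrix.mul_assoc Kᵀ, hS.1, hmm]
    have h2 := mul_eq_one_comm.1 h1
    calc K * minkowski * Kᵀ = K * (minkowski * Kᵀ * minkowski) * minkowski := by
          simp only [Matrix.mul_assoc, hmm, Matrix.mul_one]
      _ = minkowski := by rw [h2, Matrix.one_mul]
  have hrow : K 0 0 ^ 2 - K 0 1 ^ 2 - K 0 2 ^ 2 = 1 := by
    have := congrFun (congrFun hT 0) 0
    simp [mul_apply, minkowski, Fin.sum_univ_four, hK3, Matrix.diagonal_apply] at this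
    linarith
  have hx2 : 0 < x 0 ^ 2 - x 1 ^ 2 - x 2 ^ 2 := by
    have h3 : dot minkowski x x = x 0 ^ 2 - x 1 ^ 2 - x 2 ^ 2 := by
      simp [dot, minkowski, mulVec_diagonal, dotProduct, Fin.sum_univ_four, hx]
      ring
    rwa [h3] at hpos
  have hKx : (K *ᵥ x) 0 = K 0 0 * x 0 + (K 0 1 * x 1 + K 0 2 * x 2) := by
    simp [mulVec, dotProduct, Fin.sum_univ_four, hx]
    ring
  have hcs : (K 0 1 * x 1 + K 0 2 * x 2) ^ 2 < (K 0 0 * x 0) ^ 2 := by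
    have h1 : 0 < x 0 ^ 2 := by nlinarith [sq_nonneg (x 1), sq_nonneg (x 2)]
    have h2 : (K 0 1 * x 1 + K 0 2 * x 2) ^ 2 ≤
        (K 0 1 ^ 2 + K 0 2 ^ 2) * (x 1 ^ 2 + x 2 ^ 2) := by
      nlinarith [sq_nonneg (K 0 1 * x 2 - K 0 2 * x 1)]
    have h3 : (K 0 1 ^ 2 + K 0 2 ^ 2) * (x 1 ^ 2 + x 2 ^ 2) ≤
        (K 0 1 ^ 2 + K 0 2 ^ 2) * x 0 ^ 2 :=
      mul_le_mul_of_nonneg_left (by linarith) (by positivity)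
    have h4 : K 0 0 ^ 2 * x 0 ^ 2 = x 0 ^ 2 + (K 0 1 ^ 2 + K 0 2 ^ 2) * x 0 ^ 2 := by
      linear_combination x 0 ^ 2 * hrow
    rw [mul_pow, h4]
    linarith
  rw [hKx]
  have habs := sq_lt_sq.1 hcs
  set p := K 0 0 * x 0 with hp
  set s := K 0 1 * x 1 + K 0 2 * x 2 with hs
  have h5 : x 0 * (p + s) * K 0 0 = p * (p + s) := by rw [hp]; ring
  rw [h5]
  rcases lt_or_ge p 0 with h | h
  · rw [abs_of_neg h] at habs
    exact mul_pos_of_neg_of_neg h (by linarith [le_abs_self s])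
  · rw [abs_of_nonneg h] at habs
    have := neg_abs_le s
    exact mul_pos (lt_of_le_of_lt (abs_nonneg s) habs) (by linarith)

theorem IsVectorGeometry.mul {H : Fin 5 → Mat} (hH : IsVectorGeometry N v H) {K : Mat}
    (hK : IsSOV N K) : IsVectorGeometry N v fun i => K * H i :=
  ⟨fun i => hK.mul (hH.1 i), fun i j hij => by
    rw [← mulVec_mulVec, ← mulVec_mulVec, hH.2 i j hij, mulVec_neg]⟩

/-- Two vector geometries lift to a solution as soon as the rotations `Hp i * (Hm i)⁻¹` do. -/
theorem exists_isSolution_of_lift (hN : N = e0 ∨ N = e3) (hD : IsClosedData (flipped N) N v)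
    {Hp Hm : Fin 5 → Mat} (hp : IsVectorGeometry N v Hp) (hm : IsVectorGeometry N v Hm)
    (h : ∀ i, ∀ K, IsSOV N K → K * Hm i = Hp i →
      ∃ G, IsSO (flipped N) G ∧ groupPhi N 1 G = K ∧ groupPhi N (-1) G = 1) :
    ∃ G, IsSolution (flipped N) N v G ∧ (∀ i, groupPhi N 1 (G i) = Hp i) ∧
      ∀ i, groupPhi N (-1) (G i) = Hm i := by
  have hK : ∀ i, ∃ G, IsSO (flipped N) G ∧ groupPhi N 1 G * Hm i = Hp i ∧
      groupPhi N (-1) G = 1 := by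
    intro i
    obtain ⟨F, hF, hFH, -⟩ := (hm.1 i).exists_inv hN
    have hKH : Hp i * F * Hm i = Hp i := by rw [Matrix.mul_assoc, hFH, Matrix.mul_one]
    obtain ⟨G, hG, h1, h2⟩ := h i _ ((hp.1 i).mul hF) hKH
    exact ⟨G, hG, by rw [h1, hKH], h2⟩
  choose L hL hLp hLm using hK
  have hGp : ∀ i, groupPhi N 1 (L i * Hm i) = Hp i := fun i => by
    rw [groupPhi_mul hN (Or.inl rfl) _ (hL i), groupPhi_eq_self hN (hm.1 i), hLp]
  have hGm : ∀ i, groupPhi N (-1) (L i * Hm i) = Hm i := fun i => by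
    rw [groupPhi_mul hN (Or.inr rfl) _ (hL i), groupPhi_eq_self hN (hm.1 i), hLm,
      Matrix.one_mul]
  refine ⟨fun i => L i * Hm i, isSolution_of_isVectorGeometry hN hD
    (fun i => (hL i).mul ((isSOV_iff hN _).1 (hm.1 i)).1) ?_ ?_, hGp, hGm⟩
  · simpa only [hGp] using hp
  · simpa only [hGm] using hm

/-- The half turn in the plane of `e₀` and `e₁`, which reverses the time orientation. -/
theorem exists_isSOV_time_reversing : ∃ K : Mat, IsSOV e3 K ∧ ∀ H : Mat, (K * H) 0 0 = -H 0 0 := by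
  refine ⟨Matrix.diagonal ![-1, -1, 1, 1], ⟨⟨?_, ?_⟩, ?_⟩, fun H => ?_⟩
  · rw [minkowski, diagonal_transpose, diagonal_mul_diagonal, diagonal_mul_diagonal]
    congr 1
    ext i
    fin_cases i <;> simp
  · simp [det_diagonal, Fin.prod_univ_four]
  · ext i
    fin_cases i <;> simp [e3, mulVec_diagonal]
  · simp [diagonal_mul]

/-- Every pair of vector geometries comes from a solution, up to gauge equivalence. For `N = e₃`
the relative time orientation of `Hp i` and `Hm i` does not depend on `i`, because it is the
relative time orientation of the timelike vectors `Hp i (v i j) = -Hp j (v j i)` and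
`Hm i (v i j) = -Hm j (v j i)`; a gauge transformation makes it trivial. -/
theorem exists_isSolution_of_isVectorGeometry (hN : N = e0 ∨ N = e3)
    {rho : Fin 5 → Fin 5 → ℝ} (hv : IsBoundaryData N rho v) (hnd : IsNondegenerateData v)
    {Hp Hm : Fin 5 → Mat} (hp : IsVectorGeometry N v Hp) (hm : IsVectorGeometry N v Hm) :
    ∃ G, IsSolution (flipped N) N v G ∧
      VectorGeometryEquiv N (fun i => groupPhi N 1 (G i)) Hp ∧
      VectorGeometryEquiv N (fun i => groupPhi N (-1) (G i)) Hm := by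
  have hD := isClosedData_flipped hN hv hnd
  have hone : IsSOV N 1 := ⟨⟨by simp, det_one⟩, one_mulVec N⟩
  rcases hN with rfl | rfl
  · obtain ⟨G, hG, h1, h2⟩ := exists_isSolution_of_lift (Or.inl rfl) hD hp hm
      fun i K hK _ => exists_lift_e0 hK
    exact ⟨G, hG, ⟨1, hone, fun i => by simp only [Matrix.one_mul, h1]⟩,
      ⟨1, hone, fun i => by simp only [Matrix.one_mul, h2]⟩⟩
  have hN : e3 = e0 ∨ e3 = e3 := Or.inr rfl
  have hv3 : ∀ i j, i ≠ j → v i j 3 = 0 := fun i j hij => by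
    simpa [dot, minkowski, e3, mulVec_diagonal, dotProduct, Fin.sum_univ_four] using
      hv.orthogonal i j hij
  have hvt : ∀ i j, i ≠ j → 0 < dot minkowski (v i j) (v i j) := fun i j hij => by
    rw [hv.norm_sq i j hij]
    have h1 : dot minkowski e3 e3 = -1 := by
      simp [dot, minkowski, e3, mulVec_diagonal, dotProduct, Fin.sum_univ_four]
    rw [h1]
    have := hv.rho_pos i j hij
    positivity
  -- the sign of `Hm 0 0` times that of `Hp 0 0` is independent of the tetrahedron
  have hsign : ∀ i j, i ≠ j → 0 < (Hp i 0 0 * Hm i 0 0) * (Hp j 0 0 * Hm j 0 0) := by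
    intro i j hij
    have a1 := (hp.1 i).timelike_sign (hv3 i j hij) (hvt i j hij)
    have a2 := (hm.1 i).timelike_sign (hv3 i j hij) (hvt i j hij)
    have a3 := (hp.1 j).timelike_sign (hv3 j i hij.symm) (hvt j i hij.symm)
    have a4 := (hm.1 j).timelike_sign (hv3 j i hij.symm) (hvt j i hij.symm)
    rw [hp.2 i j hij] at a1
    rw [hm.2 i j hij] at a2
    have h := mul_pos (mul_pos a1 a2) (mul_pos a3 a4)
    simp only [Pi.neg_apply] at h
    refine pos_of_mul_pos_left (b := (v i j 0 * v j i 0 * (Hp j *ᵥ v j i) 0 *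
      (Hm j *ᵥ v j i) 0) ^ 2) ?_ (sq_nonneg _)
    linarith
  have hlift : ∀ {H : Fin 5 → Mat}, IsVectorGeometry e3 v H → (∀ i, 0 < Hp i 0 0 * H i 0 0) →
      ∃ G, IsSolution (flipped e3) e3 v G ∧ (∀ i, groupPhi e3 1 (G i) = Hp i) ∧
        ∀ i, groupPhi e3 (-1) (G i) = H i := by
    intro H hH hpos
    refine exists_isSolution_of_lift hN hD hp hH fun i K hK hKH => exists_lift_e3 hK ?_
    obtain ⟨F, hF, -, hHF⟩ := (hH.1 i).exists_inv hN
    set x : Vec := F *ᵥ e0 with hx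
    have hHx : H i *ᵥ x = e0 := by rw [hx, mulVec_mulVec, hHF, one_mulVec]
    have hKx : Hp i *ᵥ x = K *ᵥ e0 := by rw [← hKH, ← mulVec_mulVec, hHx]
    have h00 : (K *ᵥ e0) 0 = K 0 0 := by
      simp [e0, mulVec, dotProduct, Fin.sum_univ_four]
    have hx3 : x 3 = 0 := by
      have := hF.dot_normal hN e0
      rw [← hx] at this
      rw [flipped_e3] at this
      simpa [dot, e0, e3, mulVec_diagonal, dotProduct, Fin.sum_univ_four] using this
    have hxt : 0 < dot minkowski x x := by
      rw [hx, dot_mulVec, hF.1.1]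
      simp [dot, minkowski, e0, mulVec_diagonal, dotProduct, Fin.sum_univ_four]
    have b1 := (hp.1 i).timelike_sign hx3 hxt
    have b2 := (hH.1 i).timelike_sign hx3 hxt
    rw [hKx, h00] at b1
    rw [hHx] at b2
    have h := mul_pos (mul_pos b1 b2) (hpos i)
    have he : e0 0 = 1 := rfl
    rw [he] at h
    refine pos_of_mul_pos_left (b := (x 0 * Hp i 0 0 * H i 0 0) ^ 2) ?_ (sq_nonneg _)
    linarith
  have hall : (∀ i, 0 < Hp i 0 0 * Hm i 0 0) ∨ ∀ i, Hp i 0 0 * Hm i 0 0 < 0 := by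
    have h10 := hsign 1 0 (by decide)
    rcases lt_trichotomy (Hp 0 0 0 * Hm 0 0 0) 0 with h | h | h
    · refine Or.inr fun i => ?_
      by_cases hi : i = 0
      · rwa [hi]
      · exact neg_of_mul_pos_left (hsign i 0 hi) h.le
    · rw [h, mul_zero] at h10
      exact absurd h10 (lt_irrefl _)
    · refine Or.inl fun i => ?_
      by_cases hi : i = 0
      · rwa [hi]
      · exact pos_of_mul_pos_left (hsign i 0 hi) h.le
  rcases hall with hpos | hneg
  · obtain ⟨G, hG, h1, h2⟩ := hlift hm hpos
    exact ⟨G, hG, ⟨1, hone, fun i => by simp only [Matrix.one_mul, h1]⟩,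
      ⟨1, hone, fun i => by simp only [Matrix.one_mul, h2]⟩⟩
  · obtain ⟨K, hK, hK0⟩ := exists_isSOV_time_reversing
    obtain ⟨G, hG, h1, h2⟩ := hlift (hm.mul hK) fun i => by
      rw [hK0, mul_neg]
      exact neg_pos.2 (hneg i)
    refine ⟨G, hG, ⟨1, hone, fun i => by simp only [Matrix.one_mul, h1]⟩,
      VectorGeometryEquiv.symm hN ⟨K, hK, fun i => h2 i⟩⟩

/-- Every ordered pair of inequivalent vector geometries comes from a non-degenerate solution. -/
theorem exists_isNondegenerateSolution_of_not_equiv (hN : N = e0 ∨ N = e3)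
    {rho : Fin 5 → Fin 5 → ℝ} (hv : IsBoundaryData N rho v) (hnd : IsNondegenerateData v)
    {Hp Hm : Fin 5 → Mat} (hp : IsVectorGeometry N v Hp) (hm : IsVectorGeometry N v Hm)
    (hne : ¬ VectorGeometryEquiv N Hp Hm) :
    ∃ G, IsNondegenerateSolution (flipped N) N v G ∧
      VectorGeometryEquiv N (fun i => groupPhi N 1 (G i)) Hp ∧
      VectorGeometryEquiv N (fun i => groupPhi N (-1) (G i)) Hm := by
  obtain ⟨G, hG, h1, h2⟩ := exists_isSolution_of_isVectorGeometry hN hv hnd hp hm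
  exact ⟨G, ⟨hG, isNondegenerateFamily_of_not_equiv hN (isClosedData_flipped hN hv hnd) hG
    fun h => hne (((h1.symm hN).trans h).trans h2)⟩, h1, h2⟩

end FamilyLift

/-! ### The bivectors of a simplex -/

section Simplex

variable {g : Mat}

theorem affineIndependent_iff_edges {n : ℕ} (p : Fin (n + 1) → Vec) :
    AffineIndependent ℝ p ↔ LinearIndependent ℝ fun a : Fin n => p a.succ - p 0 := by
  rw [affineIndependent_iff_linearIndependent_vsub ℝ p 0,
    ← linearIndependent_equiv (finSuccAboveEquiv (0 : Fin (n + 1)))]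
  rfl

/-- The matrix whose columns are the edges of a simplex at its vertex `0`. -/
noncomputable def edgeMatrix (X : Fin 5 → Vec) : Mat := Matrix.of fun μ k => X k.succ μ - X 0 μ

theorem affineIndependent_iff_det_ne_zero (X : Fin 5 → Vec) :
    AffineIndependent ℝ X ↔ (edgeMatrix X).det ≠ 0 := by
  rw [affineIndependent_iff_edges, ← isUnit_iff_ne_zero, ← isUnit_iff_isUnit_det,
    ← Matrix.linearIndependent_cols_iff_isUnit]
  rfl

theorem act_zero (G : Mat) : act G 0 = 0 := by simp [act]

theorem act_sum {ι : Type*} (s : Finset ι) (G : Mat) (f : ι → Mat) :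
    act G (∑ a ∈ s, f a) = ∑ a ∈ s, act G (f a) := by
  simp only [act, Matrix.mul_sum, Matrix.sum_mul]

/-- The bivector `B i j` depends linearly on the edges of the tetrahedron `i`. -/
theorem simplexBivector_eq_act {X x : Fin 5 → Vec} {A : Mat} {i : Fin 5}
    (h : ∀ a b, a ≠ i → b ≠ i → X a - X b = A *ᵥ (x a - x b)) (j : Fin 5) :
    simplexBivector X i j = act A (simplexBivector x i j) := by
  rw [simplexBivector, simplexBivector, act_smul, act_sum]
  congr 1
  refine Finset.sum_congr rfl fun a _ => ?_
  rw [act_sum]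
  refine Finset.sum_congr rfl fun b _ => ?_
  rw [act_sum]
  refine Finset.sum_congr rfl fun c _ => ?_
  split_ifs with hc
  · rw [act_wedge, h b a hc.2.2.2.1 hc.2.2.1, h c a hc.2.2.2.2.1 hc.2.2.1]
  · rw [act_zero]

theorem simplexBivector_swap (X : Fin 5 → Vec) {i j : Fin 5} (hij : i ≠ j) :
    simplexBivector X i j = -simplexBivector X j i := by
  have hs : ∀ i j : Fin 5, (∑ a, ∑ b, ∑ c,
      if a < b ∧ b < c ∧ a ≠ i ∧ b ≠ i ∧ c ≠ i ∧ a ≠ j ∧ b ≠ j ∧ c ≠ j then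
        wedge (X b - X a) (X c - X a) else 0) = ∑ a, ∑ b, ∑ c,
      if a < b ∧ b < c ∧ a ≠ j ∧ b ≠ j ∧ c ≠ j ∧ a ≠ i ∧ b ≠ i ∧ c ≠ i then
        wedge (X b - X a) (X c - X a) else 0 := by
    intro i j
    refine Finset.sum_congr rfl fun a _ => Finset.sum_congr rfl fun b _ =>
      Finset.sum_congr rfl fun c _ => if_congr ?_ rfl rfl
    tauto
  rw [simplexBivector, simplexBivector, hs i j, ← neg_smul]
  congr 1
  rcases lt_or_gt_of_ne hij with h | h
  · rw [if_pos h, if_neg h.not_gt, add_comm (j : ℕ), pow_succ, mul_neg_one]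
  · rw [if_neg h.not_gt, if_pos h, add_comm (j : ℕ), pow_succ, mul_neg_one, neg_neg]

/-- The standard simplex, with vertices `0` and the standard basis. -/
noncomputable def standardSimplex : Fin 5 → Vec :=
  ![![0, 0, 0, 0], ![1, 0, 0, 0], ![0, 1, 0, 0], ![0, 0, 1, 0], ![0, 0, 0, 1]]

/-- The covectors of the facets of the standard simplex: the linear parts of its barycentric
coordinates. -/
noncomputable def standardNormal : Fin 5 → Vec :=
  ![![-1, -1, -1, -1], ![1, 0, 0, 0], ![0, 1, 0, 0], ![0, 0, 1, 0], ![0, 0, 0, 1]]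

theorem simplexBivector_standardSimplex {i j : Fin 5} (hij : i ≠ j) :
    simplexBivector standardSimplex i j =
      -hodge 1 (wedge (standardNormal j) (standardNormal i)) := by
  have key : ∀ i j : Fin 5, i < j → simplexBivector standardSimplex i j =
      -hodge 1 (wedge (standardNormal j) (standardNormal i)) := by
    intro i j hij
    have hA : ∀ a b c f h k : ℝ, -asym a b c f h k = asym (-a) (-b) (-c) (-f) (-h) (-k) := by
      intro a b c f h k
      rw [← neg_one_smul ℝ, asym_smul]; simp
    rw [← Matrix.diagonal_one, show (fun _ : Fin 4 => (1 : ℝ)) = ![1, 1, 1, 1] from by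
      ext μ; fin_cases μ <;> rfl, wedge_eq_asym, hodge_asym, hA]
    fin_cases i <;> fin_cases j <;> first
      | exact absurd hij (by decide)
      | (simp only [Fin.zero_eta, Fin.mk_one, Fin.reduceFinMk, simplexBivector,
          Fin.sum_univ_five]
         simp [standardSimplex, standardNormal, wedge_eq_asym, asym_smul]
         try norm_num [asym])
  rcases lt_or_gt_of_ne hij with h | h
  · exact key i j h
  · rw [simplexBivector_swap _ hij, key j i h, wedge_swap, hodge_neg, neg_neg]

theorem edgeMatrix_mulVec (X : Fin 5 → Vec) (a b : Fin 5) :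
    X a - X b = edgeMatrix X *ᵥ (standardSimplex a - standardSimplex b) := by
  have h : ∀ a, X a - X 0 = edgeMatrix X *ᵥ standardSimplex a := by
    intro a
    ext μ
    simp only [mulVec, dotProduct, Fin.sum_univ_four, edgeMatrix, of_apply, Pi.sub_apply]
    fin_cases a <;> simp [standardSimplex]
  rw [mulVec_sub, ← h, ← h, sub_sub_sub_cancel_right]

/-- The vectors `M i` are normal to the facets of the simplex `X`: up to the factor `a` they are
dual to the linear parts of its barycentric coordinates. -/
def IsDualNormal (g : Mat) (X M : Fin 5 → Vec) (a : ℝ) : Prop :=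
  ∀ i j k, dot g (M i) (X j - X k) = a * ((if i = j then 1 else 0) - if i = k then 1 else 0)

/-- The bivectors of a simplex are dual to the products of the normals of its facets. -/
theorem simplexBivector_eq_hodge (hg : IsMetric g) {X M : Fin 5 → Vec} {a : ℝ} (ha : a ≠ 0)
    (hX : AffineIndependent ℝ X) (h : IsDualNormal g X M a) {i j : Fin 5} (hij : i ≠ j) :
    simplexBivector X i j =
      (-((edgeMatrix X).det / a ^ 2)) • hodge g (wedge (M j) (M i)) := by
  set A := edgeMatrix X with hA
  have hdet : IsUnit A.det := isUnit_iff_ne_zero.2 ((affineIndependent_iff_det_ne_zero X).1 hX)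
  have hK : Aᵀ * A⁻¹ᵀ = 1 := by rw [← transpose_mul, nonsing_inv_mul _ hdet, transpose_one]
  have hM : ∀ i, A⁻¹ᵀ *ᵥ standardNormal i = a⁻¹ • g *ᵥ M i := by
    intro i
    have h1 : Aᵀ *ᵥ (g *ᵥ M i) = a • standardNormal i := by
      ext k
      have h2 : (Aᵀ *ᵥ (g *ᵥ M i)) k = dot g (M i) (X k.succ - X 0) := by
        rw [dot_comm hg.symm, dot]
        rfl
      rw [h2, h, Pi.smul_apply, smul_eq_mul]
      congr 1
      fin_cases i <;> fin_cases k <;> simp [standardNormal]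
    have h3 : A⁻¹ᵀ *ᵥ (Aᵀ *ᵥ (g *ᵥ M i)) = g *ᵥ M i := by
      rw [mulVec_mulVec, mul_eq_one_comm.1 hK, one_mulVec]
    rw [← h3, h1, mulVec_smul, smul_smul, inv_mul_cancel₀ ha, one_smul]
  have h1 : hodge 1 (act A⁻¹ᵀ (wedge (standardNormal j) (standardNormal i))) =
      (a⁻¹ * a⁻¹) • hodge g (wedge (M j) (M i)) := by
    rw [act_wedge, hM, hM, wedge_smul_left, wedge_smul_right, smul_smul, hodge_smul,
      hodge_eq_hodge_one g]
    congr 2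
    rw [← act_wedge, act, hg.symm]
  rw [simplexBivector_eq_act (fun a b _ _ => edgeMatrix_mulVec X a b),
    simplexBivector_standardSimplex hij, act_neg, ← det_smul_hodge_one_act hK, h1, smul_smul,
    ← neg_smul]
  congr 1
  field_simp

end Simplex

/-! ### The simplex of a non-degenerate solution -/

section Reconstruction

variable {g : Mat} {N : Vec} {v : Fin 5 → Fin 5 → Vec} {G : Fin 5 → Mat}

/-- Two frames with the same Gram matrix are related by an orthogonal map. -/
theorem exists_isO_of_gram {P p : Mat} (hp : p.det ≠ 0) (h : Pᵀ * g * P = pᵀ * g * p) :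
    ∃ A : Mat, Aᵀ * g * A = g ∧ A * p = P := by
  have hp' := isUnit_iff_ne_zero.2 hp
  have h1 : p * p⁻¹ = 1 := mul_nonsing_inv _ hp'
  have h2 : p⁻¹ᵀ * pᵀ = 1 := by rw [← transpose_mul, h1, transpose_one]
  refine ⟨P * p⁻¹, ?_, by rw [Matrix.mul_assoc, nonsing_inv_mul _ hp', Matrix.mul_one]⟩
  calc (P * p⁻¹)ᵀ * g * (P * p⁻¹) = p⁻¹ᵀ * (Pᵀ * g * P) * p⁻¹ := by
        simp only [transpose_mul, Matrix.mul_assoc]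
    _ = (p⁻¹ᵀ * pᵀ) * g * (p * p⁻¹) := by rw [h]; simp only [Matrix.mul_assoc]
    _ = g := by rw [h1, h2, Matrix.one_mul, Matrix.mul_one]

/-- The orthogonal map `D` with `D N = N` that multiplies the vectors orthogonal to `N` by the
sign `κ`. -/
theorem exists_isO_fixing_normal (hg : IsMetric g) (hN : IsNormalized g N) {κ : ℝ}
    (hκ : κ = 1 ∨ κ = -1) : ∃ D : Mat, Dᵀ * g * D = g ∧ D.det = κ ∧ D *ᵥ N = N ∧
      ∀ x, dot g x N = 0 → D *ᵥ x = κ • x := by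
  rcases hκ with rfl | rfl
  · exact ⟨1, by simp, det_one, one_mulVec N, fun x _ => by rw [one_mulVec, one_smul]⟩
  · refine ⟨-reflection g N, ?_, ?_, ?_, fun x hx => ?_⟩
    · simpa using reflection_isO hg.symm hN.ne_zero
    · rw [det_neg_mat, reflection_det g hN.ne_zero]
    · rw [neg_mulVec, reflection_self hg.symm hN.ne_zero, neg_neg]
    · rw [neg_mulVec, reflection_of_dot_eq_zero hg.symm hx, neg_one_smul]

theorem transpose_mul_mul_apply (g P : Mat) (s t : Fin 4) :
    (Pᵀ * g * P) s t = dot g (P.col s) (P.col t) := by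
  rw [Matrix.mul_assoc, mul_apply]
  rfl

/-- Simplices with the same edge lengths are congruent. -/
theorem exists_isO_of_lengths (hg : gᵀ = g) {X X' : Fin 5 → Vec} (hX : AffineIndependent ℝ X)
    (h : ∀ m l, dot g (X' m - X' l) (X' m - X' l) = dot g (X m - X l) (X m - X l)) :
    ∃ O : Mat, Oᵀ * g * O = g ∧ ∀ a b, X' a - X' b = O *ᵥ (X a - X b) := by
  have hpol : ∀ (Y : Fin 5 → Vec) (s t : Fin 5), dot g (Y s - Y 0) (Y t - Y 0) =
      (dot g (Y s - Y 0) (Y s - Y 0) + dot g (Y t - Y 0) (Y t - Y 0) -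
        dot g (Y s - Y t) (Y s - Y t)) / 2 := by
    intro Y s t
    simp only [dot_sub_left, dot_sub_right, dot_comm hg (Y t) (Y s), dot_comm hg (Y 0)]
    ring
  obtain ⟨O, hO, hOX⟩ := exists_isO_of_gram (g := g) (P := edgeMatrix X') (p := edgeMatrix X)
    ((affineIndependent_iff_det_ne_zero X).1 hX) (by
      ext s t
      rw [transpose_mul_mul_apply, transpose_mul_mul_apply]
      show dot g (X' s.succ - X' 0) (X' t.succ - X' 0) = dot g (X s.succ - X 0) (X t.succ - X 0)
      rw [hpol X', hpol X, h, h, h])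
  refine ⟨O, hO, fun a b => ?_⟩
  rw [edgeMatrix_mulVec X', edgeMatrix_mulVec X, mulVec_mulVec, hOX]

/-- The simplex whose facets have the weighted normals `m i • G i N` of a solution. Its scale is
chosen so that its bivectors are those of the solution, up to a common sign `ρ`. -/
theorem exists_simplex (hD : IsClosedData g N v) (hG : IsSolution g N v G)
    (hnd : IsNondegenerateFamily N G) : ∃ (X : Fin 5 → Vec) (m : Fin 5 → ℝ) (a ρ : ℝ),
      AffineIndependent ℝ X ∧ (∀ i, m i ≠ 0) ∧ 0 < a ∧ (ρ = 1 ∨ ρ = -1) ∧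
      IsDualNormal g X (fun i => m i • G i *ᵥ N) a ∧ ∀ i j, i ≠ j →
        simplexBivector X i j = ρ • hodge g (wedge (G i *ᵥ v i j) (G i *ᵥ N)) := by
  have hg := hD.metric
  obtain ⟨s, m, hM⟩ := hD.exists_isMinkowskiForm hG hnd
  set M : Fin 5 → Vec := fun i => m i • G i *ᵥ N with hMdef
  set E : Mat := Matrix.of fun μ k => M k.succ μ with hE
  have hEdet : E.det ≠ 0 := by
    rw [← isUnit_iff_ne_zero, ← isUnit_iff_isUnit_det, ← linearIndependent_cols_iff_isUnit]
    exact IsClosedData.linearIndependent_smul hM.ne_zero hnd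
  have hEu := isUnit_iff_ne_zero.2 hEdet
  set a : ℝ := √|E.det| with ha
  have ha0 : 0 < a := Real.sqrt_pos.2 (abs_pos.2 hEdet)
  have ha2 : a ^ 2 = |E.det| := Real.sq_sqrt (abs_nonneg _)
  set A : Mat := a • (g * E⁻¹ᵀ) with hA
  set X : Fin 5 → Vec := fun j => A *ᵥ standardSimplex j with hXdef
  have hEA : Eᵀ * g * A = a • (1 : Mat) := by
    rw [hA, Matrix.mul_smul, Matrix.mul_assoc, ← Matrix.mul_assoc g, hg.sq, Matrix.one_mul,
      ← transpose_mul, nonsing_inv_mul _ hEu, transpose_one]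
  have hedge : edgeMatrix X = A := by
    ext μ k
    have h1 : X k.succ - X 0 = A *ᵥ Pi.single k 1 := by
      rw [hXdef, ← mulVec_sub]
      congr 1
      ext ν
      fin_cases k <;> fin_cases ν <;> simp [standardSimplex]
    rw [mulVec_single_one] at h1
    exact congrFun h1 μ
  have hAdet : A.det = a ^ 4 * E.det⁻¹ := by
    rw [hA, det_smul, det_mul, hg.det, det_transpose, det_nonsing_inv, Ring.inverse_eq_inv',
      Fintype.card_fin, one_mul]
  have hdual : IsDualNormal g X M a := by
    -- on the normals of index `k + 1` this is the definition of `A`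
    have hsucc : ∀ (k : Fin 4) (j : Fin 5), dot g (M k.succ) (X j) = a * standardSimplex j k := by
      intro k j
      have h1 : dot g (M k.succ) (X j) = ((Eᵀ * g * A) *ᵥ standardSimplex j) k := by
        rw [Matrix.mul_assoc, ← mulVec_mulVec, ← mulVec_mulVec]
        rfl
      rw [h1, hEA, smul_mulVec, one_mulVec, Pi.smul_apply, smul_eq_mul]
    have hzero : ∀ j, dot g (M 0) (X j) = -∑ k : Fin 4, a * standardSimplex j k := by
      intro j
      have h1 : M 0 = -∑ k : Fin 4, M k.succ :=
        eq_neg_of_add_eq_zero_left (by rw [← Fin.sum_univ_succ]; exact hM.sum_eq_zero)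
      rw [h1, dot_neg_left, dot_comm hg.symm, dot_sum_right]
      simp only [dot_comm hg.symm (X j), hsucc]
    intro i j k
    rw [dot_sub_right]
    refine Fin.cases ?_ (fun i => ?_) i
    · rw [hzero, hzero, Fin.sum_univ_four, Fin.sum_univ_four]
      fin_cases j <;> fin_cases k <;> simp [standardSimplex]
    · rw [hsucc, hsucc, ← mul_sub]
      congr 1
      fin_cases i <;> fin_cases j <;> fin_cases k <;> simp [standardSimplex]
  have hX : AffineIndependent ℝ X := by
    rw [affineIndependent_iff_det_ne_zero, hedge, hAdet]
    exact mul_ne_zero (pow_ne_zero _ ha0.ne') (inv_ne_zero hEdet)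
  have hc : (edgeMatrix X).det / a ^ 2 = 1 ∨ (edgeMatrix X).det / a ^ 2 = -1 := by
    have h1 : (edgeMatrix X).det / a ^ 2 = |E.det| / E.det := by
      rw [hedge, hAdet, ← ha2]
      field_simp
    rw [h1]
    rcases abs_choice E.det with h | h <;> rw [h]
    · exact Or.inl (div_self hEdet)
    · exact Or.inr (by rw [neg_div, div_self hEdet])
  have hss : s * s = 1 := mul_self_eq_one_iff.2 hM.sign
  refine ⟨X, m, a, -((edgeMatrix X).det / a ^ 2) * s, hX, hM.ne_zero, ha0, ?_, hdual,
    fun i j hij => ?_⟩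
  · rcases hc with h | h <;> rcases hM.sign with h' | h' <;> rw [h, h'] <;> norm_num
  · rw [simplexBivector_eq_hodge hg ha0.ne' hX hdual hij, hM.wedge_eq i j hij, hodge_smul,
      smul_smul, mul_assoc, hss, mul_one]

/-- The tetrahedra of the simplex, moved back to the space orthogonal to `N` by the rotations of
the solution, are the boundary tetrahedra. -/
theorem isMatchedLengths_of_simplex (hD : IsClosedData g N v) (hG : IsSolution g N v G)
    {X : Fin 5 → Vec} {m : Fin 5 → ℝ} {a ρ : ℝ} (hm : ∀ i, m i ≠ 0) (hρ : ρ = 1 ∨ ρ = -1)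
    (hdual : IsDualNormal g X (fun i => m i • G i *ᵥ N) a)
    (hB : ∀ i j, i ≠ j →
      simplexBivector X i j = ρ • hodge g (wedge (G i *ᵥ v i j) (G i *ᵥ N))) :
    IsMatchedLengths g N v fun m l => dot g (X m - X l) (X m - X l) := by
  have hg := hD.metric
  intro i
  obtain ⟨H, hH, hHG, -⟩ := (hG.1 i).exists_inv hg
  obtain ⟨k, hk⟩ := exists_ne i
  have hHN : H *ᵥ (G i *ᵥ N) = N := by rw [mulVec_mulVec, hHG, one_mulVec]
  refine ⟨fun j => H *ᵥ (X j - X k), ⟨fun j hj => ?_, ρ, hρ, fun j hj => ?_⟩,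
    fun p q _ _ => ?_⟩
  · show dot g (H *ᵥ (X j - X k)) N = 0
    rw [← hHN, hH.dot, dot_comm hg.symm]
    have h1 := hdual i j k
    rw [if_neg hj.symm, if_neg hk.symm, sub_zero, mul_zero, dot_smul_left] at h1
    exact (mul_eq_zero.1 h1).resolve_left (hm i)
  · rw [simplexBivector_eq_act (X := fun j => H *ᵥ (X j - X k)) (x := X) (A := H)
      (fun p q _ _ => by rw [← mulVec_sub, sub_sub_sub_cancel_right]), hB i j hj.symm, act_smul,
      dataBivector, ← hodge_act g H _ hg.symm hg.sq hH, act_wedge, hHN, mulVec_mulVec, hHG,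
      one_mulVec]
  · show dot g (H *ᵥ (X p - X k) - H *ᵥ (X q - X k)) (H *ᵥ (X p - X k) - H *ᵥ (X q - X k)) = _
    rw [← mulVec_sub, sub_sub_sub_cancel_right, hH.dot]

/-- The geometric rotations of every simplex with the edge lengths of `X` have determinant `ρ`. For
the simplex moved by `O`, the sign in the bivectors is `ρ * det O`. It is absorbed by a factor `D`,
whose determinant is this sign too. -/
theorem orientationsMatching_of_simplex (hD : IsClosedData g N v) (hG : IsSolution g N v G)
    {X : Fin 5 → Vec} {m : Fin 5 → ℝ} {a ρ : ℝ} (hX : AffineIndependent ℝ X)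
    (hm : ∀ i, m i ≠ 0) (ha : 0 < a) (hρ : ρ = 1 ∨ ρ = -1)
    (hdual : IsDualNormal g X (fun i => m i • G i *ᵥ N) a)
    (hB : ∀ i j, i ≠ j →
      simplexBivector X i j = ρ • hodge g (wedge (G i *ᵥ v i j) (G i *ᵥ N))) :
    OrientationsMatching g N v fun m l => dot g (X m - X l) (X m - X l) := by
  have hg := hD.metric
  refine ⟨⟨X, hX, fun _ _ => rfl⟩, fun X' hX' => ⟨ρ, hρ, fun i => ?_⟩⟩
  obtain ⟨O, hO, hOX⟩ := exists_isO_of_lengths hg.symm hX hX'.2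
  have hOdot : ∀ x y, dot g (O *ᵥ x) (O *ᵥ y) = dot g x y := fun x y => by rw [dot_mulVec, hO]
  have hOdet := det_eq_one_or_neg_one hg hO
  have hκ : ρ * O.det = 1 ∨ ρ * O.det = -1 := by
    rcases hρ with h | h <;> rcases hOdet with h' | h' <;> rw [h, h'] <;> norm_num
  obtain ⟨D, -, hDdet, hDN, hDv⟩ := exists_isO_fixing_normal hg hD.normalized hκ
  have hnn := hD.dot_normal hG i
  -- the sign that makes the normal `O (G i N)` point outwards
  obtain ⟨ε, hε, hεm⟩ : ∃ ε : ℝ, (ε = 1 ∨ ε = -1) ∧ ε * (m i * dot g N N) < 0 := by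
    have h0 : m i * dot g N N ≠ 0 := mul_ne_zero (hm i) hD.normalized.ne_zero
    rcases lt_or_gt_of_ne h0 with h | h
    · exact ⟨1, Or.inl rfl, by linarith⟩
    · exact ⟨-1, Or.inr rfl, by linarith⟩
  have hεε : ε * ε = 1 := mul_self_eq_one_iff.2 hε
  set n : Vec := ε • O *ᵥ (G i *ᵥ N) with hn
  have hnn' : dot g n n = dot g N N := by
    rw [hn, dot_smul_left, dot_smul_right, hOdot, hnn, ← mul_assoc, hεε, one_mul]
  have hndot : ∀ j k, dot g n (X' j - X' k) = ε * dot g (G i *ᵥ N) (X j - X k) := fun j k => by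
    rw [hn, dot_smul_left, hOX, hOdot]
  have hdual' : ∀ j k, m i * dot g (G i *ᵥ N) (X j - X k) =
      a * ((if i = j then 1 else 0) - if i = k then 1 else 0) := fun j k => by
    rw [← hdual i j k, dot_smul_left]
  refine ⟨ε • (O * G i * D), ⟨n, fun j => (ρ * O.det * ε) • O *ᵥ (G i *ᵥ v i j),
    ⟨?_, fun j k hj hk => ?_, fun j hj => ?_⟩, fun j hj => ⟨?_, ?_⟩, ?_, fun j hj => ?_⟩, ?_⟩
  · rw [IsNormalized, hnn']
    exact hD.normalized
  · have h1 := hdual' j k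
    rw [if_neg hj.symm, if_neg hk.symm, sub_zero, mul_zero] at h1
    rw [hndot, (mul_eq_zero.1 h1).resolve_left (hm i), mul_zero]
  · have h1 := hdual' i j
    rw [if_pos rfl, if_neg hj.symm, sub_zero, mul_one] at h1
    have h2 : dot g n (X' i - X' j) / dot g n n * (m i * dot g N N) ^ 2 =
        a * (ε * (m i * dot g N N)) := by
      rw [hndot, hnn', ← h1]
      field_simp [hD.normalized.ne_zero]
    exact neg_of_mul_neg_left (h2 ▸ mul_neg_of_pos_of_neg ha hεm) (sq_nonneg _)
  · rw [dot_smul_left, hn, dot_smul_right, hOdot, hD.dot_face_normal hG hj.symm, mul_zero, mul_zero]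
  · rw [simplexBivector_eq_act (fun p q _ _ => hOX p q), hB i j hj.symm, act_smul, hn,
      wedge_smul_left, wedge_smul_right, ← act_wedge O, hodge_smul, hodge_smul,
      hodge_act_eq_det_smul hg hO, smul_smul, smul_smul]
    congr 1
    rcases hOdet with h | h <;> rw [h] <;> linear_combination -ρ * hεε
  · rw [smul_mulVec, ← mulVec_mulVec, hDN, ← mulVec_mulVec]
  · rw [smul_mulVec, ← mulVec_mulVec, hDv _ (hD.orthogonal i j hj.symm), mulVec_smul, smul_smul,
      ← mulVec_mulVec, mul_comm ε]
  · rw [det_smul, det_mul, det_mul, hDdet, (hG.1 i).2, Fintype.card_fin]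
    have h1 : O.det * O.det = 1 := mul_self_eq_one_iff.2 hOdet
    linear_combination ρ * (ε ^ 2 + 1) * hεε * O.det ^ 2 + ρ * h1

/-- A non-degenerate solution reconstructs a simplex with matching lengths and orientations. -/
theorem exists_matching_of_isNondegenerateSolution (hN : N = e0 ∨ N = e3)
    (hD : IsClosedData (flipped N) N v) (hG : IsNondegenerateSolution (flipped N) N v G) :
    ∃ len : Fin 5 → Fin 5 → ℝ, IsMatchedLengths (flipped N) N v len ∧
      OrientationsMatching (flipped N) N v len ∧
      ((∃ X, IsReconstructedSimplex splitMetric len X) ∨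
        ∃ X, IsReconstructedSimplex euclideanMetric len X) := by
  obtain ⟨X, m, a, ρ, hX, hm, ha, hρ, hdual, hB⟩ := exists_simplex hD hG.1 hG.2
  refine ⟨_, isMatchedLengths_of_simplex hD hG.1 hm hρ hdual hB,
    orientationsMatching_of_simplex hD hG.1 hX hm ha hρ hdual hB, ?_⟩
  rcases hN with rfl | rfl
  · exact Or.inr ⟨X, hX, fun p q => by rw [flipped_e0, euclideanMetric]⟩
  · -- the coordinates `1` and `3` are exchanged
    let s : Vec ≃ₗ[ℝ] Vec := LinearEquiv.funCongrLeft ℝ ℝ (Equiv.swap 1 3)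
    refine Or.inl ⟨fun j => s (X j), ?_, fun p q => ?_⟩
    · exact hX.map' s.toLinearMap.toAffineMap s.injective
    · show dot splitMetric (s (X p) - s (X q)) (s (X p) - s (X q)) =
        dot (flipped e3) (X p - X q) (X p - X q)
      rw [← map_sub, flipped_e3, splitMetric]
      generalize X p - X q = x
      have hs : ∀ μ, s x μ = x (Equiv.swap 1 3 μ) := fun _ => rfl
      simp only [dot, mulVec_diagonal, dotProduct, Fin.sum_univ_four, hs]
      have h0 : Equiv.swap (1 : Fin 4) 3 0 = 0 := by decide
      have h1 : Equiv.swap (1 : Fin 4) 3 1 = 3 := by decide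
      have h2 : Equiv.swap (1 : Fin 4) 3 2 = 2 := by decide
      have h3 : Equiv.swap (1 : Fin 4) 3 3 = 1 := by decide
      rw [h0, h1, h2, h3]
      simp only [cons_val]
      ring

end Reconstruction

/-! ### The solution of a simplex -/

section FromSimplex

variable {g : Mat} {N : Vec} {v : Fin 5 → Fin 5 → Vec}

/-- A frame made of a normal and three vectors orthogonal to it. -/
noncomputable def normalFrame (n : Vec) (F : Fin 3 → Vec) : Mat :=
  Matrix.of fun μ k => (Fin.cons n F : Fin 4 → Vec) k μ

theorem normalFrame_gram (hg : gᵀ = g) {n : Vec} {F : Fin 3 → Vec}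
    (hF : ∀ a, dot g (F a) n = 0) (s t : Fin 4) :
    ((normalFrame n F)ᵀ * g * normalFrame n F) s t =
      (Fin.cons (Fin.cons (dot g n n) fun _ => 0)
        fun a => Fin.cons 0 fun b => dot g (F a) (F b) : Fin 4 → Fin 4 → ℝ) s t := by
  rw [transpose_mul_mul_apply]
  have h0 : (normalFrame n F).col 0 = n := rfl
  have h1 : ∀ a : Fin 3, (normalFrame n F).col a.succ = F a := fun _ => rfl
  refine Fin.cases ?_ (fun a => ?_) s <;> refine Fin.cases ?_ (fun b => ?_) t
  · rw [h0]; rfl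
  · rw [h0, h1, dot_comm hg, hF]; rfl
  · rw [h0, h1, hF]; rfl
  · rw [h1, h1]; rfl

theorem normalFrame_det_sq (hg : IsMetric g) {n : Vec} {F : Fin 3 → Vec}
    (hF : ∀ a, dot g (F a) n = 0) :
    (normalFrame n F).det ^ 2 = dot g n n * (Matrix.of fun a b => dot g (F a) (F b)).det := by
  have h1 : ((normalFrame n F)ᵀ * g * normalFrame n F).det = (normalFrame n F).det ^ 2 := by
    rw [det_mul, det_mul, det_transpose, hg.det]
    ring
  rw [← h1, det_succ_row_zero, Fin.sum_univ_succ]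
  simp only [normalFrame_gram hg.symm hF]
  rw [Finset.sum_eq_zero fun a _ => by simp]
  simp only [Fin.val_zero, pow_zero, one_mul, Fin.cons_zero, add_zero, Fin.succAbove_zero]
  congr 2
  ext a b
  simp [normalFrame_gram hg.symm hF]

/-- Congruent triples of edges, with unit normals, are related by an orthogonal map. The normals
have the same sign, because the product of this sign with the Gram determinant of the edges is
the square of a determinant. -/
theorem exists_isO_of_edges (hg : IsMetric g) {n : Vec} {E F : Fin 3 → Vec}
    (hN : IsNormalized g N) (hn : IsNormalized g n) (hE : ∀ a, dot g (E a) N = 0)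
    (hF : ∀ a, dot g (F a) n = 0) (hEF : ∀ a b, dot g (F a) (F b) = dot g (E a) (E b))
    (hli : LinearIndependent ℝ F) :
    ∃ A : Mat, Aᵀ * g * A = g ∧ A *ᵥ N = n ∧ ∀ a, A *ᵥ E a = F a := by
  have hdet : (normalFrame n F).det ≠ 0 := by
    rw [← isUnit_iff_ne_zero, ← isUnit_iff_isUnit_det, ← linearIndependent_cols_iff_isUnit]
    show LinearIndependent ℝ (Fin.cons n F : Fin 4 → Vec)
    rw [linearIndependent_finCons]
    refine ⟨hli, fun hmem => hn.ne_zero ?_⟩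
    have : ∀ x ∈ Submodule.span ℝ (Set.range F), dot g x n = 0 := by
      intro x hx
      induction hx using Submodule.span_induction with
      | mem x hx =>
        obtain ⟨a, rfl⟩ := hx
        exact hF a
      | zero => simp [dot]
      | add a b _ _ ha hb => rw [dot_add_left, ha, hb, add_zero]
      | smul c a _ ha => rw [dot_smul_left, ha, mul_zero]
    exact this n hmem
  have h1 := normalFrame_det_sq hg hF
  have h2 := normalFrame_det_sq hg hE
  simp only [hEF] at h1
  set D := (Matrix.of fun a b => dot g (E a) (E b)).det with hD
  have hpos : 0 < dot g n n * D := h1 ▸ (by positivity)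
  have hD0 : D ≠ 0 := right_ne_zero_of_mul hpos.ne'
  have hp : (normalFrame N E).det ≠ 0 := by
    intro h
    rw [h, zero_pow two_ne_zero] at h2
    exact mul_ne_zero hN.ne_zero hD0 h2.symm
  have hpos' : 0 < dot g N N * D := h2 ▸ (by positivity)
  have hnN : dot g n n = dot g N N := by
    rcases hn with h | h <;> rcases hN with h' | h' <;> rw [h] at hpos ⊢ <;> rw [h'] at hpos' ⊢ <;>
      exfalso <;> linarith
  obtain ⟨A, hA, hAp⟩ := exists_isO_of_gram (g := g) hp (P := normalFrame n F) (by
    ext s t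
    rw [normalFrame_gram hg.symm hF, normalFrame_gram hg.symm hE, hnN]
    simp only [hEF])
  have hcol : ∀ k, A *ᵥ (normalFrame N E).col k = (normalFrame n F).col k := fun k => by
    rw [← hAp]
    rfl
  exact ⟨A, hA, hcol 0, fun a => hcol a.succ⟩

/-- The geometric rotations are orthogonal: they agree, up to the reflection along `N`, with the
congruence of the tetrahedra. -/
theorem IsGeometricRotation.isO (hD : IsClosedData g N v) {len : Fin 5 → Fin 5 → ℝ}
    (hlen : IsMatchedLengths g N v len) {X : Fin 5 → Vec} (hX : IsReconstructedSimplex g len X)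
    {i : Fin 5} {G : Mat} (hG : IsGeometricRotation g N v X i G) : Gᵀ * g * G = g := by
  have hg := hD.metric
  obtain ⟨n, w, ⟨hn, hnX, -⟩, hw, hGN, hGv⟩ := hG
  obtain ⟨x, ⟨hxN, r, hr, hxB⟩, hxl⟩ := hlen i
  have hpol : ∀ (Y : Fin 5 → Vec) (p q k : Fin 5), dot g (Y p - Y k) (Y q - Y k) =
      (dot g (Y p - Y k) (Y p - Y k) + dot g (Y q - Y k) (Y q - Y k) -
        dot g (Y p - Y q) (Y p - Y q)) / 2 := by
    intro Y p q k
    simp only [dot_sub_left, dot_sub_right, dot_comm hg.symm (Y q) (Y p), dot_comm hg.symm (Y k)]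
    ring
  have hi : ∀ b, i.succAbove b ≠ i := Fin.succAbove_ne i
  obtain ⟨A, hA, hAN, hAE⟩ := exists_isO_of_edges hg (n := n)
    (E := fun a => x (i.succAbove a.succ) - x (i.succAbove 0))
    (F := fun a => X (i.succAbove a.succ) - X (i.succAbove 0)) hD.normalized hn
    (fun a => by rw [dot_sub_left, hxN _ (hi _), hxN _ (hi _), sub_zero])
    (fun a => by rw [dot_comm hg.symm, hnX _ _ (hi _) (hi _)])
    (fun a b => by
      rw [hpol X, hpol x, hX.2, hX.2, hX.2, hxl _ _ (hi _) (hi _), hxl _ _ (hi _) (hi _),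
        hxl _ _ (hi _) (hi _)])
    ((affineIndependent_iff_edges fun b => X (i.succAbove b)).1
      (hX.1.comp_embedding (Fin.succAboveEmb i)))
  have hAX : ∀ a b, a ≠ i → b ≠ i → X a - X b = A *ᵥ (x a - x b) := by
    have h1 : ∀ a, a ≠ i → X a - X (i.succAbove 0) = A *ᵥ (x a - x (i.succAbove 0)) := by
      intro a ha
      obtain ⟨c, rfl⟩ := Fin.exists_succAbove_eq ha
      refine Fin.cases ?_ (fun c => ?_) c
      · rw [sub_self, sub_self, mulVec_zero]
      · exact (hAE c).symm
    intro a b ha hb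
    rw [← sub_sub_sub_cancel_right (X a) (X b) (X (i.succAbove 0)), h1 a ha, h1 b hb, ← mulVec_sub,
      sub_sub_sub_cancel_right]
  have hAdet := det_eq_one_or_neg_one hg hA
  have hδ : r * A.det = 1 ∨ r * A.det = -1 := by
    rcases hr with h | h <;> rcases hAdet with h' | h' <;> rw [h, h'] <;> norm_num
  have hwA : ∀ j, j ≠ i → w j = (r * A.det) • A *ᵥ v i j := by
    intro j hj
    refine eq_of_wedge_eq (hw j hj).1 (n := n) ?_ hn.ne_zero ?_
    · rw [dot_smul_left, ← hAN, dot_mulVec, hA, hD.orthogonal i j hj.symm, mul_zero]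
    · refine hodge_injective hg (wedge_transpose _ _) (wedge_transpose _ _) ?_
      rw [← (hw j hj).2, simplexBivector_eq_act hAX, hxB j hj, act_smul, dataBivector,
        wedge_smul_left, hodge_smul, ← hAN, ← act_wedge, hodge_act_eq_det_smul hg hA, smul_smul,
        mul_assoc, mul_self_eq_one_iff.2 hAdet, mul_one]
  obtain ⟨D, hDO, -, hDN, hDv⟩ := exists_isO_fixing_normal hg hD.normalized hδ
  have hGA : G = A * D := by
    refine hD.mat_ext i ?_ fun j hij => ?_
    · rw [hGN, ← mulVec_mulVec, hDN, hAN]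
    · rw [hGv j hij.symm, hwA j hij.symm, ← mulVec_mulVec, hDv _ (hD.orthogonal i j hij),
        mulVec_smul]
  rw [hGA]
  exact isO_mul hA hDO

/-- Four of the five normals of a simplex span the space: they are dual to the four edges at the
vertex opposite to the fifth one. -/
theorem isNondegenerateFamily_of_outward {X : Fin 5 → Vec} {G : Fin 5 → Mat}
    (h : ∀ i, IsOutwardNormal g X i (G i *ᵥ N)) : IsNondegenerateFamily N G := by
  intro k
  rw [span_eq_top_iff]
  intro y hy
  set P : Mat := Matrix.of fun a => G (k.succAbove a) *ᵥ N with hP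
  set U : Mat := Matrix.of fun μ b => X (k.succAbove b) μ - X k μ with hU
  have hk : ∀ a, k.succAbove a ≠ k := Fin.succAbove_ne k
  have hPU : P * (g * U) = diagonal fun a =>
      dot g (G (k.succAbove a) *ᵥ N) (X (k.succAbove a) - X k) := by
    ext a b
    have h1 : (P * (g * U)) a b =
        dot g (G (k.succAbove a) *ᵥ N) (X (k.succAbove b) - X k) := rfl
    rw [h1, diagonal_apply]
    split_ifs with hab
    · rw [hab]
    · exact (h _).2.1 _ _ (fun e => hab (Fin.succAbove_right_injective e).symm) (hk a).symm
  have hdet : P.det ≠ 0 := by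
    refine left_ne_zero_of_mul (b := (g * U).det) ?_
    rw [← det_mul, hPU, det_diagonal, Finset.prod_ne_zero_iff]
    intro a _ h0
    have h1 := (h (k.succAbove a)).2.2 k (hk a).symm
    rw [h0, zero_div] at h1
    exact lt_irrefl _ h1
  refine eq_zero_of_mulVec_eq_zero hdet (funext fun a => ?_)
  exact (dotProduct_comm _ _).trans (hy _ ⟨_, hk a, rfl⟩)

/-- The geometric rotations of a reconstructed simplex, composed with the reflection along `N` if
they reverse the orientation, form a non-degenerate solution. -/
theorem exists_isNondegenerateSolution_of_matching (hD : IsClosedData g N v)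
    {len : Fin 5 → Fin 5 → ℝ} (hlen : IsMatchedLengths g N v len)
    (hor : OrientationsMatching g N v len) : ∃ G, IsNondegenerateSolution g N v G := by
  have hg := hD.metric
  obtain ⟨⟨X, hX⟩, hor⟩ := hor
  obtain ⟨r, hr, hor⟩ := hor X hX
  choose G hG hGdet using hor
  obtain ⟨D, hDO, hDdet, hDN, hDv⟩ := exists_isO_fixing_normal hg hD.normalized hr
  have hGN : ∀ i, (G i * D) *ᵥ N = G i *ᵥ N := fun i => by rw [← mulVec_mulVec, hDN]
  have hB : ∀ i j, i ≠ j →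
      simplexBivector X i j = hodge g (wedge (G i *ᵥ v i j) (G i *ᵥ N)) := by
    intro i j hij
    obtain ⟨n, w, -, hw, hn, hv⟩ := hG i
    rw [hn, hv j hij.symm, (hw j hij.symm).2]
  refine ⟨fun i => G i * D, (hD.isSolution_iff _).2 ⟨fun i => ⟨?_, ?_⟩, fun i j hij => ?_⟩,
    isNondegenerateFamily_of_outward (g := g) (X := X) fun i => ?_⟩
  · exact isO_mul ((hG i).isO hD hlen hX) hDO
  · rw [det_mul, hGdet, hDdet, mul_self_eq_one_iff.2 hr]
  · rw [hGN, hGN, ← mulVec_mulVec, ← mulVec_mulVec, hDv _ (hD.orthogonal i j hij),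
      hDv _ (hD.orthogonal j i hij.symm), mulVec_smul, mulVec_smul, wedge_smul_left,
      wedge_smul_left, ← smul_neg]
    congr 1
    refine hodge_injective hg (wedge_transpose _ _) (by simp [wedge_transpose]) ?_
    rw [hodge_neg, ← hB i j hij, ← hB j i hij.symm, simplexBivector_swap X hij]
  · obtain ⟨n, w, hn, -, hGn, -⟩ := hG i
    rw [hGN, hGn]
    exact hn

end FromSimplex

/-! ### The equivalence classes -/

section Classes

variable {N : Vec} {v : Fin 5 → Fin 5 → Vec} {G : Fin 5 → Mat}

/-- The vector geometries `Φ⁺(G i)` and `Φ⁻(G i)` represent all classes: a pair of `Φ⁺(G i)` and a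
third class would come from a solution which is equivalent neither to `G` nor to its reflection. -/
theorem groupPhi_equiv_or (hN : N = e0 ∨ N = e3) {rho : Fin 5 → Fin 5 → ℝ}
    (hv : IsBoundaryData N rho v) (hnd : IsNondegenerateData v)
    (hG : IsNondegenerateSolution (flipped N) N v G) {H : Fin 5 → Mat}
    (hH : IsVectorGeometry N v H) :
    VectorGeometryEquiv N (fun i => groupPhi N 1 (G i)) H ∨
      VectorGeometryEquiv N (fun i => groupPhi N (-1) (G i)) H := by
  have hD := isClosedData_flipped hN hv hnd
  refine or_iff_not_imp_left.2 fun hne => ?_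
  obtain ⟨G', hG', hp, hm⟩ := exists_isNondegenerateSolution_of_not_equiv hN hv hnd
    (isVectorGeometry_groupPhi hN (Or.inl rfl) hD hG.1) hH hne
  rcases hD.solutionEquiv_or hG hG' with h | h
  · exact (groupPhi_equiv_of_solutionEquiv hN (Or.inr rfl) h).trans hm
  · have h1 := groupPhi_equiv_of_solutionEquiv (σ := 1) hN (Or.inl rfl) h
    simp only [groupPhi_reflection hN] at h1
    exact absurd ((h1.trans hp).symm hN) (not_equiv_groupPhi hN hD hG)

theorem exactlyTwoClasses_isNondegenerateSolution (hN : N = e0 ∨ N = e3)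
    (hD : IsClosedData (flipped N) N v) (hG : IsNondegenerateSolution (flipped N) N v G) :
    ExactlyTwoClasses (IsNondegenerateSolution (flipped N) N v) (SolutionEquiv (flipped N)) :=
  ⟨G, _, hG, hD.reflected_isNondegenerateSolution hG (isNormalized_flipped hN),
    hD.not_solutionEquiv_reflected hG (isNormalized_flipped hN),
    fun _ hG' => hD.solutionEquiv_or hG hG'⟩

end Classes
end SimplexGeometry

theorem mainTheorem4 (N : Vec) (hN : N = e0 ∨ N = e3)
    (rho : Fin 5 → Fin 5 → ℝ) (v : Fin 5 → Fin 5 → Vec)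
    (hv : IsBoundaryData N rho v) (hnd : IsNondegenerateData v) :
    List.TFAE [
      -- lengths and orientations matching, and a non-degenerate split or Euclidean simplex
      ∃ len : Fin 5 → Fin 5 → ℝ, IsMatchedLengths (flipped N) N v len ∧
        OrientationsMatching (flipped N) N v len ∧
        ((∃ X, IsReconstructedSimplex splitMetric len X) ∨
          ∃ X, IsReconstructedSimplex euclideanMetric len X),
      -- there is a non-degenerate solution for the flipped data
      ∃ G, IsNondegenerateSolution (flipped N) N v G,
      -- there are exactly two classes of such solutions, related by reflections
      ExactlyTwoClasses (IsNondegenerateSolution (flipped N) N v) (SolutionEquiv (flipped N)) ∧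
        ∀ G, IsNondegenerateSolution (flipped N) N v G →
          ∀ e, IsNormalized (flipped N) e →
            IsNondegenerateSolution (flipped N) N v
              (fun i => reflection (flipped N) e * G i * reflection (flipped N) N) ∧
            ¬ SolutionEquiv (flipped N) G
              (fun i => reflection (flipped N) e * G i * reflection (flipped N) N),
      -- there are at least two classes of vector geometries
      AtLeastTwoClasses (IsVectorGeometry N v) (VectorGeometryEquiv N),
      -- there are exactly two classes of vector geometries
      ExactlyTwoClasses (IsVectorGeometry N v) (VectorGeometryEquiv N)] ∧
    -- every non-degenerate solution yields representatives of the two classes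
    (∀ G, IsNondegenerateSolution (flipped N) N v G →
      IsVectorGeometry N v (fun i => groupPhi N 1 (G i)) ∧
      IsVectorGeometry N v (fun i => groupPhi N (-1) (G i)) ∧
      ¬ VectorGeometryEquiv N (fun i => groupPhi N 1 (G i)) (fun i => groupPhi N (-1) (G i)) ∧
      ∀ H, IsVectorGeometry N v H →
        VectorGeometryEquiv N (fun i => groupPhi N 1 (G i)) H ∨
        VectorGeometryEquiv N (fun i => groupPhi N (-1) (G i)) H) ∧
    -- every ordered pair of inequivalent vector geometries is obtained in this way
    (∀ Hp Hm, IsVectorGeometry N v Hp → IsVectorGeometry N v Hm →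
      ¬ VectorGeometryEquiv N Hp Hm →
      ∃ G, IsNondegenerateSolution (flipped N) N v G ∧
        VectorGeometryEquiv N (fun i => groupPhi N 1 (G i)) Hp ∧
        VectorGeometryEquiv N (fun i => groupPhi N (-1) (G i)) Hm) := by
  have hD := isClosedData_flipped hN hv hnd
  have hvg : ∀ G, IsNondegenerateSolution (flipped N) N v G →
      IsVectorGeometry N v (fun i => groupPhi N 1 (G i)) ∧
      IsVectorGeometry N v (fun i => groupPhi N (-1) (G i)) ∧
      ¬ VectorGeometryEquiv N (fun i => groupPhi N 1 (G i)) (fun i => groupPhi N (-1) (G i)) ∧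
      ∀ H, IsVectorGeometry N v H →
        VectorGeometryEquiv N (fun i => groupPhi N 1 (G i)) H ∨
        VectorGeometryEquiv N (fun i => groupPhi N (-1) (G i)) H := fun G hG =>
    ⟨isVectorGeometry_groupPhi hN (Or.inl rfl) hD hG.1,
      isVectorGeometry_groupPhi hN (Or.inr rfl) hD hG.1, not_equiv_groupPhi hN hD hG,
      fun H hH => groupPhi_equiv_or hN hv hnd hG hH⟩
  refine ⟨?_, hvg, fun Hp Hm hp hm hne =>
    exists_isNondegenerateSolution_of_not_equiv hN hv hnd hp hm hne⟩
  tfae_have 1 → 2 := fun ⟨_, hlen, hor, _⟩ => exists_isNondegenerateSolution_of_matching hD hlen hor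
  tfae_have 2 → 1 := fun ⟨_, hG⟩ => exists_matching_of_isNondegenerateSolution hN hD hG
  tfae_have 2 → 3 := fun ⟨_, hG⟩ => ⟨exactlyTwoClasses_isNondegenerateSolution hN hD hG,
    fun _ hG' _ he => ⟨hD.reflected_isNondegenerateSolution hG' he,
      hD.not_solutionEquiv_reflected hG' he⟩⟩
  tfae_have 3 → 2 := fun ⟨⟨G, _, hG, _⟩, _⟩ => ⟨G, hG⟩
  tfae_have 2 → 5 := fun ⟨G, hG⟩ =>
    let ⟨h1, h2, h3, h4⟩ := hvg G hG
    ⟨_, _, h1, h2, h3, h4⟩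
  tfae_have 5 → 4 := fun ⟨H, H', hH, hH', hne, _⟩ => ⟨H, H', hH, hH', hne⟩
  tfae_have 4 → 2 := fun ⟨_, _, hp, hm, hne⟩ =>
    let ⟨G, hG, _⟩ := exists_isNondegenerateSolution_of_not_equiv hN hv hnd hp hm hne
    ⟨G, hG⟩
  tfae_finish
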